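/- Let $\mathbf T^3=\mathbf R^3/\mathbf Z^3$ with normalized Lebesgue measure. For $\delta>1$ let $B_\delta$ be the space of (continuous) real functions $f$ on $\mathbf T^3$ with $|f|_\delta:=\sum_{k\in\mathbf Z^3}|\mathcal F f(k)|\,\delta^{|k|}<\infty$, where $\mathcal F f(k)$ are the Fourier coefficients; for vector fields the norms of the components are added. Write $\langle F\rangle=\int_{\mathbf T^3}F\,dx$ and $v(\xi)=\xi/(1+\varepsilon^2|\xi|^2)^{1/2}$, and let $\mathbf P$ be the Leray projection onto divergence-free fields. Let $(M,\mu)$ be a probability space, $\delta_0>\delta_1>1$, $C_0>0$ and $\gamma\in[0,1]$. Let $(\rho_\theta(0))_{\theta\in M}$ and $(\xi_\theta(0))_{\theta\in M}$ be families of functions, respectively vector fields, in $B_{\delta_0}$ (measurable in $\theta$), and for $\varepsilon\in(0,1]$ let $E^0_\varepsilon,B^0_\varepsilon$ be vector fields in $B_{\delta_0}$, such that $$\nabla\cdot E^0_\varepsilon=\int_M\rho_\theta(0)\,d\mu(\theta)-1,\qquad \nabla\cdot B^0_\varepsilon=0,$$ $$\sup_\theta|\rho_\theta(0)|_{\delta_0}\le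 C_0,\qquad \sup_\theta|\xi_\theta(0)|_{\delta_0}\le C_0,\qquad |E^0_\varepsilon|_{\delta_0}+|B^0_\varepsilon|_{\delta_0}\le C_0\varepsilon^{-\gamma}.$$ Then there exist constants $\varepsilon_0>0$ and $C>0$ such that for every $\varepsilon\in(0,\varepsilon_0]$ there exist a time $T>0$ and families $(\rho_\theta)_\theta$, $(\xi_\theta)_\theta$ in $C([0,T],B_{\delta_1})$ which, together with a scalar potential $\phi$ and a vector potential $A$ with $\nabla\cdot A=0$, solve on $[0,T]\times\mathbf T^3$, in the classical sense and for all $\theta\in M$, the relativistic multifluid Vlasov–Maxwell system $$\partial_t\rho_\theta+\nabla\cdot(v(\xi_\theta)\rho_\theta)=0,\qquad \partial_t\xi_\theta+(v(\xi_\theta)\cdot\nabla)\xi_\theta=E+\varepsilon\,v(\xi_\theta)\times B,$$ $$-\Delta\phi=\int_M\rho_\theta\,d\mu(\theta)-1,\qquad \varepsilon^2\partial_t^2A-\Delta A=\varepsilon\,\mathbf P\Big(\int_M v(\xi_\theta)\rho_\theta\,d\mu(\theta)\Big),$$ $$E=-\nabla\phi-\varepsilon\partial_tA,\qquad B=\nabla\times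 A+\langle B^0_\varepsilon\rangle,$$ with initial data $\rho_\theta|_{t=0}=\rho_\theta(0)$, $\xi_\theta|_{t=0}=\xi_\theta(0)$, $E|_{t=0}=E^0_\varepsilon$, $B|_{t=0}=B^0_\varepsilon$, $\langle A|_{t=0}\rangle=0$. Moreover $E,B\in C([0,T],B_{\delta_1})$ and $$\sup_\theta\sup_{[0,T]}|\rho_\theta|_{\delta_1}+\sup_\theta\sup_{[0,T]}|\xi_\theta|_{\delta_1}\le C,\qquad \sup_{[0,T]}|E|_{\delta_1}+\sup_{[0,T]}|B|_{\delta_1}\le C\varepsilon^{-\gamma}.$$ In addition there is $T_0>0$, independent of $\varepsilon$, such that one can take $T\ge T_0$ for every $\varepsilon\in(0,\varepsilon_0]$ with $\langle E^0_\varepsilon\rangle=0$. -/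

import Mathlib

open Set Filter Topology MeasureTheory

noncomputable section

namespace VlasovMaxwell

/-- The torus `ℝ³ / ℤ³`; its `volume` is the normalized Lebesgue measure. -/
abbrev T3 : Type := UnitAddTorus (Fin 3)

/-! ### The analytic spaces `B_δ` -/

/-- The `k`-th Fourier coefficient of a real function on the torus. -/
def fourierCoef (f : T3 → ℝ) (k : Fin 3 → ℤ) : ℂ :=
  UnitAddTorus.mFourierCoeff (fun x => (f x : ℂ)) k

/-- The Euclidean length `|k|` of a frequency. -/
def freqNorm (k : Fin 3 → ℤ) : ℝ := Real.sqrt (∑ j, (k j : ℝ) ^ 2)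

/-- `f ∈ B_δ`, that is `∑ₖ |𝓕 f(k)| δ^|k| < ∞`. A function with this property agrees almost
everywhere with a continuous function, and we always take the continuous representative. -/
def MemB (δ : ℝ) (f : T3 → ℝ) : Prop :=
  Continuous f ∧ Summable fun k : Fin 3 → ℤ => ‖fourierCoef f k‖ * δ ^ freqNorm k

/-- The norm `|f|_δ = ∑ₖ |𝓕 f(k)| δ^|k|`, for `f ∈ B_δ`. -/
def bNorm (δ : ℝ) (f : T3 → ℝ) : ℝ :=
  ∑' k : Fin 3 → ℤ, ‖fourierCoef f k‖ * δ ^ freqNorm k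

/-- A vector field belongs to `B_δ` if its components do. -/
def MemBVec (δ : ℝ) (F : T3 → Fin 3 → ℝ) : Prop :=
  ∀ i, MemB δ fun x => F x i

/-- The norm `|F|_δ` of a vector field: the sum of the norms of its components. -/
def bNormVec (δ : ℝ) (F : T3 → Fin 3 → ℝ) : ℝ :=
  ∑ i, bNorm δ fun x => F x i

/-- `u ∈ C([0,T], B_δ)` for a time-dependent function `u`. -/
def ContInB (T δ : ℝ) (u : ℝ → T3 → ℝ) : Prop :=
  ∀ t ∈ Icc 0 T, MemB δ (u t) ∧
    Tendsto (fun s => bNorm δ fun x => u s x - u t x) (𝓝[Icc 0 T] t) (𝓝 0)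

/-- `F ∈ C([0,T], B_δ)` for a time-dependent vector field `F`. -/
def ContInBVec (T δ : ℝ) (F : ℝ → T3 → Fin 3 → ℝ) : Prop :=
  ∀ i, ContInB T δ fun t x => F t x i

/-! ### Differential operators and the Leray projection on the torus -/

/-- The partial derivative `∂ᵢ f`. -/
def pderiv (i : Fin 3) (f : T3 → ℝ) (x : T3) : ℝ :=
  deriv (fun s : ℝ => f (x + Pi.single i (s : UnitAddCircle))) 0

/-- The gradient. -/
def grad (f : T3 → ℝ) (x : T3) (i : Fin 3) : ℝ := pderiv i f x

/-- The divergence. -/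
def divergence (F : T3 → Fin 3 → ℝ) (x : T3) : ℝ :=
  ∑ i, pderiv i (fun y => F y i) x

/-- The curl. -/
def curl (F : T3 → Fin 3 → ℝ) (x : T3) : Fin 3 → ℝ :=
  ![pderiv 1 (fun y => F y 2) x - pderiv 2 (fun y => F y 1) x,
    pderiv 2 (fun y => F y 0) x - pderiv 0 (fun y => F y 2) x,
    pderiv 0 (fun y => F y 1) x - pderiv 1 (fun y => F y 0) x]

/-- The Laplacian. -/
def laplacian (f : T3 → ℝ) (x : T3) : ℝ := ∑ i, pderiv i (pderiv i f) x

/-- The spatial mean `⟨F⟩`. -/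
def mean (F : T3 → Fin 3 → ℝ) (i : Fin 3) : ℝ := ∫ x, F x i

/-- The Leray projection, given by its Fourier multiplier `Id - k ⊗ k / |k|²` (the identity for
`k = 0`, as `0 / 0 = 0` here), for fields with absolutely summable Fourier coefficients. -/
def leray (F : T3 → Fin 3 → ℝ) (x : T3) (i : Fin 3) : ℝ :=
  (∑' k : Fin 3 → ℤ,
    (fourierCoef (fun y => F y i) k -
      (k i : ℂ) * (∑ j, (k j : ℂ) * fourierCoef (fun y => F y j) k) / (∑ j, (k j : ℂ) ^ 2)) *
      UnitAddTorus.mFourier k x).re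

/-! ### The relativistic multifluid Vlasov-Maxwell system -/

/-- The relativistic velocity `v(ξ) = ξ / (1 + ε²|ξ|²)^(1/2)`. -/
def vel (ε : ℝ) (ξ : Fin 3 → ℝ) (i : Fin 3) : ℝ :=
  ξ i / Real.sqrt (1 + ε ^ 2 * ∑ j, ξ j ^ 2)

/-- The total density `∫_M ρ_θ μ(dθ)`. -/
def density {M : Type*} [MeasurableSpace M] (μ : Measure M) (ρ : M → T3 → ℝ) (x : T3) : ℝ :=
  ∫ θ, ρ θ x ∂μ

/-- The total current `∫_M v(ξ_θ) ρ_θ μ(dθ)`. -/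
def current {M : Type*} [MeasurableSpace M] (μ : Measure M) (ε : ℝ)
    (ρ : M → T3 → ℝ) (ξ : M → T3 → Fin 3 → ℝ) (x : T3) (i : Fin 3) : ℝ :=
  ∫ θ, vel ε (ξ θ x) i * ρ θ x ∂μ

/-- The electric field `E = -∇φ - ε ∂ₜA`; the argument `At` is `∂ₜA`. -/
def elec (ε : ℝ) (φ : ℝ → T3 → ℝ) (At : ℝ → T3 → Fin 3 → ℝ) (t : ℝ) (x : T3) (i : Fin 3) : ℝ :=
  -grad (φ t) x i - ε * At t x i

/-- The magnetic field `B = ∇ × A + ⟨B⁰⟩`. -/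
def magn (B0 : T3 → Fin 3 → ℝ) (A : ℝ → T3 → Fin 3 → ℝ) (t : ℝ) (x : T3) (i : Fin 3) : ℝ :=
  curl (A t) x i + mean B0 i

/-- `(ρ_θ, ξ_θ)` in `C([0,T], B_δ)`, with scalar potential `φ` and vector potential `A` in Coulomb
gauge, is a classical solution on `[0,T]` of the multifluid Vlasov-Maxwell system with initial
data `(ρ_θ(0), ξ_θ(0), E⁰, B⁰)`. The fields `At` and `Att` are the first two time derivatives
of `A`. -/
structure IsSolution {M : Type*} [MeasurableSpace M] (μ : Measure M) (ε T δ : ℝ)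
    (ρ0 : M → T3 → ℝ) (ξ0 : M → T3 → Fin 3 → ℝ) (E0 B0 : T3 → Fin 3 → ℝ)
    (ρ : M → ℝ → T3 → ℝ) (ξ : M → ℝ → T3 → Fin 3 → ℝ)
    (φ : ℝ → T3 → ℝ) (A At Att : ℝ → T3 → Fin 3 → ℝ) : Prop where
  /-- regularity of the unknowns -/
  cont_rho : ∀ θ, ContInB T δ (ρ θ)
  cont_xi : ∀ θ, ContInBVec T δ (ξ θ)
  cont_phi : ContInB T δ φ
  cont_A : ContInBVec T δ A
  /-- the fields belong to `C([0,T], B_δ)` -/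
  cont_E : ContInBVec T δ (elec ε φ At)
  cont_B : ContInBVec T δ (magn B0 A)
  /-- the total density and the total current are well defined, and the latter is in `B_δ` -/
  integrable_rho : ∀ t ∈ Icc 0 T, ∀ x, Integrable (fun θ => ρ θ t x) μ
  integrable_current : ∀ t ∈ Icc 0 T, ∀ x i,
    Integrable (fun θ => vel ε (ξ θ t x) i * ρ θ t x) μ
  mem_current : ∀ t ∈ Icc 0 T, MemBVec δ (current μ ε (fun θ => ρ θ t) (fun θ => ξ θ t))
  /-- `∂ₜ ρ_θ + ∇ · (v(ξ_θ) ρ_θ) = 0` -/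
  continuity : ∀ θ, ∀ t ∈ Icc 0 T, ∀ x,
    HasDerivWithinAt (fun s => ρ θ s x)
      (-divergence (fun y i => vel ε (ξ θ t y) i * ρ θ t y) x) (Icc 0 T) t
  /-- `∂ₜ ξ_θ + (v(ξ_θ) · ∇) ξ_θ = E + ε v(ξ_θ) × B` -/
  momentum : ∀ θ, ∀ t ∈ Icc 0 T, ∀ x i,
    HasDerivWithinAt (fun s => ξ θ s x i)
      (-(∑ j, vel ε (ξ θ t x) j * pderiv j (fun y => ξ θ t y i) x)
        + elec ε φ At t x i
        + ε * crossProduct (vel ε (ξ θ t x)) (magn B0 A t x) i) (Icc 0 T) t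
  /-- `-Δ φ = ∫_M ρ_θ μ(dθ) - 1` -/
  poisson : ∀ t ∈ Icc 0 T, ∀ x,
    -laplacian (φ t) x = density μ (fun θ => ρ θ t) x - 1
  /-- `ε² ∂ₜ² A - Δ A = ε P (∫_M v(ξ_θ) ρ_θ μ(dθ))` -/
  deriv_A : ∀ t ∈ Icc 0 T, ∀ x i,
    HasDerivWithinAt (fun s => A s x i) (At t x i) (Icc 0 T) t
  deriv_At : ∀ t ∈ Icc 0 T, ∀ x i,
    HasDerivWithinAt (fun s => At s x i) (Att t x i) (Icc 0 T) t
  wave : ∀ t ∈ Icc 0 T, ∀ x i,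
    ε ^ 2 * Att t x i - laplacian (fun y => A t y i) x
      = ε * leray (current μ ε (fun θ => ρ θ t) (fun θ => ξ θ t)) x i
  /-- the Coulomb gauge `∇ · A = 0` -/
  gauge : ∀ t ∈ Icc 0 T, ∀ x, divergence (A t) x = 0
  /-- initial conditions -/
  init_rho : ∀ θ, ρ θ 0 = ρ0 θ
  init_xi : ∀ θ, ξ θ 0 = ξ0 θ
  /-- `E|ₜ₌₀ = E⁰`, that is `ε ∂ₜA|ₜ₌₀ = -E⁰ - ∇φ|ₜ₌₀` -/
  init_E : ∀ x i, ε * At 0 x i = -E0 x i - grad (φ 0) x i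
  /-- `B|ₜ₌₀ = B⁰`, with `A|ₜ₌₀` of zero mean -/
  init_B : ∀ x i, curl (A 0) x i = B0 x i - mean B0 i
  init_mean_A : ∀ i, mean (A 0) i = 0

end VlasovMaxwell

end

open VlasovMaxwell

noncomputable section

set_option linter.unusedSectionVars false

namespace VlasovMaxwell

open scoped ComplexConjugate

/-! The argument is of Cauchy–Kovalevskaya type, with estimates uniform in ε. A function of (t, θ,
x) is replaced by its Fourier coefficients f(k, t, θ), and its norm is the least B with |f(k, t, θ)|
≤ B · wt k · exp(-(a - λt)|k|), time being clamped to [0, T]. The polynomial weight `wt` dominates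
its own convolution square, so these coefficients form a Banach algebra under convolution
(`norm_conv_le`). The strip of analyticity shrinks at speed λ. Hence integrating in time a source
that has lost one derivative costs only the factor T + 1/λ (`integral_one_add_mul_exp_le`,
`norm_duhamel_le`), which is small for large λ and small T. The budget is λT ≤ a - b, with b = log
δ₁ and a < log δ₀.

The fields may be as large as ε^(-γ), and E enters the momentum equation without a factor ε. But its
large part -ε ∂ₜA is a time derivative, so the equation is integrated for ξ + εA. On nonzero modes
the wave propagators cos and sin/|2πk| are bounded by 1 (`abs_sinK_le_one`), so the free part of A
is O(ε^(-γ)) for all times, and εA and εB are O(1) because γ ≤ 1. The zero mode of the free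
potential grows like ⟨E⁰⟩ t/ε. It vanishes if ⟨E⁰⟩ = 0 and is otherwise controlled by T ≤ ε; this is
the only reason for T to depend on ε. The parts of A and B generated by the current are Duhamel
integrals, whose kernels, after multiplication by ε for A and under the curl for B, are bounded
independently of ε.

The unknowns are ρ, the field with coefficients (1+|k|) times those of ξ, and h = (1+ε²|ξ|²)^(-1/2)
- 1. The second choice makes ξ and ∇ξ images of the unknown under bounded multipliers, so that
(v·∇)ξ is a product in the algebra. The third removes the square root: h solves 2h + h² +
ε²|ξ|²(1+h)² = 0, which is a contraction for small ε, and v = ξ(1+h) (`vel_eq_of_lorentz`).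

One number Q dominates the data and all numerical constants. Every nonlinear term is bounded and
Lipschitz with constant a power of Q, so taking λ of order Q^30, T of order Q^(-30) and ε ≤ Q^(-30)
gives a 1/2-contraction (`exists_fixedPoint`). The exponential decay of the coefficients permits
termwise differentiation of the fixed point. The Coulomb gauge, Gauss's law and neutrality then
follow from identities between symbols (`isSolution`). -/

/-- The frequencies of the Fourier series on the torus. -/
abbrev Freq : Type := Fin 3 → ℤ

/-! ### Frequencies and summable weights -/

lemma freqNorm_nonneg (k : Freq) : 0 ≤ freqNorm k := Real.sqrt_nonneg _

lemma freqNorm_sq (k : Freq) : freqNorm k ^ 2 = ∑ j, (k j : ℝ) ^ 2 :=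
  Real.sq_sqrt (Finset.sum_nonneg fun _ _ => sq_nonneg _)

@[simp] lemma freqNorm_zero : freqNorm 0 = 0 := by simp [freqNorm]

@[simp] lemma freqNorm_neg (k : Freq) : freqNorm (-k) = freqNorm k := by simp [freqNorm]

lemma freqNorm_eq_norm (k : Freq) :
    freqNorm k = ‖(WithLp.toLp 2 fun j => (k j : ℝ) : EuclideanSpace ℝ (Fin 3))‖ := by
  simp [freqNorm, EuclideanSpace.norm_eq]

lemma freqNorm_add_le (j k : Freq) : freqNorm (j + k) ≤ freqNorm j + freqNorm k := by
  simp only [freqNorm_eq_norm]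
  refine le_trans (le_of_eq ?_) (norm_add_le _ _)
  congr 1
  ext i
  simp

lemma freqNorm_le_add_sub (j k : Freq) : freqNorm k ≤ freqNorm j + freqNorm (k - j) := by
  simpa using freqNorm_add_le j (k - j)

lemma abs_le_freqNorm (k : Freq) (j : Fin 3) : |(k j : ℝ)| ≤ freqNorm k := by
  apply Real.abs_le_sqrt
  exact Finset.single_le_sum (f := fun j => (k j : ℝ) ^ 2) (fun _ _ => sq_nonneg _)
    (Finset.mem_univ j)

lemma one_le_freqNorm {k : Freq} (hk : k ≠ 0) : 1 ≤ freqNorm k := by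
  obtain ⟨j, hj⟩ := Function.ne_iff.mp hk
  refine le_trans ?_ (abs_le_freqNorm k j)
  exact_mod_cast Int.one_le_abs hj

lemma summable_pi_prod {f : ℤ → ℝ} (hf : Summable f) (h0 : 0 ≤ f) (n : ℕ) :
    Summable fun k : Fin n → ℤ => ∏ i, f (k i) := by
  induction n with
  | zero => exact (hasSum_fintype _).summable
  | succ n ih =>
    rw [← (Fin.consEquiv fun _ : Fin (n + 1) => ℤ).summable_iff]
    refine (hf.mul_of_nonneg ih h0 fun k => Finset.prod_nonneg fun i _ => h0 _).congr fun x => ?_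
    simp [Fin.consEquiv, Fin.prod_univ_succ]

lemma summable_one_add_abs : Summable fun n : ℤ => 1 / (1 + |(n : ℝ)|) ^ 2 := by
  have h := (Real.summable_one_div_int_pow (p := 2)).2 (by norm_num)
  refine (h.add (hasSum_ite_eq (0 : ℤ) (1 : ℝ)).summable).of_nonneg_of_le
    (fun n => by positivity) fun n => ?_
  by_cases hn : n = 0
  · simp [hn]
  · simp only [hn, if_false, add_zero]
    rw [← sq_abs (n : ℝ)]
    have : 0 < |(n : ℝ)| := abs_pos.2 (by exact_mod_cast hn)
    gcongr
    linarith

/-- The exponent 6 = 2·3 leaves a summable inverse square for each of the three coordinates. -/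
lemma summable_polyWeight : Summable fun k : Freq => 1 / (1 + freqNorm k) ^ 6 := by
  refine (summable_pi_prod summable_one_add_abs (fun n => by positivity) 3).of_nonneg_of_le
    (fun k => by have := freqNorm_nonneg k; positivity) fun k => ?_
  have h := freqNorm_nonneg k
  rw [Finset.prod_div_distrib, Finset.prod_const_one]
  gcongr
  rw [show (6 : ℕ) = 2 * 3 from rfl, pow_mul, ← Fin.prod_const]
  gcongr
  exact abs_le_freqNorm _ _

/-- The sum of `(1 + |k|)⁻⁶`. -/
def polySum : ℝ := ∑' k : Freq, 1 / (1 + freqNorm k) ^ 6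

lemma polySum_pos : 0 < polySum :=
  summable_polyWeight.tsum_pos (fun k => by have := freqNorm_nonneg k; positivity) (0 : Freq) (by simp)

/-- A summable polynomial weight, normalized so that it dominates its convolution square. -/
def wt (k : Freq) : ℝ := 1 / (64 * polySum) * (1 / (1 + freqNorm k) ^ 6)

lemma wt_pos (k : Freq) : 0 < wt k := by
  have := freqNorm_nonneg k; have := polySum_pos; unfold wt; positivity

@[simp] lemma wt_neg (k : Freq) : wt (-k) = wt k := by simp [wt]

lemma summable_wt : Summable wt := summable_polyWeight.mul_left _

lemma tsum_wt_le : ∑' k, wt k ≤ 1 / 64 := by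
  unfold wt
  rw [tsum_mul_left, ← polySum]
  have := polySum_pos
  field_simp
  rfl

/-- Since 1+|k| ≤ (1+|j|) + (1+|k-j|), convexity of the sixth power gives (1+|k|)⁶ ≤ 2⁵((1+|j|)⁶ +
(1+|k-j|)⁶); divide by the product of the three powers. -/
lemma inv_mul_inv_le (j k : Freq) :
    (1 / (1 + freqNorm j) ^ 6) * (1 / (1 + freqNorm (k - j)) ^ 6) ≤
      32 * (1 / (1 + freqNorm k) ^ 6) *
        (1 / (1 + freqNorm j) ^ 6 + 1 / (1 + freqNorm (k - j)) ^ 6) := by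
  have hj := freqNorm_nonneg j
  have hk := freqNorm_nonneg k
  have hkj := freqNorm_nonneg (k - j)
  have h1 : (1 + freqNorm k) ^ 6 ≤
      32 * ((1 + freqNorm j) ^ 6 + (1 + freqNorm (k - j)) ^ 6) := by
    have h := add_pow_le (a := 1 + freqNorm j) (b := 1 + freqNorm (k - j))
      (by positivity) (by positivity) 6
    norm_num only at h
    refine (pow_le_pow_left₀ (by positivity) ?_ 6).trans h
    linarith [freqNorm_le_add_sub j k]
  have hx : 0 < (1 + freqNorm j) ^ 6 := by positivity
  have hy : 0 < (1 + freqNorm (k - j)) ^ 6 := by positivity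
  have hz : 0 < (1 + freqNorm k) ^ 6 := by positivity
  generalize (1 + freqNorm j) ^ 6 = x at *
  generalize (1 + freqNorm (k - j)) ^ 6 = y at *
  generalize (1 + freqNorm k) ^ 6 = z at *
  have e1 : 1 / x * (1 / y) = z / (x * y * z) := by field_simp
  have e2 : 32 * (1 / z) * (1 / x + 1 / y) = 32 * (x + y) / (x * y * z) := by
    field_simp
    ring
  rw [e1, e2]
  gcongr

lemma wt_mul_wt_le (j k : Freq) :
    wt j * wt (k - j) ≤ wt k / 2 * (1 / polySum) *
      (1 / (1 + freqNorm j) ^ 6 + 1 / (1 + freqNorm (k - j)) ^ 6) := by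
  have h := inv_mul_inv_le j k
  have hp := polySum_pos
  unfold wt
  calc _ = (1 / (64 * polySum)) ^ 2 *
        ((1 / (1 + freqNorm j) ^ 6) * (1 / (1 + freqNorm (k - j)) ^ 6)) := by ring
    _ ≤ (1 / (64 * polySum)) ^ 2 * (32 * (1 / (1 + freqNorm k) ^ 6) *
        (1 / (1 + freqNorm j) ^ 6 + 1 / (1 + freqNorm (k - j)) ^ 6)) := by gcongr
    _ ≤ _ := by
      have hk := freqNorm_nonneg k
      have hj := freqNorm_nonneg j
      have hkj := freqNorm_nonneg (k - j)
      have h0 : 0 ≤ (1 / (1 + freqNorm k) ^ 6) *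
        (1 / (1 + freqNorm j) ^ 6 + 1 / (1 + freqNorm (k - j)) ^ 6) := by positivity
      calc _ = 1 / (128 * polySum ^ 2) * ((1 / (1 + freqNorm k) ^ 6) *
        (1 / (1 + freqNorm j) ^ 6 + 1 / (1 + freqNorm (k - j)) ^ 6)) := by field_simp; norm_num
        _ ≤ _ := le_of_eq (by field_simp; norm_num)

lemma hasSum_polyWeight_sub (k : Freq) :
    HasSum (fun j : Freq => 1 / (1 + freqNorm j) ^ 6 + 1 / (1 + freqNorm (k - j)) ^ 6)
      (polySum + polySum) :=
  summable_polyWeight.hasSum.add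
    ((Equiv.subLeft k).hasSum_iff.2 summable_polyWeight.hasSum)

lemma summable_wt_mul_wt (k : Freq) : Summable fun j => wt j * wt (k - j) :=
  ((hasSum_polyWeight_sub k).summable.mul_left _).of_nonneg_of_le
    (fun _ => (mul_pos (wt_pos _) (wt_pos _)).le) fun j => wt_mul_wt_le j k

/-- This is where the normalization 64 = 32·2 comes from: 32 is the convexity constant, and 2 counts
the two sums over j and over k - j. -/
lemma tsum_wt_mul_wt_le (k : Freq) : ∑' j, wt j * wt (k - j) ≤ wt k := by
  refine ((summable_wt_mul_wt k).tsum_le_tsum (fun j => wt_mul_wt_le j k)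
    ((hasSum_polyWeight_sub k).summable.mul_left _)).trans ?_
  rw [tsum_mul_left, (hasSum_polyWeight_sub k).tsum_eq]
  have := polySum_pos
  have := wt_pos k
  apply le_of_eq
  field_simp
  ring

/-- A polynomial factor is absorbed by a geometric one. -/
lemma exists_pow_mul_exp_le (n : ℕ) {c : ℝ} (hc : 0 < c) :
    ∃ K > 0, ∀ k : Freq, (1 + freqNorm k) ^ n * Real.exp (-c * freqNorm k) ≤ K := by
  refine ⟨n.factorial / c ^ n * Real.exp c, by positivity, fun k => ?_⟩
  have hk := freqNorm_nonneg k
  have h := Real.pow_div_factorial_le_exp (c * (1 + freqNorm k)) (by positivity) n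
  have hf : (0 : ℝ) < n.factorial := by positivity
  rw [div_le_iff₀ hf, mul_pow] at h
  have e : Real.exp (c * (1 + freqNorm k)) * Real.exp (-c * freqNorm k) = Real.exp c := by
    rw [← Real.exp_add]; congr 1; ring
  calc (1 + freqNorm k) ^ n * Real.exp (-c * freqNorm k)
      = (c ^ n * (1 + freqNorm k) ^ n) * Real.exp (-c * freqNorm k) / c ^ n := by field_simp
    _ ≤ (Real.exp (c * (1 + freqNorm k)) * n.factorial) * Real.exp (-c * freqNorm k) / c ^ n := by
        gcongr
    _ = _ := by rw [← e]; ring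

/-! ### Functions given by their Fourier series -/

/-- The coefficients `a` satisfy the symmetry of the Fourier coefficients of a real function. -/
def Herm (a : Freq → ℂ) : Prop := ∀ k, a (-k) = conj (a k)

/-- The function with Fourier coefficients `a` (real when `a` is Hermitian). -/
def syn (a : Freq → ℂ) (x : T3) : ℝ := (∑' k, a k * UnitAddTorus.mFourier k x).re

lemma norm_mFourier_apply (k : Freq) (x : T3) : ‖UnitAddTorus.mFourier k x‖ = 1 := by
  simp only [UnitAddTorus.mFourier, ContinuousMap.coe_mk, norm_prod, fourier_apply,
    Circle.norm_coe, Finset.prod_const_one]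

lemma norm_mul_mFourier (z : ℂ) (k : Freq) (x : T3) :
    ‖z * UnitAddTorus.mFourier k x‖ = ‖z‖ := by
  rw [norm_mul, norm_mFourier_apply, mul_one]

lemma summable_mul_mFourier {a : Freq → ℂ} (ha : Summable fun k => ‖a k‖) (x : T3) :
    Summable fun k => a k * UnitAddTorus.mFourier k x :=
  Summable.of_norm (ha.congr fun _ => (norm_mul_mFourier _ _ _).symm)

/-- Conjugating the series amounts to reindexing it by k ↦ -k, so its sum is real and taking the
real part in `syn` loses nothing. -/
lemma ofReal_syn {a : Freq → ℂ} (hh : Herm a) (x : T3) :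
    (syn a x : ℂ) = ∑' k, a k * UnitAddTorus.mFourier k x := by
  refine Complex.conj_eq_iff_re.1 ?_
  rw [Complex.conj_tsum, ← (Equiv.neg Freq).tsum_eq]
  refine tsum_congr fun k => ?_
  rw [Equiv.neg_apply, UnitAddTorus.mFourier_neg, hh k]
  simp

lemma abs_syn_le {a : Freq → ℂ} (ha : Summable fun k => ‖a k‖) (x : T3) :
    |syn a x| ≤ ∑' k, ‖a k‖ := by
  refine (Complex.abs_re_le_norm _).trans ((norm_tsum_le_tsum_norm ?_).trans ?_)
  · exact ha.congr fun k => (norm_mul_mFourier _ _ _).symm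
  · exact le_of_eq (tsum_congr fun k => norm_mul_mFourier _ _ _)

lemma continuous_syn {a : Freq → ℂ} (ha : Summable fun k => ‖a k‖) : Continuous (syn a) :=
  Complex.continuous_re.comp (continuous_tsum (fun k => by fun_prop) ha
    fun k x => (norm_mul_mFourier _ _ _).le)

lemma syn_add {a b : Freq → ℂ} (ha : Summable fun k => ‖a k‖) (hb : Summable fun k => ‖b k‖)
    (x : T3) : syn (fun k => a k + b k) x = syn a x + syn b x := by
  simp only [syn, add_mul]
  rw [(summable_mul_mFourier ha x).tsum_add (summable_mul_mFourier hb x), Complex.add_re]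

lemma syn_sub {a b : Freq → ℂ} (ha : Summable fun k => ‖a k‖) (hb : Summable fun k => ‖b k‖)
    (x : T3) : syn (fun k => a k - b k) x = syn a x - syn b x := by
  simp only [syn, sub_mul]
  rw [(summable_mul_mFourier ha x).tsum_sub (summable_mul_mFourier hb x), Complex.sub_re]

lemma syn_neg (a : Freq → ℂ) (x : T3) : syn (fun k => -a k) x = -syn a x := by
  simp only [syn, neg_mul, tsum_neg, Complex.neg_re]

lemma syn_const_mul (r : ℝ) (a : Freq → ℂ) (x : T3) :
    syn (fun k => (r : ℂ) * a k) x = r * syn a x := by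
  simp only [syn, mul_assoc, tsum_mul_left, Complex.re_ofReal_mul]

lemma syn_sum {ι : Type*} (s : Finset ι) {a : ι → Freq → ℂ}
    (ha : ∀ i ∈ s, Summable fun k => ‖a i k‖) (x : T3) :
    syn (fun k => ∑ i ∈ s, a i k) x = ∑ i ∈ s, syn (a i) x := by
  simp only [syn, Finset.sum_mul]
  rw [Summable.tsum_finsetSum fun i hi => summable_mul_mFourier (ha i hi) x, Complex.re_sum]

/-- The coefficients of a product. -/
def conv (a b : Freq → ℂ) (k : Freq) : ℂ := ∑' j, a j * b (k - j)

/-- The change of variables `(k, j) ↦ (j, k - j)`. -/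
def convEquiv : Freq × Freq ≃ Freq × Freq where
  toFun z := (z.2, z.1 - z.2)
  invFun z := (z.1 + z.2, z.1)
  left_inv z := by simp
  right_inv z := by simp

lemma tsum_mul_tsum_eq_tsum_conv {f g : Freq → ℂ} (hf : Summable f) (hg : Summable g) :
    (∑' k, f k) * ∑' k, g k = ∑' k, ∑' j, f j * g (k - j) := by
  have hfg : Summable fun z : Freq × Freq => f z.1 * g z.2 :=
    summable_mul_of_summable_norm hf.norm hg.norm
  rw [hf.tsum_mul_tsum hg hfg, ← convEquiv.tsum_eq]
  exact (convEquiv.summable_iff.2 hfg).tsum_prod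

/-- Cauchy product of two absolutely convergent series, regrouped by the total frequency. Hermitian
symmetry is needed because the real part is not multiplicative. -/
lemma syn_conv {a b : Freq → ℂ} (ha : Summable fun k => ‖a k‖) (hb : Summable fun k => ‖b k‖)
    (ha' : Herm a) (hb' : Herm b) (x : T3) : syn (conv a b) x = syn a x * syn b x := by
  have h := congrArg Complex.re
    (tsum_mul_tsum_eq_tsum_conv (summable_mul_mFourier ha x) (summable_mul_mFourier hb x))
  rw [← ofReal_syn ha', ← ofReal_syn hb', Complex.re_mul_ofReal, Complex.ofReal_re] at h
  rw [h, syn]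
  congr 1
  refine tsum_congr fun k => ?_
  rw [conv, ← tsum_mul_right]
  refine tsum_congr fun j => ?_
  have : UnitAddTorus.mFourier k x
      = UnitAddTorus.mFourier j x * UnitAddTorus.mFourier (k - j) x := by
    rw [← UnitAddTorus.mFourier_add, add_sub_cancel]
  rw [this]
  ring

lemma mFourier_add_single (k : Freq) (x : T3) (i : Fin 3) (s : ℝ) :
    UnitAddTorus.mFourier k (x + Pi.single i (s : UnitAddCircle))
      = UnitAddTorus.mFourier k x * Complex.exp (2 * Real.pi * Complex.I * k i * s) := by
  have h : ∀ j, fourier (k j) ((x + Pi.single i (s : UnitAddCircle) : T3) j)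
      = fourier (k j) (x j) * if j = i then Complex.exp (2 * Real.pi * Complex.I * k i * s)
        else 1 := by
    intro j
    have hadd : ∀ y z : UnitAddCircle, fourier (k j) (y + z) = fourier (k j) y * fourier (k j) z := by
      intro y z
      simp [fourier_apply, smul_add, AddCircle.toCircle_add]
    rw [Pi.add_apply, hadd]
    split_ifs with hj
    · subst hj
      rw [Pi.single_eq_same, fourier_coe_apply]
      simp
    · rw [Pi.single_eq_of_ne hj]
      simp
  simp only [UnitAddTorus.mFourier, ContinuousMap.coe_mk]
  rw [Finset.prod_congr rfl fun j _ => h j, Finset.prod_mul_distrib]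
  simp

/-- The symbol of the partial derivative `∂ᵢ`. -/
def dsym (i : Fin 3) (k : Freq) : ℂ := 2 * Real.pi * Complex.I * k i

lemma norm_dsym (i : Fin 3) (k : Freq) : ‖dsym i k‖ = 2 * Real.pi * |(k i : ℝ)| := by
  simp [dsym, abs_of_pos Real.pi_pos]

lemma norm_dsym_le (i : Fin 3) (k : Freq) : ‖dsym i k‖ ≤ 2 * Real.pi * freqNorm k := by
  rw [norm_dsym]
  have := Real.pi_pos
  gcongr
  exact abs_le_freqNorm k i

lemma dsym_neg (i : Fin 3) (k : Freq) : dsym i (-k) = conj (dsym i k) := by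
  simp [dsym, Complex.conj_ofReal, Complex.conj_ofNat]

lemma Herm.mul {a b : Freq → ℂ} (ha : Herm a) (hb : Herm b) : Herm fun k => a k * b k := by
  intro k; simp only [ha k, hb k, map_mul]

lemma pderiv_syn {a : Freq → ℂ} (ha : Summable fun k => ‖a k‖)
    (hd : ∀ i, Summable fun k => ‖dsym i k * a k‖) (i : Fin 3) (x : T3) :
    pderiv i (syn a) x = syn (fun k => dsym i k * a k) x := by
  have h1 : ∀ (k : Freq) (s : ℝ), HasDerivAt
      (fun s : ℝ => a k * UnitAddTorus.mFourier k (x + Pi.single i (s : UnitAddCircle)))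
      (dsym i k * a k * UnitAddTorus.mFourier k (x + Pi.single i (s : UnitAddCircle))) s := by
    intro k s
    simp only [mFourier_add_single]
    have h := (((Complex.ofRealCLM.hasDerivAt (x := s)).const_mul
      (2 * Real.pi * Complex.I * k i)).cexp.const_mul (UnitAddTorus.mFourier k x)).const_mul (a k)
    refine h.congr_deriv ?_
    simp [dsym]
    ring
  have h2 := hasDerivAt_tsum (y₀ := 0) (hd i) h1
    (fun k s => (norm_mul_mFourier _ _ _).le) (summable_mul_mFourier ha _) 0
  have h3 := (Complex.reCLM.hasFDerivAt.comp_hasDerivAt (0 : ℝ) h2).deriv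
  rw [pderiv]
  refine Eq.trans ?_ (h3.trans ?_)
  · rfl
  · simp [syn]

lemma volume_T3_eq :
    (volume : Measure T3) = Measure.pi fun _ : Fin 3 => AddCircle.haarAddCircle := by
  rw [volume_pi]
  congr 1
  funext i
  rw [AddCircle.volume_eq_smul_haarAddCircle]
  simp

instance : IsProbabilityMeasure (volume : Measure T3) := by
  rw [volume_T3_eq]; infer_instance

lemma fourierCoef_eq_integral (f : T3 → ℝ) (k : Freq) :
    fourierCoef f k = ∫ x, UnitAddTorus.mFourier (-k) x * (f x : ℂ) := by
  rw [volume_T3_eq]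
  rfl

lemma integral_mFourier (k : Freq) :
    ∫ x : T3, UnitAddTorus.mFourier k x = if k = 0 then 1 else 0 := by
  split_ifs with hk
  · simp [hk, UnitAddTorus.mFourier_zero]
  · obtain ⟨j, hj⟩ := Function.ne_iff.mp hk
    rw [volume_T3_eq]
    simp only [UnitAddTorus.mFourier, ContinuousMap.coe_mk]
    rw [integral_fintype_prod_eq_prod (𝕜 := ℂ)]
    refine Finset.prod_eq_zero (Finset.mem_univ j) ?_
    exact integral_eq_zero_of_add_right_eq_neg
      -- Translation by half a period changes the sign of the character and preserves the measure.
      (g := ((1 / 2 / k j : ℝ) : UnitAddCircle)) fun x => by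
        have := fourier_add_half_inv_index (T := 1) hj one_pos x
        simpa using this

lemma fourierCoef_syn {a : Freq → ℂ} (ha : Summable fun k => ‖a k‖) (hh : Herm a) (k : Freq) :
    fourierCoef (syn a) k = a k := by
  rw [fourierCoef_eq_integral]
  simp only [ofReal_syn hh, ← tsum_mul_left]
  rw [← integral_tsum_of_summable_integral_norm]
  · rw [tsum_eq_single k]
    · have : ∀ x : T3, UnitAddTorus.mFourier (-k) x * (a k * UnitAddTorus.mFourier k x) = a k := by
        intro x
        rw [mul_left_comm, ← UnitAddTorus.mFourier_add]
        simp [UnitAddTorus.mFourier_zero]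
      simp [this]
    · intro j hj
      have : ∀ x : T3, UnitAddTorus.mFourier (-k) x * (a j * UnitAddTorus.mFourier j x)
          = a j * UnitAddTorus.mFourier (-k + j) x := by
        intro x
        rw [mul_left_comm, ← UnitAddTorus.mFourier_add]
      simp only [this]
      rw [integral_const_mul, integral_mFourier, if_neg, mul_zero]
      intro h
      exact hj (neg_add_eq_zero.1 h).symm
  · intro j
    exact Continuous.integrable_of_hasCompactSupport (by fun_prop)
      (HasCompactSupport.of_compactSpace _)
  · simpa [norm_mFourier_apply] using ha

lemma herm_fourierCoef (f : T3 → ℝ) : Herm (fourierCoef f) := by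
  intro k
  rw [fourierCoef_eq_integral, fourierCoef_eq_integral, ← integral_conj]
  refine integral_congr_ae (Eventually.of_forall fun x => ?_)
  simp [UnitAddTorus.mFourier_neg]

/-- Continuity makes the Fourier inversion hold at every point rather than almost everywhere. -/
lemma syn_fourierCoef {f : T3 → ℝ} (hf : Continuous f)
    (hs : Summable fun k => ‖fourierCoef f k‖) : syn (fourierCoef f) = f := by
  funext x
  have h := UnitAddTorus.hasSum_mFourier_series_apply_of_summable
    (f := ⟨fun x => (f x : ℂ), by fun_prop⟩) (Summable.of_norm hs) x
  have h2 := h.tsum_eq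
  simp only [smul_eq_mul, ContinuousMap.coe_mk] at h2
  exact (congrArg Complex.re h2).trans (Complex.ofReal_re _)

lemma mean_eq_fourierCoef (F : T3 → Fin 3 → ℝ) (i : Fin 3) :
    (mean F i : ℂ) = fourierCoef (fun x => F x i) 0 := by
  rw [fourierCoef_eq_integral, mean, ← integral_complex_ofReal]
  simp [UnitAddTorus.mFourier_zero]

lemma rpow_freqNorm_pos {δ : ℝ} (hδ : 0 < δ) (k : Freq) : 0 < δ ^ freqNorm k :=
  Real.rpow_pos_of_pos hδ _

lemma one_le_rpow_freqNorm {δ : ℝ} (hδ : 1 ≤ δ) (k : Freq) : 1 ≤ δ ^ freqNorm k :=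
  Real.one_le_rpow hδ (freqNorm_nonneg k)

lemma summable_norm_of_rpow {δ : ℝ} (hδ : 1 ≤ δ) {a : Freq → ℂ}
    (ha : Summable fun k => ‖a k‖ * δ ^ freqNorm k) : Summable fun k => ‖a k‖ :=
  ha.of_nonneg_of_le (fun _ => norm_nonneg _) fun k =>
    le_mul_of_one_le_right (norm_nonneg _) (one_le_rpow_freqNorm hδ k)

lemma memB_syn {δ : ℝ} (hδ : 1 ≤ δ) {a : Freq → ℂ} (hh : Herm a)
    (ha : Summable fun k => ‖a k‖ * δ ^ freqNorm k) : MemB δ (syn a) := by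
  have h := summable_norm_of_rpow hδ ha
  exact ⟨continuous_syn h, by simpa only [fourierCoef_syn h hh] using ha⟩

lemma bNorm_syn (δ : ℝ) {a : Freq → ℂ} (hh : Herm a) (ha : Summable fun k => ‖a k‖) :
    bNorm δ (syn a) = ∑' k, ‖a k‖ * δ ^ freqNorm k := by
  simp only [bNorm, fourierCoef_syn ha hh]

lemma MemB.summable {δ : ℝ} (hδ : 1 ≤ δ) {f : T3 → ℝ} (hf : MemB δ f) :
    Summable fun k => ‖fourierCoef f k‖ := summable_norm_of_rpow hδ hf.2

/-- A single term is at most the whole sum. This trades the ℓ¹ norm of the data for a pointwise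
exponential bound, the only form in which the data enter the estimates. -/
lemma MemB.norm_fourierCoef_le {δ : ℝ} (hδ : 0 < δ) {f : T3 → ℝ} (hf : MemB δ f) (k : Freq) :
    ‖fourierCoef f k‖ ≤ bNorm δ f * Real.exp (-Real.log δ * freqNorm k) := by
  have h : ‖fourierCoef f k‖ * δ ^ freqNorm k ≤ bNorm δ f :=
    hf.2.le_tsum k fun j _ => mul_nonneg (norm_nonneg _) (rpow_freqNorm_pos hδ j).le
  rw [Real.rpow_def_of_pos hδ] at h
  rw [neg_mul, Real.exp_neg]
  exact (le_div_iff₀ (Real.exp_pos _)).2 h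

/-! ### Time-dependent Fourier series -/

lemma hasDerivWithinAt_syn {T : ℝ} (hT : 0 < T) {a a' : Freq → ℝ → ℂ} {u : Freq → ℝ}
    (ha : ∀ k, ∀ t ∈ Icc 0 T, HasDerivWithinAt (a k) (a' k t) (Icc 0 T) t)
    (hc : ∀ k, ContinuousOn (a' k) (Icc 0 T)) (hu : Summable u)
    (hau : ∀ k, ∀ t ∈ Icc 0 T, ‖a' k t‖ ≤ u k) (h0 : Summable fun k => ‖a k 0‖)
    (x : T3) {t : ℝ} (ht : t ∈ Icc 0 T) :
    HasDerivWithinAt (fun s => syn (fun k => a k s) x) (syn (fun k => a' k t) x) (Icc 0 T) t := by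
  -- The coefficients are extended to the whole line by integrating their derivatives, frozen at the
  -- endpoint values outside [0, T]. Termwise differentiation on ℝ then applies, and the extension
  -- agrees with `a` on the interval.
  let b : Freq → ℝ → ℂ := fun k s => a k 0 + ∫ r in (0 : ℝ)..s, IccExtend hT.le (domRestrict (Icc 0 T) (a' k)) r
  have hcont : ∀ k, Continuous (IccExtend hT.le (domRestrict (Icc 0 T) (a' k))) := fun k =>
    (continuousOn_iff_continuous_domRestrict.1 (hc k)).Icc_extend'
  have hb : ∀ k s, HasDerivAt (b k) (IccExtend hT.le (domRestrict (Icc 0 T) (a' k)) s) s := fun k s =>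
    ((hcont k).integral_hasStrictDerivAt 0 s).hasDerivAt.const_add _
  have hbe : ∀ k, ∀ s ∈ Icc 0 T, IccExtend hT.le (domRestrict (Icc 0 T) (a' k)) s = a' k s :=
    fun k s hs => by rw [IccExtend_of_mem _ _ hs]; rfl
  have hab : ∀ k, ∀ s ∈ Icc 0 T, b k s = a k s := by
    intro k s hs
    refine eq_of_derivWithin_eq
      (fun r _ => (hb k r).differentiableAt.differentiableWithinAt)
      (fun r hr => (ha k r hr).differentiableWithinAt) (fun r hr => ?_) (by simp [b]) s hs
    have hr' := Ico_subset_Icc_self hr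
    rw [((hb k r).hasDerivWithinAt).derivWithin (uniqueDiffOn_Icc hT r hr'),
      (ha k r hr').derivWithin (uniqueDiffOn_Icc hT r hr'), hbe k r hr']
  have h2 := hasDerivAt_tsum (y₀ := 0) hu
    (g := fun k s => b k s * UnitAddTorus.mFourier k x)
    (g' := fun k s => IccExtend hT.le (domRestrict (Icc 0 T) (a' k)) s * UnitAddTorus.mFourier k x)
    (fun k s => (hb k s).mul_const _)
    (fun k s => by
      rw [norm_mul_mFourier]
      exact hau k _ (projIcc 0 T hT.le s).2)
    (by simpa [b] using summable_mul_mFourier h0 x) t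
  have h3 := (Complex.reCLM.hasFDerivAt.comp_hasDerivAt t h2).hasDerivWithinAt (s := Icc 0 T)
  refine (h3.congr (fun s hs => ?_) ?_).congr_deriv ?_
  · simp [syn, hab _ s hs]
  · simp [syn, hab _ t ht]
  · simp [syn, hbe _ t ht]

/-! ### Measurability of integrals and series with a parameter -/

section Measurability

variable {M : Type*} [MeasurableSpace M] {μ : Measure M}

/-- The integral of a Carathéodory function is measurable in the parameter. -/
lemma aestronglyMeasurable_integral_of_continuous {ι : Type*} [TopologicalSpace ι]
    [TopologicalSpace.MetrizableSpace ι] [MeasurableSpace ι] [SecondCountableTopology ι]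
    [OpensMeasurableSpace ι] (ν : Measure ι) [SFinite ν] {u : ι → M → ℂ}
    (hc : ∀ θ, Continuous fun i => u i θ) (hm : ∀ i, AEStronglyMeasurable (u i) μ) :
    AEStronglyMeasurable (fun θ => ∫ i, u i θ ∂ν) μ := by
  obtain ⟨D, hD, hdense⟩ := TopologicalSpace.exists_countable_dense ι
  have hae : ∀ᵐ θ ∂μ, ∀ d ∈ D, u d θ = (hm d).mk (u d) θ :=
    (ae_ball_iff hD).2 fun d _ => (hm d).ae_eq_mk
  -- Measurability holds only almost everywhere for each index. On a countable dense set of indices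
  -- the exceptional sets have a null union, enclosed in the measurable set N. After replacing the
  -- function by 0 on N, continuity propagates strong measurability from the dense set to all
  -- indices.
  set N := toMeasurable μ {θ | ¬ ∀ d ∈ D, u d θ = (hm d).mk (u d) θ} with hN
  have hN0 : μ N = 0 := by rw [hN, measure_toMeasurable]; exact hae
  have hNm : MeasurableSet N := measurableSet_toMeasurable _ _
  have hNc : ∀ θ ∉ N, ∀ d ∈ D, u d θ = (hm d).mk (u d) θ := by
    intro θ hθ
    by_contra hcon
    exact hθ (subset_toMeasurable μ _ hcon)
  let w : ι → M → ℂ := fun i => Nᶜ.indicator (u i)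
  have hwc : ∀ θ, Continuous fun i => w i θ := by
    intro θ
    by_cases hθ : θ ∈ N
    · simpa [w, hθ] using continuous_const
    · simpa [w, hθ] using hc θ
  have hwD : ∀ d ∈ D, StronglyMeasurable (w d) := by
    intro d hd
    have : w d = Nᶜ.indicator ((hm d).mk (u d)) := by
      funext θ
      by_cases hθ : θ ∈ N
      · simp [w, hθ]
      · simp [w, hθ, hNc θ hθ d hd]
    rw [this]
    exact (hm d).stronglyMeasurable_mk.indicator hNm.compl
  have hwm : ∀ i, StronglyMeasurable (w i) := by
    intro i
    obtain ⟨d, hd, hdi⟩ := mem_closure_iff_seq_limit.1 (hdense i)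
    exact stronglyMeasurable_of_tendsto atTop (fun n => hwD _ (hd n))
      (tendsto_pi_nhds.2 fun θ => ((hwc θ).tendsto i).comp hdi)
  have hjoint := stronglyMeasurable_uncurry_of_continuous_of_stronglyMeasurable hwc hwm
  have hint : StronglyMeasurable fun θ => ∫ i, w i θ ∂ν :=
    StronglyMeasurable.integral_prod_right (f := fun θ i => w i θ)
      (hjoint.comp_measurable measurable_swap)
  refine ⟨_, hint, ?_⟩
  have : ∀ᵐ θ ∂μ, θ ∉ N := measure_eq_zero_iff_ae_notMem.1 hN0
  filter_upwards [this] with θ hθ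
  simp [w, hθ]

lemma aestronglyMeasurable_tsum {f : Freq → M → ℂ}
    (hm : ∀ j, AEStronglyMeasurable (f j) μ) (hs : ∀ θ, Summable fun j => f j θ) :
    AEStronglyMeasurable (fun θ => ∑' j, f j θ) μ := by
  refine aestronglyMeasurable_of_tendsto_ae (atTop : Filter (Finset Freq))
    (f := fun s θ => ∑ j ∈ s, f j θ) (fun s => ?_) (Eventually.of_forall fun θ => (hs θ).hasSum)
  exact Finset.aestronglyMeasurable_fun_sum s fun j _ => hm j

end Measurability

/-! ### The space of time-dependent families of Fourier coefficients -/

/-- Parameters of the weights `exp (-(a - λ t) |k|)` on the time interval `[0, T]`. -/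
structure WeightPar where
  a : ℝ
  b : ℝ
  lam : ℝ
  T : ℝ
  b_pos : 0 < b
  lam_pos : 0 < lam
  T_pos : 0 < T
  lam_mul_le : lam * T ≤ a - b

namespace WeightPar

variable (P : WeightPar)

/-- The projection of the time axis to `[0, T]`. -/
def clamp (t : ℝ) : ℝ := max 0 (min t P.T)

lemma continuous_clamp : Continuous P.clamp := by unfold clamp; fun_prop

lemma clamp_mem (t : ℝ) : P.clamp t ∈ Icc 0 P.T :=
  ⟨le_max_left _ _, max_le P.T_pos.le (min_le_right _ _)⟩

lemma clamp_of_mem {t : ℝ} (ht : t ∈ Icc 0 P.T) : P.clamp t = t := by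
  rw [clamp, min_eq_left ht.2, max_eq_right ht.1]

/-- The width of the analyticity strip at time `t`. -/
def width (t : ℝ) : ℝ := P.a - P.lam * P.clamp t

lemma b_le_width (t : ℝ) : P.b ≤ P.width t := by
  have h1 := (P.clamp_mem t).2
  have h2 := P.lam_pos
  have h3 := P.lam_mul_le
  have : P.lam * P.clamp t ≤ P.lam * P.T := by gcongr
  unfold width
  linarith

lemma width_nonneg (t : ℝ) : 0 ≤ P.width t := P.b_pos.le.trans (P.b_le_width t)

lemma width_le (t : ℝ) : P.width t ≤ P.a := by
  have h1 := (P.clamp_mem t).1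
  have h2 := P.lam_pos
  have : 0 ≤ P.lam * P.clamp t := by positivity
  unfold width
  linarith

/-- The weight of the frequency `k` at time `t`. -/
def om (k : Freq) (t : ℝ) : ℝ := wt k * Real.exp (-P.width t * freqNorm k)

lemma om_pos (k : Freq) (t : ℝ) : 0 < P.om k t := mul_pos (wt_pos k) (Real.exp_pos _)

@[simp] lemma om_neg (k : Freq) (t : ℝ) : P.om (-k) t = P.om k t := by simp [om]

lemma om_le (k : Freq) (t : ℝ) : P.om k t ≤ wt k * Real.exp (-P.b * freqNorm k) := by
  have := wt_pos k
  have := P.b_le_width t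
  have := freqNorm_nonneg k
  unfold om
  gcongr

lemma om_le_wt (k : Freq) (t : ℝ) : P.om k t ≤ wt k := by
  have h : Real.exp (-P.width t * freqNorm k) ≤ 1 :=
    Real.exp_le_one_iff.2 (mul_nonpos_of_nonpos_of_nonneg (neg_nonpos.2 (P.width_nonneg t))
      (freqNorm_nonneg k))
  exact mul_le_of_le_one_right (wt_pos k).le h

lemma le_om (k : Freq) (t : ℝ) : wt k * Real.exp (-P.a * freqNorm k) ≤ P.om k t := by
  have := wt_pos k
  have := P.width_le t
  have := freqNorm_nonneg k
  unfold om
  gcongr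

/-- The exponential part is submultiplicative by the triangle inequality |k| ≤ |j| + |k-j|, since
the width is nonnegative. -/
lemma om_mul_om_le (j k : Freq) (t : ℝ) :
    P.om j t * P.om (k - j) t ≤
      wt j * wt (k - j) * Real.exp (-P.width t * freqNorm k) := by
  unfold om
  have h1 := mul_pos (wt_pos j) (wt_pos (k - j))
  have h2 : Real.exp (-P.width t * freqNorm j) * Real.exp (-P.width t * freqNorm (k - j)) ≤
      Real.exp (-P.width t * freqNorm k) := by
    rw [← Real.exp_add]
    apply Real.exp_le_exp.2
    nlinarith [freqNorm_le_add_sub j k, P.width_nonneg t]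
  calc _ = (wt j * wt (k - j)) * (Real.exp (-P.width t * freqNorm j) *
        Real.exp (-P.width t * freqNorm (k - j))) := by ring
    _ ≤ _ := by gcongr

lemma summable_om_mul_om (k : Freq) (t : ℝ) : Summable fun j => P.om j t * P.om (k - j) t :=
  ((summable_wt_mul_wt k).mul_right _).of_nonneg_of_le
    (fun _ => (mul_pos (P.om_pos _ _) (P.om_pos _ _)).le) fun j => P.om_mul_om_le j k t

lemma tsum_om_mul_om_le (k : Freq) (t : ℝ) : ∑' j, P.om j t * P.om (k - j) t ≤ P.om k t := by
  refine ((P.summable_om_mul_om k t).tsum_le_tsum (fun j => P.om_mul_om_le j k t)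
    ((summable_wt_mul_wt k).mul_right _)).trans ?_
  rw [tsum_mul_right]
  exact mul_le_mul_of_nonneg_right (tsum_wt_mul_wt_le k) (Real.exp_pos _).le

lemma continuous_om (k : Freq) : Continuous (P.om k) := by
  have := P.continuous_clamp
  unfold om width
  fun_prop

end WeightPar

section Space

variable {M : Type*} [MeasurableSpace M]

/-- Families of coefficients that are continuous in time, measurable in the parameter `θ`, and
correspond to real functions. -/
structure IsCoef (μ : Measure M) (f : Freq → ℝ → M → ℂ) : Prop where
  cont : ∀ k θ, Continuous fun t => f k t θ
  meas : ∀ k t, AEStronglyMeasurable (fun θ => f k t θ) μ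
  herm : ∀ t θ, Herm fun k => f k t θ

variable (μ : Measure M)

/-- The normalized families of coefficients, as a closed subspace of a space of bounded
functions. -/
def coefSubmodule : Submodule ℝ (lp (fun _ : Freq × ℝ × M => ℂ) ⊤) where
  carrier := {U | IsCoef μ fun k t θ => U (k, t, θ)}
  zero_mem' := ⟨fun _ _ => continuous_const, fun _ _ => aestronglyMeasurable_const,
    fun _ _ _ => by simp⟩
  add_mem' := fun {U V} hU hV => ⟨fun k θ => (hU.cont k θ).add (hV.cont k θ),
    fun k t => (hU.meas k t).add (hV.meas k t),
    fun t θ k => by simpa using congrArg₂ (· + ·) (hU.herm t θ k) (hV.herm t θ k)⟩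
  smul_mem' := fun c U hU => ⟨fun k θ => (hU.cont k θ).const_smul c,
    fun k t => (hU.meas k t).const_smul c,
    fun t θ k => by simpa using Or.inl (hU.herm t θ k)⟩

/-- The Banach space of families of coefficients, divided by their weights. -/
def CoefSpace : Type _ := coefSubmodule μ

instance : NormedAddCommGroup (CoefSpace μ) :=
  inferInstanceAs (NormedAddCommGroup (coefSubmodule μ))

instance : NormedSpace ℝ (CoefSpace μ) := inferInstanceAs (NormedSpace ℝ (coefSubmodule μ))

/-- Convergence in the supremum norm is uniform in (k, t, θ), so continuity in time survives;
measurability and Hermitian symmetry already pass to pointwise limits. -/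
lemma isClosed_coefSubmodule : IsClosed (coefSubmodule μ : Set (lp (fun _ : Freq × ℝ × M => ℂ) ⊤)) := by
  refine IsSeqClosed.isClosed fun U V hU hUV => ?_
  have hunif : TendstoUniformly (fun n (z : Freq × ℝ × M) => U n z) (fun z => V z) atTop := by
    rw [Metric.tendstoUniformly_iff]
    intro ε hε
    filter_upwards [Metric.tendsto_nhds.1 hUV ε hε] with n hn z
    rw [dist_comm]
    refine lt_of_le_of_lt ?_ hn
    rw [dist_eq_norm, dist_eq_norm]
    exact lp.norm_apply_le_norm (by simp) (U n - V) z
  have hpt : ∀ z, Tendsto (fun n => U n z) atTop (𝓝 (V z)) := fun z => hunif.tendsto_at z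
  refine ⟨fun k θ => ?_, fun k t => ?_, fun t θ k => ?_⟩
  · exact (hunif.comp fun t => (k, t, θ)).continuous (Frequently.of_forall fun n => (hU n).cont k θ)
  · exact aestronglyMeasurable_of_tendsto_ae atTop (fun n => (hU n).meas k t)
      (Eventually.of_forall fun θ => hpt _)
  · refine tendsto_nhds_unique (hpt (-k, t, θ)) ?_
    have h2 := (Complex.continuous_conj.tendsto _).comp (hpt (k, t, θ))
    exact h2.congr fun n => ((hU n).herm t θ k).symm

instance : CompleteSpace (CoefSpace μ) :=
  (isClosed_coefSubmodule μ).completeSpace_coe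

end Space

namespace WeightPar

variable (P : WeightPar) {M : Type*} [MeasurableSpace M] {μ : Measure M}

/-- The coefficients of an element of the space. -/
def coef (U : CoefSpace μ) (k : Freq) (t : ℝ) (θ : M) : ℂ := P.om k t * U.1 (k, t, θ)

lemma isCoef_coef (U : CoefSpace μ) : IsCoef μ (P.coef U) where
  cont k θ := (Complex.continuous_ofReal.comp (P.continuous_om k)).mul (U.2.cont k θ)
  meas k t := (U.2.meas k t).const_mul _
  herm t θ k := by
    have := U.2.herm t θ k
    simp only at this
    simp [coef, this]

lemma norm_coef_le (U : CoefSpace μ) (k : Freq) (t : ℝ) (θ : M) :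
    ‖P.coef U k t θ‖ ≤ ‖U‖ * P.om k t := by
  rw [coef, norm_mul, Complex.norm_real, Real.norm_of_nonneg (P.om_pos k t).le, mul_comm]
  have h : ‖U.1 (k, t, θ)‖ ≤ ‖U‖ := lp.norm_apply_le_norm (by simp) U.1 _
  exact mul_le_mul_of_nonneg_right h (P.om_pos k t).le

lemma norm_le_of_coef (U : CoefSpace μ) {B : ℝ} (hB : 0 ≤ B)
    (h : ∀ k t θ, ‖P.coef U k t θ‖ ≤ B * P.om k t) : ‖U‖ ≤ B := by
  refine lp.norm_le_of_forall_le hB fun z => ?_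
  have h1 := h z.1 z.2.1 z.2.2
  rw [coef, norm_mul, Complex.norm_real, Real.norm_of_nonneg (P.om_pos _ _).le, mul_comm] at h1
  exact le_of_mul_le_mul_right h1 (P.om_pos _ _)

lemma isCoef_normalized {f : Freq → ℝ → M → ℂ} (hf : IsCoef μ f) :
    IsCoef μ fun k t θ => ((P.om k t)⁻¹ : ℝ) * f k t θ where
  cont k θ := (Complex.continuous_ofReal.comp
    ((P.continuous_om k).inv₀ fun t => (P.om_pos k t).ne')).mul (hf.cont k θ)
  meas k t := (hf.meas k t).const_mul _
  herm t θ k := by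
    have := hf.herm t θ k
    simp only at this
    simp [this]

lemma memℓp_normalized {f : Freq → ℝ → M → ℂ} (hB : ∃ B, ∀ k t θ, ‖f k t θ‖ ≤ B * P.om k t) :
    Memℓp (fun z : Freq × ℝ × M => (((P.om z.1 z.2.1)⁻¹ : ℝ) : ℂ) * f z.1 z.2.1 z.2.2) ⊤ := by
  obtain ⟨B, hB⟩ := hB
  refine memℓp_infty ⟨B, ?_⟩
  rintro _ ⟨z, rfl⟩
  have h := P.om_pos z.1 z.2.1
  simp only [norm_mul, Complex.norm_real, Real.norm_of_nonneg (inv_nonneg.2 h.le)]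
  rw [inv_mul_le_iff₀ h, mul_comm]
  exact hB _ _ _

/-- The element of the space with prescribed coefficients. -/
def ofCoef (f : Freq → ℝ → M → ℂ) (hf : IsCoef μ f)
    (hB : ∃ B, ∀ k t θ, ‖f k t θ‖ ≤ B * P.om k t) : CoefSpace μ :=
  ⟨⟨_, P.memℓp_normalized hB⟩, P.isCoef_normalized hf⟩

@[simp] lemma coef_ofCoef (f : Freq → ℝ → M → ℂ) (hf : IsCoef μ f)
    (hB : ∃ B, ∀ k t θ, ‖f k t θ‖ ≤ B * P.om k t) : P.coef (P.ofCoef f hf hB) = f := by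
  funext k t θ
  have : (P.om k t : ℂ) ≠ 0 := by exact_mod_cast (P.om_pos k t).ne'
  simp [coef, ofCoef, this]

lemma coef_injective : Function.Injective (P.coef (μ := μ)) := by
  intro U V h
  apply Subtype.ext
  apply lp.ext
  funext z
  have h1 : P.coef U z.1 z.2.1 z.2.2 = P.coef V z.1 z.2.1 z.2.2 := by rw [h]
  have : (P.om z.1 z.2.1 : ℂ) ≠ 0 := by exact_mod_cast (P.om_pos _ _).ne'
  exact mul_left_cancel₀ this h1

lemma coef_add (U V : CoefSpace μ) (k : Freq) (t : ℝ) (θ : M) :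
    P.coef (U + V) k t θ = P.coef U k t θ + P.coef V k t θ :=
  mul_add (P.om k t : ℂ) (U.1 (k, t, θ)) (V.1 (k, t, θ))

lemma coef_sub (U V : CoefSpace μ) (k : Freq) (t : ℝ) (θ : M) :
    P.coef (U - V) k t θ = P.coef U k t θ - P.coef V k t θ :=
  mul_sub (P.om k t : ℂ) (U.1 (k, t, θ)) (V.1 (k, t, θ))

lemma coef_neg (U : CoefSpace μ) (k : Freq) (t : ℝ) (θ : M) :
    P.coef (-U) k t θ = -P.coef U k t θ := mul_neg (P.om k t : ℂ) (U.1 (k, t, θ))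

lemma coef_zero (k : Freq) (t : ℝ) (θ : M) : P.coef (0 : CoefSpace μ) k t θ = 0 :=
  mul_zero (P.om k t : ℂ)

lemma coef_smul (c : ℝ) (U : CoefSpace μ) (k : Freq) (t : ℝ) (θ : M) :
    P.coef (c • U) k t θ = c * P.coef U k t θ := mul_left_comm (P.om k t : ℂ) c (U.1 (k, t, θ))

lemma coef_sum {ι : Type*} (s : Finset ι) (U : ι → CoefSpace μ) (k : Freq) (t : ℝ) (θ : M) :
    P.coef (∑ i ∈ s, U i) k t θ = ∑ i ∈ s, P.coef (U i) k t θ := by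
  classical
  induction s using Finset.induction_on with
  | empty => simp [coef_zero]
  | insert i s hi ih => rw [Finset.sum_insert hi, Finset.sum_insert hi, coef_add, ih]

lemma summable_coef (U : CoefSpace μ) (t : ℝ) (θ : M) : Summable fun k => ‖P.coef U k t θ‖ :=
  (summable_wt.mul_left ‖U‖).of_nonneg_of_le (fun _ => norm_nonneg _) fun k =>
    (P.norm_coef_le U k t θ).trans (mul_le_mul_of_nonneg_left (P.om_le_wt k t) (norm_nonneg _))

/-! ### Products -/

lemma norm_coef_mul_coef_le (U V : CoefSpace μ) (j k : Freq) (t : ℝ) (θ : M) :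
    ‖P.coef U j t θ * P.coef V (k - j) t θ‖ ≤ ‖U‖ * ‖V‖ * (P.om j t * P.om (k - j) t) := by
  rw [norm_mul]
  calc _ ≤ (‖U‖ * P.om j t) * (‖V‖ * P.om (k - j) t) := by
        have := P.om_pos j t
        gcongr <;> exact P.norm_coef_le _ _ _ _
    _ = _ := by ring

lemma norm_coef_mul_coef_le_wt (U V : CoefSpace μ) (j k : Freq) (t : ℝ) (θ : M) :
    ‖P.coef U j t θ * P.coef V (k - j) t θ‖ ≤ ‖U‖ * ‖V‖ * (wt j * wt (k - j)) := by
  refine (P.norm_coef_mul_coef_le U V j k t θ).trans ?_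
  have := P.om_pos (k - j) t
  have := wt_pos j
  gcongr <;> exact P.om_le_wt _ _

lemma summable_coef_mul_coef (U V : CoefSpace μ) (k : Freq) (t : ℝ) (θ : M) :
    Summable fun j => P.coef U j t θ * P.coef V (k - j) t θ :=
  Summable.of_norm_bounded ((P.summable_om_mul_om k t).mul_left _) fun j =>
    P.norm_coef_mul_coef_le U V j k t θ

/-- The algebra property: the convolution of two sequences dominated by the weight is dominated by
it again, with constant 1. -/
lemma norm_conv_le (U V : CoefSpace μ) (k : Freq) (t : ℝ) (θ : M) :
    ‖conv (fun j => P.coef U j t θ) (fun j => P.coef V j t θ) k‖ ≤ ‖U‖ * ‖V‖ * P.om k t := by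
  refine (tsum_of_norm_bounded ((P.summable_om_mul_om k t).mul_left _).hasSum fun j =>
    P.norm_coef_mul_coef_le U V j k t θ).trans ?_
  rw [tsum_mul_left]
  exact mul_le_mul_of_nonneg_left (P.tsum_om_mul_om_le k t) (by positivity)

lemma isCoef_conv (U V : CoefSpace μ) :
    IsCoef μ fun k t θ => conv (fun j => P.coef U j t θ) (fun j => P.coef V j t θ) k where
  cont k θ := continuous_tsum
    (fun j => ((P.isCoef_coef U).cont j θ).mul ((P.isCoef_coef V).cont (k - j) θ))
    -- The majorant must not depend on t, hence the bound by the purely polynomial weights.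
    ((summable_wt_mul_wt k).mul_left _) fun j t => P.norm_coef_mul_coef_le_wt U V j k t θ
  meas k t := aestronglyMeasurable_tsum
    (fun j => ((P.isCoef_coef U).meas j t).mul ((P.isCoef_coef V).meas (k - j) t))
    fun θ => P.summable_coef_mul_coef U V k t θ
  herm t θ k := by
    simp only [conv]
    rw [← (Equiv.neg Freq).tsum_eq, Complex.conj_tsum]
    refine tsum_congr fun j => ?_
    have h1 := (P.isCoef_coef U).herm t θ j
    have h2 := (P.isCoef_coef V).herm t θ (k - j)
    simp only at h1 h2
    rw [Equiv.neg_apply, map_mul, ← h1, ← h2]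
    congr 2
    abel

/-- The product, whose coefficients are given by a convolution. -/
def mul : CoefSpace μ →L[ℝ] CoefSpace μ →L[ℝ] CoefSpace μ :=
  LinearMap.mkContinuous₂
    (LinearMap.mk₂ ℝ (fun U V => P.ofCoef _ (P.isCoef_conv U V)
        ⟨_, P.norm_conv_le U V⟩)
      (fun U U' V => P.coef_injective (by
        funext k t θ
        simp only [coef_add, coef_ofCoef, conv, add_mul]
        exact (P.summable_coef_mul_coef U V k t θ).tsum_add (P.summable_coef_mul_coef U' V k t θ)))
      (fun c U V => P.coef_injective (by
        funext k t θ
        simp only [coef_smul, coef_ofCoef, conv, mul_assoc, tsum_mul_left]))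
      (fun U V V' => P.coef_injective (by
        funext k t θ
        simp only [coef_add, coef_ofCoef, conv, mul_add]
        exact (P.summable_coef_mul_coef U V k t θ).tsum_add (P.summable_coef_mul_coef U V' k t θ)))
      (fun c U V => P.coef_injective (by
        funext k t θ
        simp only [coef_smul, coef_ofCoef, conv, mul_left_comm _ (c : ℂ), tsum_mul_left])))
    1 fun U V => by
      rw [one_mul]
      refine P.norm_le_of_coef _ (by positivity) fun k t θ => ?_
      simpa using P.norm_conv_le U V k t θ

@[simp] lemma coef_mul (U V : CoefSpace μ) (k : Freq) (t : ℝ) (θ : M) :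
    P.coef (P.mul U V) k t θ = conv (fun j => P.coef U j t θ) (fun j => P.coef V j t θ) k := by
  simp [mul]

lemma norm_mul_le (U V : CoefSpace μ) : ‖P.mul U V‖ ≤ ‖U‖ * ‖V‖ := by
  refine P.norm_le_of_coef _ (by positivity) fun k t θ => ?_
  simpa using P.norm_conv_le U V k t θ

/-! ### Fourier multipliers -/

/-- Bounded symbols of operators that preserve real functions. -/
structure IsSymbol (H : ℝ) (p : Freq → ℂ) : Prop where
  herm : Herm p
  bound : ∀ k, ‖p k‖ ≤ H

lemma IsSymbol.nonneg {H : ℝ} {p : Freq → ℂ} (hp : IsSymbol H p) : 0 ≤ H :=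
  (norm_nonneg _).trans (hp.bound 0)

lemma isCoef_multiplier {H : ℝ} {p : Freq → ℂ} (hp : IsSymbol H p) (U : CoefSpace μ) :
    IsCoef μ fun k t θ => p k * P.coef U k t θ where
  cont k θ := ((P.isCoef_coef U).cont k θ).const_mul _
  meas k t := ((P.isCoef_coef U).meas k t).const_mul _
  herm t θ := hp.herm.mul ((P.isCoef_coef U).herm t θ)

lemma norm_multiplier_le {H : ℝ} {p : Freq → ℂ} (hp : IsSymbol H p) (U : CoefSpace μ)
    (k : Freq) (t : ℝ) (θ : M) : ‖p k * P.coef U k t θ‖ ≤ H * ‖U‖ * P.om k t := by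
  rw [norm_mul, mul_assoc]
  exact mul_le_mul (hp.bound k) (P.norm_coef_le U k t θ) (norm_nonneg _) hp.nonneg

/-- The Fourier multiplier with symbol `p`. -/
def multiplier {H : ℝ} {p : Freq → ℂ} (hp : IsSymbol H p) : CoefSpace μ →L[ℝ] CoefSpace μ :=
  LinearMap.mkContinuous
    { toFun := fun U => P.ofCoef _ (P.isCoef_multiplier hp U) ⟨_, P.norm_multiplier_le hp U⟩
      map_add' := fun U V => P.coef_injective (by
        funext k t θ; simp only [coef_add, coef_ofCoef, mul_add])
      map_smul' := fun c U => P.coef_injective (by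
        funext k t θ; simp only [coef_smul, coef_ofCoef, RingHom.id_apply, mul_left_comm]) }
    H fun U => by
      refine P.norm_le_of_coef _ (mul_nonneg hp.nonneg (norm_nonneg _)) fun k t θ => ?_
      simpa using P.norm_multiplier_le hp U k t θ

@[simp] lemma coef_multiplier {H : ℝ} {p : Freq → ℂ} (hp : IsSymbol H p) (U : CoefSpace μ)
    (k : Freq) (t : ℝ) (θ : M) : P.coef (P.multiplier hp U) k t θ = p k * P.coef U k t θ := by
  simp [multiplier]

lemma norm_multiplier_apply_le {H : ℝ} {p : Freq → ℂ} (hp : IsSymbol H p) (U : CoefSpace μ) :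
    ‖P.multiplier hp U‖ ≤ H * ‖U‖ := by
  refine P.norm_le_of_coef _ (mul_nonneg hp.nonneg (norm_nonneg _)) fun k t θ => ?_
  simpa using P.norm_multiplier_le hp U k t θ

/-! ### Averages over the parameter -/

variable [IsProbabilityMeasure μ]

lemma integrable_coef (U : CoefSpace μ) (k : Freq) (t : ℝ) :
    Integrable (fun θ => P.coef U k t θ) μ :=
  Integrable.of_bound ((P.isCoef_coef U).meas k t) _
    (Eventually.of_forall fun θ => P.norm_coef_le U k t θ)

lemma norm_average_le (U : CoefSpace μ) (k : Freq) (t : ℝ) :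
    ‖∫ θ, P.coef U k t θ ∂μ‖ ≤ ‖U‖ * P.om k t := by
  have := norm_integral_le_of_norm_le_const (μ := μ)
    (Eventually.of_forall fun θ => P.norm_coef_le U k t θ)
  simpa using this

lemma isCoef_average (U : CoefSpace μ) :
    IsCoef μ fun k t _ => ∫ θ, P.coef U k t θ ∂μ where
  cont k _ := continuous_of_dominated (bound := fun _ => ‖U‖ * wt k)
    (fun t => (P.isCoef_coef U).meas k t)
    (fun t => Eventually.of_forall fun θ => (P.norm_coef_le U k t θ).trans
      (mul_le_mul_of_nonneg_left (P.om_le_wt k t) (norm_nonneg _)))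
    (integrable_const _) (Eventually.of_forall fun θ => (P.isCoef_coef U).cont k θ)
  meas _ _ := aestronglyMeasurable_const
  herm t _ k := by
    rw [← integral_conj]
    exact integral_congr_ae (Eventually.of_forall fun θ => (P.isCoef_coef U).herm t θ k)

/-- The average over the parameter `θ`. -/
def average : CoefSpace μ →L[ℝ] CoefSpace μ :=
  LinearMap.mkContinuous
    { toFun := fun U => P.ofCoef _ (P.isCoef_average U) ⟨_, fun k t _ => P.norm_average_le U k t⟩
      map_add' := fun U V => P.coef_injective (by
        funext k t θ
        simp only [coef_add, coef_ofCoef]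
        exact integral_add (P.integrable_coef U k t) (P.integrable_coef V k t))
      map_smul' := fun c U => P.coef_injective (by
        funext k t θ
        simp only [coef_smul, coef_ofCoef, RingHom.id_apply, integral_const_mul]) }
    1 fun U => by
      rw [one_mul]
      refine P.norm_le_of_coef _ (norm_nonneg _) fun k t θ => ?_
      simpa using P.norm_average_le U k t

@[simp] lemma coef_average (U : CoefSpace μ) (k : Freq) (t : ℝ) (θ : M) :
    P.coef (P.average U) k t θ = ∫ θ', P.coef U k t θ' ∂μ := by
  simp [average]

lemma norm_average_apply_le (U : CoefSpace μ) : ‖P.average U‖ ≤ ‖U‖ := by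
  refine P.norm_le_of_coef _ (norm_nonneg _) fun k t θ => ?_
  simpa using P.norm_average_le U k t

end WeightPar

namespace WeightPar

variable (P : WeightPar) {M : Type*} [MeasurableSpace M] {μ : Measure M}

/-! ### Integration in time -/

/-- Convolution kernels in time that lose at most one derivative. -/
structure IsKernel (H : ℝ) (h : Freq → ℝ → ℂ) : Prop where
  nonneg : 0 ≤ H
  cont : ∀ k, Continuous (h k)
  herm : ∀ t, Herm fun k => h k t
  bound : ∀ k, ∀ t ∈ Icc 0 P.T, ‖h k t‖ ≤ H * (1 + freqNorm k)

/-- The gain of an integration in time. -/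
def gain : ℝ := P.T + 1 / P.lam

lemma gain_nonneg : 0 ≤ P.gain := by
  have := P.T_pos; have := P.lam_pos; unfold gain; positivity

/-- Relative to the weight at the later time t, the weight at time s is smaller by exp(-λ(t-s)|k|).
This decay pays for a derivative. -/
lemma om_eq_mul {s t : ℝ} (hs : s ∈ Icc 0 P.T) (k : Freq) :
    P.om k s = P.om k t * Real.exp (-(P.lam * (P.clamp t - s)) * freqNorm k) := by
  unfold om width
  rw [P.clamp_of_mem hs, mul_assoc, ← Real.exp_add]
  congr 2
  ring

/-- The factor x is absorbed because ∫ λx exp(-λ(t-s)x) ds ≤ 1, uniformly in x ≥ 0; the remaining 1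
contributes at most T. -/
lemma integral_one_add_mul_exp_le {x : ℝ} (hx : 0 ≤ x) {t : ℝ} (ht : t ∈ Icc 0 P.T) :
    ∫ s in (0 : ℝ)..t, (1 + x) * Real.exp (-(P.lam * (t - s)) * x) ≤ P.gain := by
  have hl := P.lam_pos
  have hle : ∀ s ∈ Icc 0 t, (1 + x) * Real.exp (-(P.lam * (t - s)) * x) ≤
      1 + x * Real.exp (-(P.lam * (t - s)) * x) := by
    intro s hs
    have h1 : Real.exp (-(P.lam * (t - s)) * x) ≤ 1 := by
      apply Real.exp_le_one_iff.2
      have : 0 ≤ P.lam * (t - s) * x := by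
        have := sub_nonneg.2 hs.2
        positivity
      linarith
    linarith
  -- This primitive contains no division by x, so the zero frequency needs no separate treatment.
  have hd : ∀ s, HasDerivAt (fun s => s + 1 / P.lam * Real.exp (-(P.lam * (t - s)) * x))
      (1 + x * Real.exp (-(P.lam * (t - s)) * x)) s := by
    intro s
    have h := (((((hasDerivAt_id s).const_sub t).const_mul P.lam).neg.mul_const x).exp.const_mul
      (1 / P.lam))
    refine ((hasDerivAt_id s).add h).congr_deriv ?_
    simp
    field_simp
  calc _ ≤ ∫ s in (0 : ℝ)..t, (1 + x * Real.exp (-(P.lam * (t - s)) * x)) :=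
        intervalIntegral.integral_mono_on ht.1
          (Continuous.intervalIntegrable (by fun_prop) _ _)
          (Continuous.intervalIntegrable (by fun_prop) _ _) hle
    _ = _ := intervalIntegral.integral_eq_sub_of_hasDerivAt (fun s _ => hd s)
          (Continuous.intervalIntegrable (by fun_prop) _ _)
    _ ≤ P.gain := by
      have h2 : 0 ≤ 1 / P.lam * Real.exp (-(P.lam * (t - 0)) * x) := by positivity
      unfold gain
      simp only [sub_self, mul_zero, neg_zero, zero_mul, Real.exp_zero, mul_one]
      linarith [ht.2]

variable {P} {H : ℝ} {h : Freq → ℝ → ℂ}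

lemma continuous_kernel_mul (hh : P.IsKernel H h) (U : CoefSpace μ) (k : Freq) (t : ℝ) (θ : M) :
    Continuous fun s => h k (P.clamp t - s) * P.coef U k s θ :=
  ((hh.cont k).comp (by fun_prop)).mul ((P.isCoef_coef U).cont k θ)

/-- The derivative lost by the kernel is recovered from the shrinking strip: the norm stays the same
and only the factor `gain` appears. -/
lemma norm_duhamel_le (hh : P.IsKernel H h) (U : CoefSpace μ) (k : Freq) (t : ℝ) (θ : M) :
    ‖∫ s in (0 : ℝ)..P.clamp t, h k (P.clamp t - s) * P.coef U k s θ‖ ≤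
      H * P.gain * ‖U‖ * P.om k t := by
  have hc := P.clamp_mem t
  have hk := freqNorm_nonneg k
  have hle : ∀ s ∈ Ioc 0 (P.clamp t), ‖h k (P.clamp t - s) * P.coef U k s θ‖ ≤
      H * ‖U‖ * P.om k t * ((1 + freqNorm k) *
        Real.exp (-(P.lam * (P.clamp t - s)) * freqNorm k)) := by
    intro s hs
    have hs' : s ∈ Icc 0 P.T := ⟨hs.1.le, hs.2.trans hc.2⟩
    have h1 := hh.bound k (P.clamp t - s) ⟨sub_nonneg.2 hs.2, by linarith [hs.1, hc.2]⟩
    have h2 := P.norm_coef_le U k s θ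
    rw [P.om_eq_mul (t := t) hs'] at h2
    rw [norm_mul]
    have hH := hh.nonneg
    calc _ ≤ (H * (1 + freqNorm k)) * (‖U‖ * (P.om k t *
          Real.exp (-(P.lam * (P.clamp t - s)) * freqNorm k))) :=
          mul_le_mul h1 h2 (norm_nonneg _) (by positivity)
      _ = _ := by ring
  refine (intervalIntegral.norm_integral_le_of_norm_le hc.1
    (Eventually.of_forall hle) (Continuous.intervalIntegrable (by fun_prop) _ _)).trans ?_
  rw [intervalIntegral.integral_const_mul]
  have h3 := P.integral_one_add_mul_exp_le hk hc
  have h4 : 0 ≤ H * ‖U‖ * P.om k t :=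
    mul_nonneg (mul_nonneg hh.nonneg (norm_nonneg _)) (P.om_pos k t).le
  calc _ ≤ H * ‖U‖ * P.om k t * P.gain := mul_le_mul_of_nonneg_left h3 h4
    _ = _ := by ring

lemma isCoef_duhamel (hh : P.IsKernel H h) (U : CoefSpace μ) :
    IsCoef μ fun k t θ => ∫ s in (0 : ℝ)..P.clamp t, h k (P.clamp t - s) * P.coef U k s θ where
  cont k θ := by
    have hcl := P.continuous_clamp
    refine intervalIntegral.continuous_parametric_intervalIntegral_of_continuous
      (f := fun t s => h k (P.clamp t - s) * P.coef U k s θ) ?_ hcl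
    have h1 := hh.cont k
    have h2 := (P.isCoef_coef U).cont k θ
    exact (h1.comp ((hcl.comp continuous_fst).sub continuous_snd)).mul (h2.comp continuous_snd)
  meas k t := by
    simp only [intervalIntegral.integral_of_le (P.clamp_mem t).1]
    -- The integrand is continuous in time and measurable in θ separately, which suffices for the
    -- time integral to be measurable in θ.
    exact aestronglyMeasurable_integral_of_continuous _
      (fun θ => continuous_kernel_mul hh U k t θ)
      fun s => ((P.isCoef_coef U).meas k s).const_mul _
  herm t θ k := by
    simp only [intervalIntegral.integral_of_le (P.clamp_mem t).1]
    rw [← integral_conj]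
    exact integral_congr_ae (Eventually.of_forall fun s =>
      (hh.herm _).mul ((P.isCoef_coef U).herm s θ) k)

/-- The time convolution with a kernel. -/
def duhamel (hh : P.IsKernel H h) : CoefSpace μ →L[ℝ] CoefSpace μ :=
  LinearMap.mkContinuous
    { toFun := fun U => P.ofCoef _ (isCoef_duhamel hh U) ⟨_, norm_duhamel_le hh U⟩
      map_add' := fun U V => P.coef_injective (by
        funext k t θ
        simp only [coef_add, coef_ofCoef, mul_add]
        exact intervalIntegral.integral_add
          ((continuous_kernel_mul hh U k t θ).intervalIntegrable _ _)
          ((continuous_kernel_mul hh V k t θ).intervalIntegrable _ _))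
      map_smul' := fun c U => P.coef_injective (by
        funext k t θ
        simp only [coef_smul, coef_ofCoef, RingHom.id_apply, mul_left_comm _ (c : ℂ),
          intervalIntegral.integral_const_mul]) }
    (H * P.gain) fun U => by
      refine P.norm_le_of_coef _
        (mul_nonneg (mul_nonneg hh.nonneg P.gain_nonneg) (norm_nonneg _)) fun k t θ => ?_
      simpa using norm_duhamel_le hh U k t θ

@[simp] lemma coef_duhamel (hh : P.IsKernel H h) (U : CoefSpace μ) (k : Freq) (t : ℝ) (θ : M) :
    P.coef (duhamel hh U) k t θ =
      ∫ s in (0 : ℝ)..P.clamp t, h k (P.clamp t - s) * P.coef U k s θ := by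
  simp [duhamel]

lemma norm_duhamel_apply_le (hh : P.IsKernel H h) (U : CoefSpace μ) :
    ‖duhamel hh U‖ ≤ H * P.gain * ‖U‖ := by
  refine P.norm_le_of_coef _
    (mul_nonneg (mul_nonneg hh.nonneg P.gain_nonneg) (norm_nonneg _)) fun k t θ => ?_
  simpa using norm_duhamel_le hh U k t θ

end WeightPar

/-! ### The wave propagators -/

/-- The angular frequency `2 π |k|`. -/
def ang (k : Freq) : ℝ := 2 * Real.pi * freqNorm k

lemma ang_nonneg (k : Freq) : 0 ≤ ang k := by
  have := freqNorm_nonneg k; have := Real.pi_pos; unfold ang; positivity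

lemma ang_pos {k : Freq} (hk : k ≠ 0) : 0 < ang k := by
  have := one_le_freqNorm hk; have := Real.pi_pos; unfold ang; positivity

@[simp] lemma ang_zero : ang 0 = 0 := by simp [ang]

@[simp] lemma ang_neg (k : Freq) : ang (-k) = ang k := by simp [ang]

lemma one_le_ang {k : Freq} (hk : k ≠ 0) : 1 ≤ ang k := by
  have := one_le_freqNorm hk; have := Real.pi_gt_three; unfold ang; nlinarith

/-- The cosine propagator of `ε² ∂ₜ² + |2πk|²`. -/
def cosK (ε : ℝ) (k : Freq) (t : ℝ) : ℝ := Real.cos (ang k * t / ε)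

/-- The sine propagator of `ε² ∂ₜ² + |2πk|²`. -/
def sinK (ε : ℝ) (k : Freq) (t : ℝ) : ℝ :=
  if k = 0 then t / ε else Real.sin (ang k * t / ε) / ang k

@[simp] lemma cosK_neg (ε : ℝ) (k : Freq) (t : ℝ) : cosK ε (-k) t = cosK ε k t := by simp [cosK]

@[simp] lemma sinK_neg (ε : ℝ) (k : Freq) (t : ℝ) : sinK ε (-k) t = sinK ε k t := by simp [sinK]

lemma continuous_cosK (ε : ℝ) (k : Freq) : Continuous (cosK ε k) := by unfold cosK; fun_prop

lemma continuous_sinK (ε : ℝ) (k : Freq) : Continuous (sinK ε k) := by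
  unfold sinK; split_ifs <;> fun_prop

lemma abs_cosK_le (ε : ℝ) (k : Freq) (t : ℝ) : |cosK ε k t| ≤ 1 := Real.abs_cos_le_one _

lemma ang_mul_abs_sinK_le (ε : ℝ) (k : Freq) (t : ℝ) : ang k * |sinK ε k t| ≤ 1 := by
  unfold sinK
  split_ifs with hk
  · simp [hk]
  · rw [abs_div, abs_of_pos (ang_pos hk), mul_div_cancel₀ _ (ang_pos hk).ne']
    exact Real.abs_sin_le_one _

/-- Uniform in ε and t because 2π|k| ≥ 1 off the zero mode. For k = 0 the propagator is t/ε, which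
is why the mean of E⁰ restricts the time of existence. -/
lemma abs_sinK_le_one {ε : ℝ} {k : Freq} (hk : k ≠ 0) (t : ℝ) : |sinK ε k t| ≤ 1 := by
  have h1 := ang_mul_abs_sinK_le ε k t
  have h2 := one_le_ang hk
  nlinarith [abs_nonneg (sinK ε k t)]

@[simp] lemma cosK_zero (ε : ℝ) (k : Freq) : cosK ε k 0 = 1 := by simp [cosK]

@[simp] lemma sinK_zero (ε : ℝ) (k : Freq) : sinK ε k 0 = 0 := by simp [sinK]

lemma hasDerivAt_cosK (ε : ℝ) (k : Freq) (t : ℝ) :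
    HasDerivAt (cosK ε k) (-(ang k ^ 2 / ε) * sinK ε k t) t := by
  have h := (((hasDerivAt_id t).const_mul (ang k)).div_const ε).cos
  refine h.congr_deriv ?_
  unfold sinK
  split_ifs with hk
  · simp [hk]
  · have := ang_pos hk
    simp
    field_simp

lemma hasDerivAt_sinK (ε : ℝ) (k : Freq) (t : ℝ) :
    HasDerivAt (sinK ε k) (cosK ε k t / ε) t := by
  by_cases hk : k = 0
  · have h := (hasDerivAt_id t).div_const ε
    have e : sinK ε k = fun x => id x / ε := by funext x; simp [sinK, hk]
    rw [e]
    exact h.congr_deriv (by simp [cosK, hk])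
  · have h := (((hasDerivAt_id t).const_mul (ang k)).div_const ε).sin.div_const (ang k)
    have e : sinK ε k = fun x => Real.sin (ang k * id x / ε) / ang k := by
      funext x; simp [sinK, hk]
    rw [e]
    refine h.congr_deriv ?_
    have := ang_pos hk
    simp [cosK]
    field_simp

lemma sinK_sub (ε : ℝ) (k : Freq) (t s : ℝ) :
    sinK ε k (t - s) = sinK ε k t * cosK ε k s - cosK ε k t * sinK ε k s := by
  unfold sinK cosK
  split_ifs with hk
  · simp [hk]; ring
  · rw [mul_sub, sub_div, Real.sin_sub]; ring

lemma cosK_sub (ε : ℝ) (k : Freq) (t s : ℝ) :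
    cosK ε k (t - s) = cosK ε k t * cosK ε k s + ang k ^ 2 * (sinK ε k t * sinK ε k s) := by
  unfold sinK cosK
  split_ifs with hk
  · simp [hk]
  · have := ang_pos hk
    rw [mul_sub, sub_div, Real.cos_sub]
    field_simp

lemma cosK_sq_add (ε : ℝ) (k : Freq) (t : ℝ) :
    cosK ε k t ^ 2 + ang k ^ 2 * sinK ε k t ^ 2 = 1 := by
  have := cosK_sub ε k t t
  rw [sub_self, cosK_zero] at this
  rw [this]
  ring

/-! ### Differentiation of the Duhamel integrals of the wave equation -/

section Duhamel

variable {f : ℝ → ℂ}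

/-- The addition formula separates t from s, so that only integrals with fixed integrands are
differentiated. The two boundary terms cancel, the sine propagator being 0 at time 0. -/
lemma hasDerivAt_integral_sinK (hf : Continuous f) (ε : ℝ) (k : Freq) (t : ℝ) :
    HasDerivAt (fun t => ∫ s in (0 : ℝ)..t, (sinK ε k (t - s) : ℂ) * f s)
      ((ε : ℂ)⁻¹ * ∫ s in (0 : ℝ)..t, (cosK ε k (t - s) : ℂ) * f s) t := by
  have hC : Continuous fun s => (cosK ε k s : ℂ) * f s :=
    (Complex.continuous_ofReal.comp (continuous_cosK ε k)).mul hf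
  have hS : Continuous fun s => (sinK ε k s : ℂ) * f s :=
    (Complex.continuous_ofReal.comp (continuous_sinK ε k)).mul hf
  have e1 : ∀ t, ∫ s in (0 : ℝ)..t, (sinK ε k (t - s) : ℂ) * f s =
      sinK ε k t * (∫ s in (0 : ℝ)..t, (cosK ε k s : ℂ) * f s)
        - cosK ε k t * ∫ s in (0 : ℝ)..t, (sinK ε k s : ℂ) * f s := by
    intro t
    rw [← intervalIntegral.integral_const_mul, ← intervalIntegral.integral_const_mul,
      ← intervalIntegral.integral_sub ((hC.const_mul _).intervalIntegrable _ _)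
        ((hS.const_mul _).intervalIntegrable _ _)]
    congr 1
    funext s
    rw [sinK_sub]
    push_cast
    ring
  have e2 : ∫ s in (0 : ℝ)..t, (cosK ε k (t - s) : ℂ) * f s =
      cosK ε k t * (∫ s in (0 : ℝ)..t, (cosK ε k s : ℂ) * f s)
        + ang k ^ 2 * sinK ε k t * ∫ s in (0 : ℝ)..t, (sinK ε k s : ℂ) * f s := by
    rw [← intervalIntegral.integral_const_mul, ← intervalIntegral.integral_const_mul,
      ← intervalIntegral.integral_add ((hC.const_mul _).intervalIntegrable _ _)
        ((hS.const_mul _).intervalIntegrable _ _)]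
    congr 1
    funext s
    rw [cosK_sub]
    push_cast
    ring
  simp only [e1]
  rw [e2]
  have d := ((hasDerivAt_sinK ε k t).ofReal_comp.mul
    (hC.integral_hasStrictDerivAt 0 t).hasDerivAt).sub
    ((hasDerivAt_cosK ε k t).ofReal_comp.mul (hS.integral_hasStrictDerivAt 0 t).hasDerivAt)
  refine d.congr_deriv ?_
  push_cast
  ring

lemma hasDerivAt_integral_cosK (hf : Continuous f) (ε : ℝ) (k : Freq) (t : ℝ) :
    HasDerivAt (fun t => ∫ s in (0 : ℝ)..t, (cosK ε k (t - s) : ℂ) * f s)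
      (f t - ang k ^ 2 * (ε : ℂ)⁻¹ * ∫ s in (0 : ℝ)..t, (sinK ε k (t - s) : ℂ) * f s) t := by
  have hC : Continuous fun s => (cosK ε k s : ℂ) * f s :=
    (Complex.continuous_ofReal.comp (continuous_cosK ε k)).mul hf
  have hS : Continuous fun s => (sinK ε k s : ℂ) * f s :=
    (Complex.continuous_ofReal.comp (continuous_sinK ε k)).mul hf
  have e1 : ∫ s in (0 : ℝ)..t, (sinK ε k (t - s) : ℂ) * f s =
      sinK ε k t * (∫ s in (0 : ℝ)..t, (cosK ε k s : ℂ) * f s)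
        - cosK ε k t * ∫ s in (0 : ℝ)..t, (sinK ε k s : ℂ) * f s := by
    rw [← intervalIntegral.integral_const_mul, ← intervalIntegral.integral_const_mul,
      ← intervalIntegral.integral_sub ((hC.const_mul _).intervalIntegrable _ _)
        ((hS.const_mul _).intervalIntegrable _ _)]
    congr 1
    funext s
    rw [sinK_sub]
    push_cast
    ring
  have e2 : ∀ t, ∫ s in (0 : ℝ)..t, (cosK ε k (t - s) : ℂ) * f s =
      cosK ε k t * (∫ s in (0 : ℝ)..t, (cosK ε k s : ℂ) * f s)
        + ang k ^ 2 * (sinK ε k t * ∫ s in (0 : ℝ)..t, (sinK ε k s : ℂ) * f s) := by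
    intro t
    rw [← mul_assoc, ← intervalIntegral.integral_const_mul, ← intervalIntegral.integral_const_mul,
      ← intervalIntegral.integral_add ((hC.const_mul _).intervalIntegrable _ _)
        ((hS.const_mul _).intervalIntegrable _ _)]
    congr 1
    funext s
    rw [cosK_sub]
    push_cast
    ring
  simp only [e2]
  rw [e1]
  have d := ((hasDerivAt_cosK ε k t).ofReal_comp.mul
    (hC.integral_hasStrictDerivAt 0 t).hasDerivAt).add
    (((hasDerivAt_sinK ε k t).ofReal_comp.mul
      (hS.integral_hasStrictDerivAt 0 t).hasDerivAt).const_mul ((ang k : ℂ) ^ 2))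
  refine d.congr_deriv ?_
  -- The boundary terms now add up to f t times this quantity: the cosine propagator is 1 at time 0.
  have key : (cosK ε k t : ℂ) ^ 2 + (ang k : ℂ) ^ 2 * (sinK ε k t : ℂ) ^ 2 = 1 := by
    exact_mod_cast cosK_sq_add ε k t
  push_cast
  linear_combination f t * key

end Duhamel

open WeightPar

/-! ### Symbols of the operators of the system -/

/-- The symbol of the Leray projection. -/
def leraySym (i j : Fin 3) (k : Freq) : ℂ :=
  ((if i = j then 1 else 0) - (k i : ℝ) * (k j : ℝ) / freqNorm k ^ 2 : ℝ)

/-- The symbol of the curl. -/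
def curlSym (i l : Fin 3) (k : Freq) : ℂ :=
  if l = i + 2 then dsym (i + 1) k else if l = i + 1 then -dsym (i + 2) k else 0

lemma norm_dsym_le_ang (i : Fin 3) (k : Freq) : ‖dsym i k‖ ≤ ang k := norm_dsym_le i k

lemma norm_curlSym_le (i l : Fin 3) (k : Freq) : ‖curlSym i l k‖ ≤ ang k := by
  unfold curlSym
  split_ifs
  · exact norm_dsym_le_ang _ _
  · rw [norm_neg]; exact norm_dsym_le_ang _ _
  · simpa using ang_nonneg k

lemma herm_dsym (i : Fin 3) : Herm (dsym i) := fun k => dsym_neg i k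

lemma herm_curlSym (i l : Fin 3) : Herm (curlSym i l) := by
  intro k
  unfold curlSym
  split_ifs <;> simp [dsym_neg]

lemma herm_ofReal {f : Freq → ℝ} (hf : ∀ k, f (-k) = f k) : Herm fun k => (f k : ℂ) := by
  intro k; simp [hf]

lemma isSymbol_leraySym (i j : Fin 3) : IsSymbol 2 (leraySym i j) where
  herm := herm_ofReal fun k => by simp
  bound k := by
    rw [leraySym, Complex.norm_real, Real.norm_eq_abs]
    have h1 : |(if i = j then (1 : ℝ) else 0)| ≤ 1 := by split_ifs <;> simp
    have h2 : |(k i : ℝ) * (k j : ℝ) / freqNorm k ^ 2| ≤ 1 := by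
      rw [abs_div, abs_mul, abs_of_nonneg (sq_nonneg (freqNorm k))]
      refine div_le_one_of_le₀ ?_ (sq_nonneg _)
      rw [sq]
      exact mul_le_mul (abs_le_freqNorm k i) (abs_le_freqNorm k j) (abs_nonneg _)
        (freqNorm_nonneg k)
    exact (abs_sub _ _).trans (by linarith)

lemma isSymbol_invLam : IsSymbol 1 fun k => ((1 / (1 + freqNorm k) : ℝ) : ℂ) where
  herm := herm_ofReal fun k => by simp
  bound k := by
    have := freqNorm_nonneg k
    rw [Complex.norm_real, Real.norm_of_nonneg (by positivity)]
    exact div_le_one_of_le₀ (by linarith) (by positivity)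

/-- The gradient of ξ is a bounded function of the unknown (1+|k|)ξ; the constant 7 is an upper
bound for 2π, here and below. -/
lemma isSymbol_dsym_invLam (j : Fin 3) :
    IsSymbol 7 fun k => dsym j k * ((1 / (1 + freqNorm k) : ℝ) : ℂ) where
  herm := (herm_dsym j).mul isSymbol_invLam.herm
  bound k := by
    have h0 := freqNorm_nonneg k
    have hpi := Real.pi_pos
    rw [norm_mul, Complex.norm_real, Real.norm_of_nonneg (by positivity), mul_one_div,
      div_le_iff₀ (by positivity)]
    have := norm_dsym_le j k
    nlinarith [Real.pi_lt_d2]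

lemma isSymbol_invLaplacian : IsSymbol 1 fun k => ((1 / ang k ^ 2 : ℝ) : ℂ) where
  herm := herm_ofReal fun k => by simp
  bound k := by
    rw [Complex.norm_real, Real.norm_of_nonneg (by positivity)]
    by_cases hk : k = 0
    · simp [hk]
    · have := one_le_ang hk
      exact div_le_one_of_le₀ (one_le_pow₀ this) (by positivity)

lemma isSymbol_gradPot (i : Fin 3) : IsSymbol 1 fun k => dsym i k * ((1 / ang k ^ 2 : ℝ) : ℂ) where
  herm := (herm_dsym i).mul isSymbol_invLaplacian.herm
  bound k := by
    rw [norm_mul, Complex.norm_real, Real.norm_of_nonneg (by positivity)]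
    by_cases hk : k = 0
    · simp [hk]
    · have h1 := one_le_ang hk
      have h2 := norm_dsym_le_ang i k
      rw [mul_one_div]
      refine div_le_one_of_le₀ ?_ (by positivity)
      nlinarith

lemma isKernel_dsym (P : WeightPar) (j : Fin 3) : P.IsKernel 7 fun k _ => dsym j k where
  nonneg := by norm_num
  cont _ := continuous_const
  herm _ := herm_dsym j
  bound k _ _ := by
    have h0 := freqNorm_nonneg k
    have := norm_dsym_le j k
    nlinarith [Real.pi_lt_d2]

lemma isKernel_lam (P : WeightPar) : P.IsKernel 1 fun k _ => ((1 + freqNorm k : ℝ) : ℂ) where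
  nonneg := zero_le_one
  cont _ := continuous_const
  herm _ := herm_ofReal fun k => by simp
  bound k _ _ := by
    have h0 := freqNorm_nonneg k
    rw [Complex.norm_real, Real.norm_of_nonneg (by positivity), one_mul]

/-- Nonzero modes use ε ≤ 1. On the zero mode the quantity equals t, and t ≤ 1 is needed; hence the
requirement T ≤ 1. -/
lemma abs_mul_sinK_le {ε : ℝ} (h0 : 0 < ε) (h1 : ε ≤ 1) (k : Freq) {t : ℝ} (ht : t ∈ Icc (0 : ℝ) 1) :
    |ε * sinK ε k t| ≤ 1 := by
  by_cases hk : k = 0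
  · have : ε * sinK ε k t = t := by simp [sinK, hk]; field_simp
    rw [this, abs_of_nonneg ht.1]
    exact ht.2
  · rw [abs_mul, abs_of_pos h0]
    exact mul_le_one₀ h1 (abs_nonneg _) (abs_sinK_le_one hk t)

/-- The kernel of -(1+|k|)εA up to sign, as it enters the equation for (1+|k|)ξ: the propagator is
bounded uniformly in ε and the weight 1+|k| is the one derivative allowed. -/
lemma isKernel_wave (P : WeightPar) {ε : ℝ} (h0 : 0 < ε) (h1 : ε ≤ 1) (hT : P.T ≤ 1) :
    P.IsKernel 1 fun k t => (((1 + freqNorm k) * (ε * sinK ε k t) : ℝ) : ℂ) where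
  nonneg := zero_le_one
  cont k := by have := continuous_sinK ε k; fun_prop
  herm t := herm_ofReal fun k => by simp
  bound k t ht := by
    have hk := freqNorm_nonneg k
    rw [Complex.norm_real, Real.norm_eq_abs, abs_mul, abs_of_nonneg (by positivity : 0 ≤ 1 + freqNorm k)]
    have := abs_mul_sinK_le h0 h1 k ⟨ht.1, ht.2.trans hT⟩
    nlinarith

/-- The derivative in the curl is cancelled by the 1/|2πk| of the sine propagator, so the bound is
independent of ε. On the zero mode, where the propagator is t/ε, the symbol of the curl vanishes. -/
lemma isKernel_curl (P : WeightPar) (ε : ℝ) (i l : Fin 3) :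
    P.IsKernel 1 fun k t => curlSym i l k * (sinK ε k t : ℂ) where
  nonneg := zero_le_one
  cont k := by have := continuous_sinK ε k; fun_prop
  herm t := (herm_curlSym i l).mul (herm_ofReal fun k => by simp)
  bound k t _ := by
    have hk := freqNorm_nonneg k
    rw [norm_mul, Complex.norm_real, Real.norm_eq_abs]
    have h1 := mul_le_mul_of_nonneg_right (norm_curlSym_le i l k) (abs_nonneg (sinK ε k t))
    have h2 := ang_mul_abs_sinK_le ε k t
    linarith

/-! ### The fixed point problem -/

/-- The data of the fixed point problem: the weights, the parameter `ε`, and the contributions of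
the initial data to the densities, velocities and magnetic field. -/
structure Sys {M : Type*} [MeasurableSpace M] (μ : Measure M) where
  P : WeightPar
  eps : ℝ
  eps_pos : 0 < eps
  eps_le : eps ≤ 1
  T_le : P.T ≤ 1
  rin : CoefSpace μ
  xin : Fin 3 → CoefSpace μ
  bin : Fin 3 → CoefSpace μ

/-- The unknowns: the density, the velocity field multiplied by `1 + |k|`, and the deviation of
the Lorentz factor from `1`. -/
abbrev State {M : Type*} [MeasurableSpace M] (μ : Measure M) : Type _ :=
  CoefSpace μ × (Fin 3 → CoefSpace μ) × CoefSpace μ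

namespace Sys

variable {M : Type*} [MeasurableSpace M] {μ : Measure M}

section Maps

variable [IsProbabilityMeasure μ] (D : Sys μ)

/-- The velocity field `ξ`. -/
def xi (i : Fin 3) (u : State μ) : CoefSpace μ := D.P.multiplier isSymbol_invLam (u.2.1 i)

/-- The derivative `∂ⱼ ξᵢ`. -/
def dxi (i j : Fin 3) (u : State μ) : CoefSpace μ :=
  D.P.multiplier (isSymbol_dsym_invLam j) (u.2.1 i)

/-- The relativistic velocity. -/
def velo (i : Fin 3) (u : State μ) : CoefSpace μ := D.xi i u + D.P.mul (D.xi i u) u.2.2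

/-- The flux `vⱼ ρ`. -/
def flux (j : Fin 3) (u : State μ) : CoefSpace μ := D.P.mul (D.velo j u) u.1

/-- The total current. -/
def cur (j : Fin 3) (u : State μ) : CoefSpace μ := D.P.average (D.flux j u)

/-- The Leray projection of the total current. -/
def pcur (i : Fin 3) (u : State μ) : CoefSpace μ :=
  ∑ j, D.P.multiplier (isSymbol_leraySym i j) (D.cur j u)

/-- The derivative `∂ᵢ φ` of the scalar potential. -/
def gradPhi (i : Fin 3) (u : State μ) : CoefSpace μ :=
  D.P.multiplier (isSymbol_gradPot i) (D.P.average u.1)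

/-- The part of the magnetic field generated by the current. -/
def curlDuh (i : Fin 3) (u : State μ) : CoefSpace μ :=
  ∑ l, duhamel (isKernel_curl D.P D.eps i l) (D.pcur l u)

/-- The magnetic field. -/
def mag (i : Fin 3) (u : State μ) : CoefSpace μ := D.bin i + D.curlDuh i u

/-- The magnetic force `ε v × B`. -/
def magForce (i : Fin 3) (u : State μ) : CoefSpace μ :=
  D.P.mul (D.velo (i + 1) u) (D.eps • D.mag (i + 2) u)
    - D.P.mul (D.velo (i + 2) u) (D.eps • D.mag (i + 1) u)

/-- The right-hand side of the equation for `ξ + ε A`, up to the sign. -/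
def force (i : Fin 3) (u : State μ) : CoefSpace μ :=
  (∑ j, D.P.mul (D.velo j u) (D.dxi i j u)) + D.gradPhi i u - D.magForce i u

/-- The square `|ξ|²`. -/
def xiSq (u : State μ) : CoefSpace μ := ∑ i, D.P.mul (D.xi i u) (D.xi i u)

/-- The terms `|ξ|² (1 + h)²` of the equation for the Lorentz factor. -/
def lorentzTerm (u : State μ) : CoefSpace μ :=
  D.xiSq u + (2 : ℝ) • D.P.mul (D.xiSq u) u.2.2 + D.P.mul (D.xiSq u) (D.P.mul u.2.2 u.2.2)

/-- The first component of the fixed point map. -/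
def stepRho (u : State μ) : CoefSpace μ :=
  D.rin - ∑ j, duhamel (isKernel_dsym D.P j) (D.flux j u)

/-- The second component of the fixed point map. -/
def stepXi (i : Fin 3) (u : State μ) : CoefSpace μ :=
  D.xin i - duhamel (isKernel_wave D.P D.eps_pos D.eps_le D.T_le) (D.pcur i u)
    - duhamel (isKernel_lam D.P) (D.force i u)

/-- The third component of the fixed point map. -/
def stepH (u : State μ) : CoefSpace μ :=
  (-(1 / 2) : ℝ) • (D.P.mul u.2.2 u.2.2 + D.eps ^ 2 • D.lorentzTerm u)

/-- The fixed point map. -/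
def step (u : State μ) : State μ := (D.stepRho u, fun i => D.stepXi i u, D.stepH u)

end Maps

/-! ### Contraction estimates for the fixed point map -/

/-- The domain of the fixed point map. -/
def dom (μ : Measure M) (R : ℝ) : Set (State μ) :=
  {u | ‖u.1‖ ≤ R ∧ (∀ i, ‖u.2.1 i‖ ≤ R) ∧ ‖u.2.2‖ ≤ 1 / 4}

/-- Bounded Lipschitz maps on `dom μ R`, with bounds by a power of `Q`. -/
structure Tame (R Q : ℝ) (n : ℕ) (f : State μ → CoefSpace μ) : Prop where
  bound : ∀ u ∈ dom μ R, ‖f u‖ ≤ Q ^ n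
  lip : ∀ u ∈ dom μ R, ∀ v ∈ dom μ R, ‖f u - f v‖ ≤ Q ^ n * ‖u - v‖

section Tame

variable {R Q : ℝ} {m n : ℕ} {f g : State μ → CoefSpace μ}

/-- As Q ≥ 8, one extra power of Q absorbs every numerical constant below: the 2 of a sum or a
product rule, the norm 7 of a derivative multiplier. Only exponents have to be tracked. -/
lemma Tame.mono (hQ : 8 ≤ Q) (hf : Tame R Q m f) (hmn : m ≤ n) : Tame R Q n f := by
  have h : Q ^ m ≤ Q ^ n := pow_le_pow_right₀ (by linarith) hmn
  exact ⟨fun u hu => (hf.bound u hu).trans h, fun u hu v hv =>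
    (hf.lip u hu v hv).trans (mul_le_mul_of_nonneg_right h (norm_nonneg _))⟩

lemma Tame.add (hQ : 8 ≤ Q) (hf : Tame R Q n f) (hg : Tame R Q n g) :
    Tame R Q (n + 1) fun u => f u + g u := by
  have hp : 0 < Q ^ n := by positivity
  have h2 : 2 * Q ^ n ≤ Q ^ (n + 1) := by rw [pow_succ]; nlinarith
  refine ⟨fun u hu => ?_, fun u hu v hv => ?_⟩
  · exact (norm_add_le _ _).trans (by linarith [hf.bound u hu, hg.bound u hu])
  · rw [add_sub_add_comm]
    refine (norm_add_le _ _).trans ?_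
    have := mul_le_mul_of_nonneg_right h2 (norm_nonneg (u - v))
    linarith [hf.lip u hu v hv, hg.lip u hu v hv]

lemma Tame.neg (hf : Tame R Q n f) : Tame R Q n fun u => -f u := by
  refine ⟨fun u hu => by simpa using hf.bound u hu, fun u hu v hv => ?_⟩
  rw [neg_sub_neg, norm_sub_rev]
  exact hf.lip u hu v hv

lemma Tame.sub (hQ : 8 ≤ Q) (hf : Tame R Q n f) (hg : Tame R Q n g) :
    Tame R Q (n + 1) fun u => f u - g u := by
  simpa only [sub_eq_add_neg] using hf.add hQ hg.neg

lemma Tame.sum {F : Fin 3 → State μ → CoefSpace μ} (hQ : 8 ≤ Q) (hF : ∀ i, Tame R Q n (F i)) :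
    Tame R Q (n + 2) fun u => ∑ i, F i u := by
  simp only [Fin.sum_univ_three]
  exact ((hF 0).add hQ (hF 1)).add hQ ((hF 2).mono hQ (Nat.le_succ n))

lemma Tame.op (hQ : 8 ≤ Q) (hf : Tame R Q n f) {L : CoefSpace μ →L[ℝ] CoefSpace μ}
    (hL : ∀ U, ‖L U‖ ≤ Q * ‖U‖) : Tame R Q (n + 1) fun u => L (f u) := by
  have hQ0 : 0 ≤ Q := by linarith
  refine ⟨fun u hu => ?_, fun u hu v hv => ?_⟩
  · rw [pow_succ, mul_comm]
    exact (hL _).trans (mul_le_mul_of_nonneg_left (hf.bound u hu) hQ0)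
  · rw [← map_sub, pow_succ, mul_comm (Q ^ n), mul_assoc]
    exact (hL _).trans (mul_le_mul_of_nonneg_left (hf.lip u hu v hv) hQ0)

lemma Tame.smul (hQ : 8 ≤ Q) (hf : Tame R Q n f) {c : ℝ} (hc : |c| ≤ 2) :
    Tame R Q (n + 1) fun u => c • f u :=
  hf.op hQ (L := c • ContinuousLinearMap.id ℝ _) fun U => by
    simp only [smul_apply, ContinuousLinearMap.id_apply, norm_smul,
      Real.norm_eq_abs]
    exact mul_le_mul_of_nonneg_right (by linarith) (norm_nonneg _)

lemma norm_mul_sub_mul_le (P : WeightPar) (U U' V V' : CoefSpace μ) :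
    ‖P.mul U V - P.mul U' V'‖ ≤ ‖U - U'‖ * ‖V‖ + ‖U'‖ * ‖V - V'‖ := by
  have : P.mul U V - P.mul U' V' = P.mul (U - U') V + P.mul U' (V - V') := by
    simp only [map_sub, sub_apply]; abel
  rw [this]
  exact (norm_add_le _ _).trans (add_le_add (P.norm_mul_le _ _) (P.norm_mul_le _ _))

/-- The product rule for differences yields two equal terms, paid for by the extra power of Q. -/
lemma Tame.mul (P : WeightPar) (hQ : 8 ≤ Q) (hf : Tame R Q m f) (hg : Tame R Q n g) :
    Tame R Q (m + n + 1) fun u => P.mul (f u) (g u) := by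
  have hQm : 0 < Q ^ m := by positivity
  have hQn : 0 < Q ^ n := by positivity
  refine ⟨fun u hu => ?_, fun u hu v hv => ?_⟩
  · calc _ ≤ ‖f u‖ * ‖g u‖ := P.norm_mul_le _ _
      _ ≤ Q ^ m * Q ^ n := mul_le_mul (hf.bound u hu) (hg.bound u hu) (norm_nonneg _) hQm.le
      _ ≤ _ := by
        rw [← pow_add]
        exact pow_le_pow_right₀ (by linarith) (Nat.le_succ _)
  · calc _ ≤ ‖f u - f v‖ * ‖g u‖ + ‖f v‖ * ‖g u - g v‖ := norm_mul_sub_mul_le P _ _ _ _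
      _ ≤ (Q ^ m * ‖u - v‖) * Q ^ n + Q ^ m * (Q ^ n * ‖u - v‖) :=
        add_le_add (mul_le_mul (hf.lip u hu v hv) (hg.bound u hu) (norm_nonneg _) (by positivity))
          (mul_le_mul (hf.bound v hv) (hg.lip u hu v hv) (norm_nonneg _) hQm.le)
      _ = 2 * (Q ^ (m + n) * ‖u - v‖) := by rw [pow_add]; ring
      _ ≤ Q * (Q ^ (m + n) * ‖u - v‖) := by gcongr; linarith
      _ = _ := by ring

lemma Tame.const (hQ : 8 ≤ Q) {U : CoefSpace μ} (hU : ‖U‖ ≤ Q) : Tame R Q 1 fun _ => U :=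
  ⟨fun _ _ => by simpa using hU, fun u _ v _ => by
    simp only [sub_self, norm_zero, pow_one]; positivity⟩

lemma tame_fst (hQ : 8 ≤ Q) (hR : R ≤ Q) : Tame R Q 1 fun u : State μ => u.1 := by
  refine ⟨fun u hu => by simpa using hu.1.trans hR, fun u _ v _ => ?_⟩
  rw [pow_one]
  exact (norm_fst_le (u - v)).trans (le_mul_of_one_le_left (norm_nonneg _) (by linarith))

lemma tame_xi (hQ : 8 ≤ Q) (hR : R ≤ Q) (i : Fin 3) :
    Tame R Q 1 fun u : State μ => u.2.1 i := by
  refine ⟨fun u hu => by simpa using (hu.2.1 i).trans hR, fun u _ v _ => ?_⟩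
  rw [pow_one]
  exact ((norm_le_pi_norm (u - v).2.1 i).trans ((norm_fst_le _).trans (norm_snd_le _))).trans
    (le_mul_of_one_le_left (norm_nonneg _) (by linarith))

lemma tame_snd (hQ : 8 ≤ Q) : Tame R Q 1 fun u : State μ => u.2.2 := by
  refine ⟨fun u hu => by rw [pow_one]; exact hu.2.2.trans (by linarith), fun u _ v _ => ?_⟩
  rw [pow_one]
  exact ((norm_snd_le _).trans (norm_snd_le (u - v))).trans
    (le_mul_of_one_le_left (norm_nonneg _) (by linarith))

/-- The smallness assumptions under which the fixed point map is a contraction. -/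
structure Small (D : Sys μ) (R Q : ℝ) : Prop where
  le_Q : 8 ≤ Q
  R_le : R ≤ Q
  R_nonneg : 0 ≤ R
  rin_le : ‖D.rin‖ + 1 ≤ R
  xin_le : ∀ i, ‖D.xin i‖ + 1 ≤ R
  bin_le : ∀ i, ‖D.eps • D.bin i‖ ≤ R
  -- The largest exponent that is integrated in time is 24, for `force`; the spare powers pay for
  -- the kernel norms and for the factor 1/64.
  gain_le : D.P.gain * Q ^ 30 ≤ 1
  eps_small : D.eps ^ 2 * Q ^ 30 ≤ 1

variable [IsProbabilityMeasure μ] {D : Sys μ}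

lemma Small.gain_le_one (h : Small D R Q) : D.P.gain ≤ 1 := by
  have h1 := h.gain_le
  have h2 : 1 ≤ Q ^ 30 := one_le_pow₀ (by linarith [h.le_Q])
  nlinarith [D.P.gain_nonneg]

lemma tame_velo_xi (h : Small D R Q) (i : Fin 3) : Tame R Q 2 (D.xi i) :=
  (tame_xi h.le_Q h.R_le i).op h.le_Q fun U => (D.P.norm_multiplier_apply_le _ U).trans
    (mul_le_mul_of_nonneg_right (by linarith [h.le_Q]) (norm_nonneg _))

lemma tame_dxi (h : Small D R Q) (i j : Fin 3) : Tame R Q 2 (D.dxi i j) :=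
  (tame_xi h.le_Q h.R_le i).op h.le_Q fun U => (D.P.norm_multiplier_apply_le _ U).trans
    (mul_le_mul_of_nonneg_right (by linarith [h.le_Q]) (norm_nonneg _))

lemma tame_velo (h : Small D R Q) (i : Fin 3) : Tame R Q 5 (D.velo i) :=
  ((tame_velo_xi h i).mono h.le_Q (by norm_num)).add h.le_Q
    ((tame_velo_xi h i).mul D.P h.le_Q (tame_snd h.le_Q))

lemma tame_flux (h : Small D R Q) (j : Fin 3) : Tame R Q 7 (D.flux j) :=
  (tame_velo h j).mul D.P h.le_Q (tame_fst h.le_Q h.R_le)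

lemma tame_cur (h : Small D R Q) (j : Fin 3) : Tame R Q 8 (D.cur j) :=
  (tame_flux h j).op h.le_Q fun U => (D.P.norm_average_apply_le U).trans
    (le_mul_of_one_le_left (norm_nonneg _) (by linarith [h.le_Q]))

lemma tame_pcur (h : Small D R Q) (i : Fin 3) : Tame R Q 11 (D.pcur i) :=
  Tame.sum h.le_Q fun j => (tame_cur h j).op h.le_Q fun U =>
    (D.P.norm_multiplier_apply_le _ U).trans
      (mul_le_mul_of_nonneg_right (by linarith [h.le_Q]) (norm_nonneg _))

lemma tame_gradPhi (h : Small D R Q) (i : Fin 3) : Tame R Q 3 (D.gradPhi i) :=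
  ((tame_fst h.le_Q h.R_le).op h.le_Q fun U => (D.P.norm_average_apply_le U).trans
    (le_mul_of_one_le_left (norm_nonneg _) (by linarith [h.le_Q]))).op h.le_Q fun U =>
      (D.P.norm_multiplier_apply_le _ U).trans
        (mul_le_mul_of_nonneg_right (by linarith [h.le_Q]) (norm_nonneg _))

lemma tame_curlDuh (h : Small D R Q) (i : Fin 3) : Tame R Q 14 (D.curlDuh i) :=
  Tame.sum h.le_Q fun l => (tame_pcur h l).op h.le_Q fun U =>
    (norm_duhamel_apply_le _ U).trans
      (mul_le_mul_of_nonneg_right (by linarith [h.le_Q, h.gain_le_one]) (norm_nonneg _))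

/-- Only ε times the magnetic field is bounded uniformly in ε, because its free part has the size of
the initial fields. This is the combination that occurs in the force. -/
lemma tame_mag (h : Small D R Q) (i : Fin 3) : Tame R Q 16 fun u => D.eps • D.mag i u := by
  simp only [mag, smul_add]
  refine ((Tame.const h.le_Q ((h.bin_le i).trans h.R_le)).mono h.le_Q (by norm_num)).add h.le_Q
    ((tame_curlDuh h i).smul h.le_Q ?_)
  rw [abs_of_pos D.eps_pos]
  linarith [D.eps_le]

lemma tame_magForce (h : Small D R Q) (i : Fin 3) : Tame R Q 23 (D.magForce i) :=
  ((tame_velo h _).mul D.P h.le_Q (tame_mag h _)).sub h.le_Q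
    ((tame_velo h _).mul D.P h.le_Q (tame_mag h _))

lemma tame_force (h : Small D R Q) (i : Fin 3) : Tame R Q 24 (D.force i) := by
  have h1 : Tame R Q 10 fun u => ∑ j, D.P.mul (D.velo j u) (D.dxi i j u) :=
    Tame.sum h.le_Q fun j => (tame_velo h j).mul D.P h.le_Q (tame_dxi h i j)
  exact ((h1.add h.le_Q ((tame_gradPhi h i).mono h.le_Q (by norm_num))).mono h.le_Q
    (by norm_num)).sub h.le_Q (tame_magForce h i)

lemma tame_lorentzTerm (h : Small D R Q) : Tame R Q 14 D.lorentzTerm := by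
  have h1 : Tame R Q 7 D.xiSq := Tame.sum h.le_Q fun i =>
    (tame_velo_xi h i).mul D.P h.le_Q (tame_velo_xi h i)
  have h2 : Tame R Q 10 fun u => (2 : ℝ) • D.P.mul (D.xiSq u) u.2.2 :=
    (h1.mul D.P h.le_Q (tame_snd h.le_Q)).smul h.le_Q (by norm_num)
  have h3 : Tame R Q 11 fun u => D.P.mul (D.xiSq u) (D.P.mul u.2.2 u.2.2) :=
    h1.mul D.P h.le_Q ((tame_snd h.le_Q).mul D.P h.le_Q (tame_snd h.le_Q))
  exact (((h1.mono h.le_Q (by norm_num)).add h.le_Q h2).add h.le_Q h3).mono h.le_Q (by norm_num)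

/-- The two unused powers give Q² ≥ 64. -/
lemma Small.mul_pow_le (h : Small D R Q) {x : ℝ} (hx : 0 ≤ x) (hxQ : x * Q ^ 30 ≤ 1) {n : ℕ} (hn : n ≤ 28) :
    x * Q ^ n ≤ 1 / 64 := by
  have hQ := h.le_Q
  have h1 : Q ^ n ≤ Q ^ 28 := pow_le_pow_right₀ (by linarith) hn
  have h2 : x * Q ^ n ≤ x * Q ^ 28 := mul_le_mul_of_nonneg_left h1 hx
  have h3 : 0 ≤ x * Q ^ 28 := by positivity
  have h4 : x * Q ^ 30 = x * Q ^ 28 * Q ^ 2 := by ring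
  have h5 : 64 ≤ Q ^ 2 := by nlinarith
  have h6 : x * Q ^ 28 * 64 ≤ x * Q ^ 28 * Q ^ 2 := mul_le_mul_of_nonneg_left h5 h3
  linarith

lemma Tame.duhamel_small {H : ℝ} {p : Freq → ℝ → ℂ} (h : Small D R Q) (hp : D.P.IsKernel H p)
    (hH : H ≤ 8) (hf : Tame R Q n f) (hn : n ≤ 26) {u v : State μ} (hu : u ∈ dom μ R)
    (hv : v ∈ dom μ R) :
    ‖duhamel hp (f u)‖ ≤ 1 / 64 ∧ ‖duhamel hp (f u) - duhamel hp (f v)‖ ≤ 1 / 64 * ‖u - v‖ := by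
  have hg := D.P.gain_nonneg
  have hQ := h.le_Q
  have hQn : 0 < Q ^ n := by positivity
  have hs : H * D.P.gain * Q ^ n ≤ 1 / 64 := by
    refine le_trans ?_ (h.mul_pow_le hg h.gain_le (n := n + 1) (by omega))
    rw [pow_succ]
    have : H * (D.P.gain * Q ^ n) ≤ Q * (D.P.gain * Q ^ n) := by gcongr; linarith
    linarith
  have hHg : 0 ≤ H * D.P.gain := mul_nonneg hp.nonneg hg
  constructor
  · exact (norm_duhamel_apply_le hp _).trans
      ((mul_le_mul_of_nonneg_left (hf.bound u hu) hHg).trans hs)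
  · rw [← map_sub]
    refine (norm_duhamel_apply_le hp _).trans
      ((mul_le_mul_of_nonneg_left (hf.lip u hu v hv) hHg).trans ?_)
    rw [← mul_assoc]
    exact mul_le_mul_of_nonneg_right hs (norm_nonneg _)

/-- Three fluxes at 1/64 each fit both in the margin 1 between the norm of the data and R and in the
Lipschitz constant 1/2. -/
lemma stepRho_bounds (h : Small D R Q) {u v : State μ} (hu : u ∈ dom μ R) (hv : v ∈ dom μ R) :
    ‖D.stepRho u‖ ≤ R ∧ ‖D.stepRho u - D.stepRho v‖ ≤ 1 / 2 * ‖u - v‖ := by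
  have hj := fun j => (tame_flux h j).duhamel_small h (isKernel_dsym D.P j) (by norm_num)
    (by norm_num) hu hv
  constructor
  · refine (norm_sub_le _ _).trans ((add_le_add_right (norm_sum_le _ _) _).trans ?_)
    rw [Fin.sum_univ_three]
    linarith [(hj 0).1, (hj 1).1, (hj 2).1, h.rin_le]
  · have : D.stepRho u - D.stepRho v = -∑ j, (duhamel (isKernel_dsym D.P j) (D.flux j u)
        - duhamel (isKernel_dsym D.P j) (D.flux j v)) := by
      rw [stepRho, stepRho, Finset.sum_sub_distrib]; abel
    rw [this, norm_neg]
    refine (norm_sum_le _ _).trans ?_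
    rw [Fin.sum_univ_three]
    linarith [(hj 0).2, (hj 1).2, (hj 2).2, norm_nonneg (u - v)]

lemma stepXi_bounds (h : Small D R Q) {u v : State μ} (hu : u ∈ dom μ R) (hv : v ∈ dom μ R) (i : Fin 3) :
    ‖D.stepXi i u‖ ≤ R ∧ ‖D.stepXi i u - D.stepXi i v‖ ≤ 1 / 2 * ‖u - v‖ := by
  have h1 := (tame_pcur h i).duhamel_small h (isKernel_wave D.P D.eps_pos D.eps_le D.T_le)
    (by norm_num) (by norm_num) hu hv
  have h2 := (tame_force h i).duhamel_small h (isKernel_lam D.P) (by norm_num) (by norm_num) hu hv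
  constructor
  · refine (norm_sub_le _ _).trans ((add_le_add_left (norm_sub_le _ _) _).trans ?_)
    linarith [h1.1, h2.1, h.xin_le i]
  · have : D.stepXi i u - D.stepXi i v =
        -(duhamel (isKernel_wave D.P D.eps_pos D.eps_le D.T_le) (D.pcur i u)
          - duhamel (isKernel_wave D.P D.eps_pos D.eps_le D.T_le) (D.pcur i v))
        - (duhamel (isKernel_lam D.P) (D.force i u) - duhamel (isKernel_lam D.P) (D.force i v)) := by
      rw [stepXi, stepXi]; abel
    rw [this]
    refine (norm_sub_le _ _).trans ?_
    rw [norm_neg]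
    linarith [h1.2, h2.2, norm_nonneg (u - v)]

/-- There is no time integral here. The quadratic term -h²/2 has Lipschitz constant at most 1/4 on
the ball of radius 1/4, and the rest is small through ε². -/
lemma stepH_bounds (h : Small D R Q) {u v : State μ} (hu : u ∈ dom μ R) (hv : v ∈ dom μ R) :
    ‖D.stepH u‖ ≤ 1 / 4 ∧ ‖D.stepH u - D.stepH v‖ ≤ 1 / 2 * ‖u - v‖ := by
  have hs := h.mul_pow_le (sq_nonneg D.eps) h.eps_small (n := 14) (by norm_num)
  have hl := tame_lorentzTerm h
  have hn : ‖(-(1 / 2) : ℝ)‖ = 1 / 2 := by norm_num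
  have hu2 := hu.2.2
  have hv2 := hv.2.2
  constructor
  · rw [stepH, norm_smul, hn]
    have h1 := D.P.norm_mul_le u.2.2 u.2.2
    have h2 : ‖D.eps ^ 2 • D.lorentzTerm u‖ ≤ 1 / 64 := by
      rw [norm_smul, Real.norm_of_nonneg (sq_nonneg _)]
      exact (mul_le_mul_of_nonneg_left (hl.bound u hu) (sq_nonneg _)).trans hs
    have h3 := norm_add_le (D.P.mul u.2.2 u.2.2) (D.eps ^ 2 • D.lorentzTerm u)
    nlinarith [norm_nonneg u.2.2]
  · have e : D.stepH u - D.stepH v = (-(1 / 2) : ℝ) • ((D.P.mul u.2.2 u.2.2 - D.P.mul v.2.2 v.2.2)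
        + D.eps ^ 2 • (D.lorentzTerm u - D.lorentzTerm v)) := by
      rw [stepH, stepH, ← smul_sub, add_sub_add_comm, ← smul_sub]
    rw [e, norm_smul, hn]
    have h1 := norm_mul_sub_mul_le D.P u.2.2 v.2.2 u.2.2 v.2.2
    have h2 : ‖D.eps ^ 2 • (D.lorentzTerm u - D.lorentzTerm v)‖ ≤ 1 / 64 * ‖u - v‖ := by
      rw [norm_smul, Real.norm_of_nonneg (sq_nonneg _)]
      refine (mul_le_mul_of_nonneg_left (hl.lip u hu v hv) (sq_nonneg _)).trans ?_
      rw [← mul_assoc]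
      exact mul_le_mul_of_nonneg_right hs (norm_nonneg _)
    have h3 := norm_add_le (D.P.mul u.2.2 u.2.2 - D.P.mul v.2.2 v.2.2)
      (D.eps ^ 2 • (D.lorentzTerm u - D.lorentzTerm v))
    have h4 : ‖u.2.2 - v.2.2‖ ≤ ‖u - v‖ := (norm_snd_le _).trans (norm_snd_le (u - v))
    nlinarith [norm_nonneg (u.2.2 - v.2.2), norm_nonneg u.2.2, norm_nonneg v.2.2]

lemma exists_fixedPoint (h : Small D R Q) : ∃ u ∈ dom μ R, D.step u = u := by
  have hclosed : IsClosed (dom μ R) := by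
    have : dom μ R = {u | ‖u.1‖ ≤ R} ∩ ((⋂ i, {u | ‖u.2.1 i‖ ≤ R}) ∩ {u | ‖u.2.2‖ ≤ 1 / 4}) := by
      ext u; simp [dom]
    rw [this]
    refine (isClosed_le (by fun_prop) continuous_const).inter
      ((isClosed_iInter fun i => isClosed_le (by fun_prop) continuous_const).inter
        (isClosed_le (by fun_prop) continuous_const))
  have hmaps : MapsTo D.step (dom μ R) (dom μ R) := fun u hu =>
    ⟨(stepRho_bounds h hu hu).1, fun i => (stepXi_bounds h hu hu i).1, (stepH_bounds h hu hu).1⟩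
  have hcontr : ContractingWith (1 / 2) (hmaps.restrict D.step (dom μ R) (dom μ R)) := by
    refine ⟨by norm_num, LipschitzWith.of_dist_le_mul fun u v => ?_⟩
    have e : ((1 / 2 : NNReal) : ℝ) = 1 / 2 := by norm_num
    rw [Subtype.dist_eq, Subtype.dist_eq, dist_eq_norm, dist_eq_norm, e]
    have hn : 0 ≤ 1 / 2 * ‖u.1 - v.1‖ := by positivity
    -- The norm of the product space is a maximum, so it suffices to treat the components
    -- separately.
    refine (norm_prod_le_iff).2 ⟨(stepRho_bounds h u.2 v.2).2, (norm_prod_le_iff).2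
      ⟨(pi_norm_le_iff_of_nonneg hn).2 fun i => (stepXi_bounds h u.2 v.2 i).2,
        (stepH_bounds h u.2 v.2).2⟩⟩
  have h0 : (0 : State μ) ∈ dom μ R := ⟨by simpa using h.R_nonneg, fun i => by
    simpa using h.R_nonneg, by simp⟩
  obtain ⟨u, hu, hfix, -⟩ := hcontr.exists_fixedPoint' hclosed.isComplete hmaps h0 (edist_ne_top _ _)
  exact ⟨u, hu, hfix⟩

end Tame

end Sys

namespace WeightPar

variable (P : WeightPar) {M : Type*} [MeasurableSpace M] {μ : Measure M}

/-! ### From coefficients to functions -/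

/-- The function whose Fourier coefficients are given by an element of the space. -/
def fn (U : CoefSpace μ) (t : ℝ) (θ : M) : T3 → ℝ := syn fun k => P.coef U k t θ

lemma fn_add (U V : CoefSpace μ) (t : ℝ) (θ : M) (x : T3) :
    P.fn (U + V) t θ x = P.fn U t θ x + P.fn V t θ x := by
  simp only [fn, coef_add]
  exact syn_add (P.summable_coef U t θ) (P.summable_coef V t θ) x

lemma fn_sub (U V : CoefSpace μ) (t : ℝ) (θ : M) (x : T3) :
    P.fn (U - V) t θ x = P.fn U t θ x - P.fn V t θ x := by
  simp only [fn, coef_sub]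
  exact syn_sub (P.summable_coef U t θ) (P.summable_coef V t θ) x

lemma fn_neg (U : CoefSpace μ) (t : ℝ) (θ : M) (x : T3) :
    P.fn (-U) t θ x = -P.fn U t θ x := by
  simp only [fn, coef_neg]
  exact syn_neg _ x

lemma fn_smul (c : ℝ) (U : CoefSpace μ) (t : ℝ) (θ : M) (x : T3) :
    P.fn (c • U) t θ x = c * P.fn U t θ x := by
  simp only [fn, coef_smul]
  exact syn_const_mul _ _ x

lemma fn_sum {ι : Type*} (s : Finset ι) (U : ι → CoefSpace μ) (t : ℝ) (θ : M) (x : T3) :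
    P.fn (∑ i ∈ s, U i) t θ x = ∑ i ∈ s, P.fn (U i) t θ x := by
  simp only [fn, coef_sum]
  exact syn_sum s (fun i _ => P.summable_coef (U i) t θ) x

lemma fn_mul (U V : CoefSpace μ) (t : ℝ) (θ : M) (x : T3) :
    P.fn (P.mul U V) t θ x = P.fn U t θ x * P.fn V t θ x := by
  simp only [fn, coef_mul]
  exact syn_conv (P.summable_coef U t θ) (P.summable_coef V t θ) ((P.isCoef_coef U).herm t θ)
    ((P.isCoef_coef V).herm t θ) x

/-- Polynomial factors are harmless. -/
lemma exists_summable_bound (U : CoefSpace μ) (n : ℕ) : ∃ w : Freq → ℝ, Summable w ∧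
    ∀ k t θ, (1 + freqNorm k) ^ n * ‖P.coef U k t θ‖ ≤ w k := by
  obtain ⟨K, hK, hb⟩ := exists_pow_mul_exp_le n P.b_pos
  refine ⟨fun k => ‖U‖ * K * wt k, summable_wt.mul_left _, fun k t θ => ?_⟩
  have h0 := freqNorm_nonneg k
  have hw := wt_pos k
  calc _ ≤ (1 + freqNorm k) ^ n * (‖U‖ * (wt k * Real.exp (-P.b * freqNorm k))) := by
        gcongr
        exact (P.norm_coef_le U k t θ).trans (by gcongr; exact P.om_le k t)
    _ = ‖U‖ * wt k * ((1 + freqNorm k) ^ n * Real.exp (-P.b * freqNorm k)) := by ring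
    _ ≤ ‖U‖ * wt k * K := by gcongr; exact hb k
    _ = _ := by ring

lemma norm_dsym_le_seven (i : Fin 3) (k : Freq) : ‖dsym i k‖ ≤ 7 * (1 + freqNorm k) := by
  have h0 := freqNorm_nonneg k
  have := norm_dsym_le i k
  nlinarith [Real.pi_lt_d2]

lemma summable_dsym_coef (U : CoefSpace μ) (t : ℝ) (θ : M) (i : Fin 3) :
    Summable fun k => ‖dsym i k * P.coef U k t θ‖ := by
  obtain ⟨w, hw, hb⟩ := P.exists_summable_bound U 1
  refine (hw.mul_left 7).of_nonneg_of_le (fun _ => norm_nonneg _) fun k => ?_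
  rw [norm_mul]
  have h1 := mul_le_mul_of_nonneg_right (norm_dsym_le_seven i k) (norm_nonneg (P.coef U k t θ))
  have h2 := hb k t θ
  rw [pow_one] at h2
  linarith

lemma summable_dsym_dsym_coef (U : CoefSpace μ) (t : ℝ) (θ : M) (i j : Fin 3) :
    Summable fun k => ‖dsym j k * (dsym i k * P.coef U k t θ)‖ := by
  obtain ⟨w, hw, hb⟩ := P.exists_summable_bound U 2
  refine (hw.mul_left 49).of_nonneg_of_le (fun _ => norm_nonneg _) fun k => ?_
  rw [norm_mul, norm_mul, ← mul_assoc]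
  have h1 : ‖dsym j k‖ * ‖dsym i k‖ ≤ (7 * (1 + freqNorm k)) * (7 * (1 + freqNorm k)) :=
    mul_le_mul (norm_dsym_le_seven j k) (norm_dsym_le_seven i k) (norm_nonneg _)
      ((norm_nonneg _).trans (norm_dsym_le_seven j k))
  have h2 := mul_le_mul_of_nonneg_right h1 (norm_nonneg (P.coef U k t θ))
  linarith [hb k t θ]

lemma pderiv_fn (U : CoefSpace μ) (t : ℝ) (θ : M) (i : Fin 3) :
    pderiv i (P.fn U t θ) = syn fun k => dsym i k * P.coef U k t θ :=
  funext fun x => pderiv_syn (P.summable_coef U t θ) (P.summable_dsym_coef U t θ) i x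

lemma laplacian_fn (U : CoefSpace μ) (t : ℝ) (θ : M) (x : T3) :
    laplacian (P.fn U t θ) x = ∑ i, syn (fun k => dsym i k * (dsym i k * P.coef U k t θ)) x := by
  refine Finset.sum_congr rfl fun i _ => ?_
  rw [pderiv_fn]
  exact pderiv_syn (P.summable_dsym_coef U t θ i) (fun j => P.summable_dsym_dsym_coef U t θ i j) i x

/-- δ^|k| = exp(|k| log δ) is absorbed by the width of the strip, which never falls below b ≥ log δ;
the summable weight `wt` remains and turns the supremum norm into the ℓ¹ norm of B_δ. -/
lemma om_mul_rpow_le {δ : ℝ} (hδ : 1 < δ) (hb : Real.log δ ≤ P.b) (k : Freq) (t : ℝ) :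
    P.om k t * δ ^ freqNorm k ≤ wt k := by
  have h0 := freqNorm_nonneg k
  have hw := wt_pos k
  rw [Real.rpow_def_of_pos (by linarith)]
  calc _ ≤ wt k * Real.exp (-P.b * freqNorm k) * Real.exp (P.b * freqNorm k) := by
        have := P.om_pos k t
        gcongr
        exact P.om_le k t
    _ = wt k := by
        rw [mul_assoc, ← Real.exp_add]
        simp

lemma norm_coef_mul_rpow_le {δ : ℝ} (hδ : 1 < δ) (hb : Real.log δ ≤ P.b) (U : CoefSpace μ)
    (k : Freq) (t : ℝ) (θ : M) : ‖P.coef U k t θ‖ * δ ^ freqNorm k ≤ ‖U‖ * wt k := by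
  have h1 := rpow_freqNorm_pos (by linarith : 0 < δ) k
  calc _ ≤ ‖U‖ * P.om k t * δ ^ freqNorm k := by gcongr; exact P.norm_coef_le U k t θ
    _ = ‖U‖ * (P.om k t * δ ^ freqNorm k) := by ring
    _ ≤ _ := by gcongr; exact P.om_mul_rpow_le hδ hb k t

lemma summable_coef_mul_rpow {δ : ℝ} (hδ : 1 < δ) (hb : Real.log δ ≤ P.b) (U : CoefSpace μ)
    (t : ℝ) (θ : M) : Summable fun k => ‖P.coef U k t θ‖ * δ ^ freqNorm k :=
  (summable_wt.mul_left ‖U‖).of_nonneg_of_le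
    (fun k => mul_nonneg (norm_nonneg _) (rpow_freqNorm_pos (by linarith) k).le)
    fun k => P.norm_coef_mul_rpow_le hδ hb U k t θ

lemma memB_fn {δ : ℝ} (hδ : 1 < δ) (hb : Real.log δ ≤ P.b) (U : CoefSpace μ) (t : ℝ) (θ : M) :
    MemB δ (P.fn U t θ) :=
  memB_syn hδ.le ((P.isCoef_coef U).herm t θ) (P.summable_coef_mul_rpow hδ hb U t θ)

lemma bNorm_fn_le {δ : ℝ} (hδ : 1 < δ) (hb : Real.log δ ≤ P.b) (U : CoefSpace μ) (t : ℝ) (θ : M) :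
    bNorm δ (P.fn U t θ) ≤ ‖U‖ := by
  rw [fn, bNorm_syn δ ((P.isCoef_coef U).herm t θ) (P.summable_coef U t θ)]
  refine ((P.summable_coef_mul_rpow hδ hb U t θ).tsum_le_tsum
    (fun k => P.norm_coef_mul_rpow_le hδ hb U k t θ) (summable_wt.mul_left _)).trans ?_
  rw [tsum_mul_left]
  exact mul_le_of_le_one_right (norm_nonneg _) (tsum_wt_le.trans (by norm_num))

lemma abs_fn_le (U : CoefSpace μ) (t : ℝ) (θ : M) (x : T3) : |P.fn U t θ x| ≤ ‖U‖ := by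
  refine (abs_syn_le (P.summable_coef U t θ) x).trans ?_
  refine ((P.summable_coef U t θ).tsum_le_tsum (fun k => (P.norm_coef_le U k t θ).trans
    (mul_le_mul_of_nonneg_left (P.om_le_wt k t) (norm_nonneg _))) (summable_wt.mul_left _)).trans ?_
  rw [tsum_mul_left]
  exact mul_le_of_le_one_right (norm_nonneg _) (tsum_wt_le.trans (by norm_num))

/-- Each coefficient is continuous in time, and the summable majorant is independent of time:
dominated convergence over the frequencies. -/
lemma contInB_fn {δ : ℝ} (hδ : 1 < δ) (hb : Real.log δ ≤ P.b) (U : CoefSpace μ) (θ : M) (T : ℝ) :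
    ContInB T δ fun t => P.fn U t θ := by
  intro t _
  refine ⟨P.memB_fn hδ hb U t θ, ?_⟩
  have e : ∀ s, bNorm δ (fun x => P.fn U s θ x - P.fn U t θ x) =
      ∑' k, ‖P.coef U k s θ - P.coef U k t θ‖ * δ ^ freqNorm k := by
    intro s
    have h1 : (fun x => P.fn U s θ x - P.fn U t θ x) =
        syn fun k => P.coef U k s θ - P.coef U k t θ :=
      funext fun x => (syn_sub (P.summable_coef U s θ) (P.summable_coef U t θ) x).symm
    have h2 : Herm fun k => P.coef U k s θ - P.coef U k t θ := fun k => by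
      have h3 := (P.isCoef_coef U).herm s θ k
      have h4 := (P.isCoef_coef U).herm t θ k
      simp only at h3 h4
      change P.coef U (-k) s θ - P.coef U (-k) t θ = conj (P.coef U k s θ - P.coef U k t θ)
      rw [h3, h4, map_sub]
    rw [h1, bNorm_syn δ h2]
    exact ((P.summable_coef U s θ).add (P.summable_coef U t θ)).of_nonneg_of_le
      (fun _ => norm_nonneg _) fun k => norm_sub_le _ _
  simp only [e]
  have h0 : ∑' k : Freq, (0 : ℝ) = 0 := tsum_zero
  rw [← h0]
  refine tendsto_tsum_of_dominated_convergence (bound := fun k => 2 * (‖U‖ * wt k))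
    ((summable_wt.mul_left _).mul_left _) (fun k => ?_) (Eventually.of_forall fun s k => ?_)
  · have hc : Continuous fun s => ‖P.coef U k s θ - P.coef U k t θ‖ * δ ^ freqNorm k :=
      (((P.isCoef_coef U).cont k θ).sub continuous_const).norm.mul continuous_const
    have := hc.tendsto t
    simp only [sub_self, norm_zero, zero_mul] at this
    exact this.mono_left nhdsWithin_le_nhds
  · have hp := rpow_freqNorm_pos (by linarith : 0 < δ) k
    rw [norm_mul, norm_norm, Real.norm_of_nonneg hp.le]
    calc _ ≤ (‖P.coef U k s θ‖ + ‖P.coef U k t θ‖) * δ ^ freqNorm k := by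
          gcongr; exact norm_sub_le _ _
      _ ≤ _ := by
          linarith [P.norm_coef_mul_rpow_le hδ hb U k s θ, P.norm_coef_mul_rpow_le hδ hb U k t θ]

section Average

variable [IsProbabilityMeasure μ]

lemma integrable_fn (U : CoefSpace μ) (t : ℝ) (x : T3) : Integrable (fun θ => P.fn U t θ x) μ := by
  refine Integrable.of_bound ?_ ‖U‖ (Eventually.of_forall fun θ => P.abs_fn_le U t θ x)
  exact Complex.continuous_re.comp_aestronglyMeasurable (aestronglyMeasurable_tsum
    (fun k => ((P.isCoef_coef U).meas k t).mul_const _)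
    fun θ => summable_mul_mFourier (P.summable_coef U t θ) x)

/-- Exchange of the Fourier series with the integral over θ, which identifies `average` with the
actual integrals in the density and the current. -/
lemma fn_average (U : CoefSpace μ) (t : ℝ) (θ : M) (x : T3) :
    P.fn (P.average U) t θ x = ∫ θ', P.fn U t θ' x ∂μ := by
  have h1 : ∀ k, Integrable (fun θ => P.coef U k t θ * UnitAddTorus.mFourier k x) μ :=
    fun k => (P.integrable_coef U k t).mul_const _
  have h2 : Summable fun k => ∫ θ, ‖P.coef U k t θ * UnitAddTorus.mFourier k x‖ ∂μ := by
    refine (summable_wt.mul_left ‖U‖).of_nonneg_of_le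
      (fun k => integral_nonneg fun _ => norm_nonneg _) fun k => ?_
    have : ∫ θ, ‖P.coef U k t θ * UnitAddTorus.mFourier k x‖ ∂μ ≤ ∫ _θ, ‖U‖ * wt k ∂μ := by
      refine integral_mono (h1 k).norm (integrable_const _) fun θ => ?_
      simp only [norm_mul_mFourier]
      exact (P.norm_coef_le U k t θ).trans
        (mul_le_mul_of_nonneg_left (P.om_le_wt k t) (norm_nonneg _))
    simpa using this
  have h3 := hasSum_integral_of_summable_integral_norm h1 h2
  have h4 : ∑' k, P.coef (P.average U) k t θ * UnitAddTorus.mFourier k x =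
      ∫ θ', ((P.fn U t θ' x : ℝ) : ℂ) ∂μ := by
    simp only [fn, ofReal_syn ((P.isCoef_coef U).herm t _), coef_average]
    rw [← h3.tsum_eq]
    simp only [integral_mul_const]
  rw [fn, syn, h4, integral_complex_ofReal, Complex.ofReal_re]

end Average

end WeightPar

/-! ### Identities for the symbols -/

lemma sum_dsym_sq (k : Freq) : ∑ i, dsym i k * dsym i k = -((ang k : ℂ) ^ 2) := by
  have h : ((freqNorm k : ℂ)) ^ 2 = ∑ j, (k j : ℂ) ^ 2 := by
    have := freqNorm_sq k
    exact_mod_cast congrArg (fun r : ℝ => (r : ℂ)) this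
  simp only [Fin.sum_univ_three, dsym, ang] at h ⊢
  push_cast
  rw [mul_pow, h]
  linear_combination (4 * (Real.pi : ℂ) ^ 2 * ((k 0 : ℂ) ^ 2 + (k 1 : ℂ) ^ 2 + (k 2 : ℂ) ^ 2)) *
    Complex.I_sq

@[simp] lemma dsym_zero (i : Fin 3) : dsym i 0 = 0 := by simp [dsym]

@[simp] lemma curlSym_zero (i l : Fin 3) : curlSym i l 0 = 0 := by simp [curlSym]

lemma sum_curlSym_mul (i : Fin 3) (k : Freq) (a : Fin 3 → ℂ) :
    ∑ l, curlSym i l k * a l = dsym (i + 1) k * a (i + 2) - dsym (i + 2) k * a (i + 1) := by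
  fin_cases i <;> simp [Fin.sum_univ_three, curlSym] <;> ring

lemma sum_dsym_curlSym (k : Freq) (a : Fin 3 → ℂ) :
    ∑ i, dsym i k * ∑ l, curlSym i l k * a l = 0 := by
  simp_rw [sum_curlSym_mul]
  simp only [Fin.sum_univ_three]
  simp only [Fin.isValue, zero_add, show (1 : Fin 3) + 1 = 2 from rfl,
    show (1 : Fin 3) + 2 = 0 from rfl, show (2 : Fin 3) + 1 = 0 from rfl,
    show (2 : Fin 3) + 2 = 1 from rfl]
  ring

/-- The identity curl curl = ∇ div - Δ on divergence-free fields. -/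
lemma sum_curlSym_curlSym (i : Fin 3) (k : Freq) (a : Fin 3 → ℂ)
    (ha : ∑ i, dsym i k * a i = 0) :
    ∑ l, curlSym i l k * ∑ m, curlSym l m k * a m = (ang k : ℂ) ^ 2 * a i := by
  have h := sum_dsym_sq k
  simp only [sum_curlSym_mul]
  simp only [Fin.sum_univ_three] at ha h
  have h' : (ang k : ℂ) ^ 2 = -(dsym 0 k * dsym 0 k + dsym 1 k * dsym 1 k + dsym 2 k * dsym 2 k) := by
    rw [h, neg_neg]
  rw [h']
  fin_cases i
  · change dsym 1 k * (dsym 0 k * a 1 - dsym 1 k * a 0) - dsym 2 k * (dsym 2 k * a 0 - dsym 0 k * a 2)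
      = _ * a 0
    linear_combination dsym 0 k * ha
  · change dsym 2 k * (dsym 1 k * a 2 - dsym 2 k * a 1) - dsym 0 k * (dsym 0 k * a 1 - dsym 1 k * a 0)
      = _ * a 1
    linear_combination dsym 1 k * ha
  · change dsym 0 k * (dsym 2 k * a 0 - dsym 0 k * a 2) - dsym 1 k * (dsym 1 k * a 2 - dsym 2 k * a 1)
      = _ * a 2
    linear_combination dsym 2 k * ha

lemma sum_leraySym_mul (i : Fin 3) (k : Freq) (c : Fin 3 → ℂ) :
    ∑ j, leraySym i j k * c j =
      c i - (k i : ℂ) * (∑ j, (k j : ℂ) * c j) / ∑ j, (k j : ℂ) ^ 2 := by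
  have h : ((freqNorm k : ℂ)) ^ 2 = ∑ j, (k j : ℂ) ^ 2 := by
    exact_mod_cast congrArg (fun r : ℝ => (r : ℂ)) (freqNorm_sq k)
  rw [← h]
  have e : ∀ j, leraySym i j k * c j = (if i = j then c j else 0) -
      (k i : ℂ) * ((k j : ℂ) * c j) / (freqNorm k : ℂ) ^ 2 := by
    intro j
    unfold leraySym
    split_ifs <;> push_cast <;> ring
  simp only [e, Finset.sum_sub_distrib, Finset.sum_ite_eq, Finset.mem_univ, if_true,
    Finset.mul_sum, Finset.sum_div]

/-- The projected current is divergence-free, so the wave equation preserves the Coulomb gauge. -/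
lemma sum_dsym_leraySym (k : Freq) (c : Fin 3 → ℂ) :
    ∑ i, dsym i k * ∑ j, leraySym i j k * c j = 0 := by
  by_cases hk : k = 0
  · simp [hk]
  have h : ((freqNorm k : ℂ)) ^ 2 = ∑ j, (k j : ℂ) ^ 2 := by
    exact_mod_cast congrArg (fun r : ℝ => (r : ℂ)) (freqNorm_sq k)
  have h0 : ∑ j, (k j : ℂ) ^ 2 ≠ 0 := by
    rw [← h]
    have := one_le_freqNorm hk
    exact pow_ne_zero 2 (by exact_mod_cast (by linarith : 0 < freqNorm k).ne')
  simp only [sum_leraySym_mul]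
  simp only [Fin.sum_univ_three, dsym] at h0 ⊢
  field_simp
  ring

lemma curl_eq (F : T3 → Fin 3 → ℝ) (x : T3) (i : Fin 3) :
    curl F x i = pderiv (i + 1) (fun y => F y (i + 2)) x - pderiv (i + 2) (fun y => F y (i + 1)) x := by
  fin_cases i <;> rfl

lemma crossProduct_eq (v w : Fin 3 → ℝ) (i : Fin 3) :
    crossProduct v w i = v (i + 1) * w (i + 2) - v (i + 2) * w (i + 1) := by
  fin_cases i <;> simp [cross_apply]

/-- The equation for h says (1+h)²(1+ε²|ξ|²) = 1, and h > -1 selects the positive square root. -/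
lemma vel_eq_of_lorentz {ε h : ℝ} {ξ : Fin 3 → ℝ}
    (hh : h = -(1 / 2) * (h * h + ε ^ 2 * ((∑ j, ξ j ^ 2) * (1 + h) ^ 2))) (hpos : -1 < h)
    (i : Fin 3) : vel ε ξ i = ξ i + ξ i * h := by
  have hs : 0 ≤ ∑ j, ξ j ^ 2 := Finset.sum_nonneg fun _ _ => sq_nonneg _
  have h1 : (1 + ε ^ 2 * ∑ j, ξ j ^ 2) = ((1 + h)⁻¹) ^ 2 := by
    have : 0 < 1 + h := by linarith
    rw [inv_pow]
    exact eq_inv_of_mul_eq_one_left (by linarith)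
  have h2 : Real.sqrt (1 + ε ^ 2 * ∑ j, ξ j ^ 2) = (1 + h)⁻¹ := by
    rw [h1, Real.sqrt_sq (inv_nonneg.2 (by linarith))]
  rw [vel, h2, div_inv_eq_mul]
  ring

/-! ### Free electromagnetic fields -/

/-- The initial vector potential of a magnetic field with coefficients `b`. -/
def potCoef (b : Fin 3 → Freq → ℂ) (i : Fin 3) (k : Freq) : ℂ :=
  (∑ l, curlSym i l k * b l k) * ((1 / ang k ^ 2 : ℝ) : ℂ)

/-- The initial value of `ε ∂ₜ A`, for an electric field with coefficients `e` and a density with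
coefficients `n`. -/
def velCoef (e : Fin 3 → Freq → ℂ) (n : Freq → ℂ) (i : Fin 3) (k : Freq) : ℂ :=
  -e i k - dsym i k * ((1 / ang k ^ 2 : ℝ) : ℂ) * n k

/-- The free evolution of the vector potential. -/
def freePot (ε : ℝ) (p q : Freq → ℂ) (k : Freq) (t : ℝ) : ℂ :=
  cosK ε k t * p k + sinK ε k t * q k

/-- The free evolution of `ε ∂ₜ A`. -/
def freeVel (ε : ℝ) (p q : Freq → ℂ) (k : Freq) (t : ℝ) : ℂ :=
  -((ang k : ℂ) ^ 2 * sinK ε k t * p k) + cosK ε k t * q k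

lemma hasDerivAt_freePot {ε : ℝ} (p q : Freq → ℂ) (k : Freq) (t : ℝ) :
    HasDerivAt (freePot ε p q k) ((ε : ℂ)⁻¹ * freeVel ε p q k t) t := by
  have d := ((hasDerivAt_cosK ε k t).ofReal_comp.mul_const (p k)).add
    ((hasDerivAt_sinK ε k t).ofReal_comp.mul_const (q k))
  refine d.congr_deriv ?_
  unfold freeVel
  push_cast
  ring

lemma hasDerivAt_freeVel {ε : ℝ} (p q : Freq → ℂ) (k : Freq) (t : ℝ) :
    HasDerivAt (freeVel ε p q k) (-((ang k : ℂ) ^ 2 * (ε : ℂ)⁻¹ * freePot ε p q k t)) t := by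
  have d := ((((hasDerivAt_sinK ε k t).ofReal_comp.const_mul ((ang k : ℂ) ^ 2)).mul_const
    (p k)).neg).add ((hasDerivAt_cosK ε k t).ofReal_comp.mul_const (q k))
  refine d.congr_deriv ?_
  unfold freePot
  push_cast
  ring

lemma freePot_zero (ε : ℝ) (p q : Freq → ℂ) (k : Freq) : freePot ε p q k 0 = p k := by
  simp [freePot]

lemma freeVel_zero (ε : ℝ) (p q : Freq → ℂ) (k : Freq) : freeVel ε p q k 0 = q k := by
  simp [freeVel]

lemma ang_sq_mul_inv {k : Freq} (hk : k ≠ 0) :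
    (ang k : ℂ) ^ 2 * ((1 / ang k ^ 2 : ℝ) : ℂ) = 1 := by
  have := (ang_pos hk).ne'
  have h : ang k ^ 2 * (1 / ang k ^ 2) = 1 := by field_simp
  exact_mod_cast h

lemma sum_dsym_potCoef (b : Fin 3 → Freq → ℂ) (k : Freq) : ∑ i, dsym i k * potCoef b i k = 0 := by
  simp only [potCoef, ← mul_assoc, ← Finset.sum_mul]
  rw [sum_dsym_curlSym k fun l => b l k, zero_mul]

/-- Gauss's law for the initial data is exactly the statement that the initial ∂ₜA, determined by E⁰
and ∇φ, is divergence-free. -/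
lemma sum_dsym_velCoef {e : Fin 3 → Freq → ℂ} {n : Freq → ℂ} {k : Freq}
    (h : k ≠ 0 → ∑ i, dsym i k * e i k = n k) : ∑ i, dsym i k * velCoef e n i k = 0 := by
  by_cases hk : k = 0
  · simp [hk]
  have h1 := sum_dsym_sq k
  have h2 := ang_sq_mul_inv hk
  have h3 := h hk
  have : ∑ i, dsym i k * velCoef e n i k = -(∑ i, dsym i k * e i k)
      - (∑ i, dsym i k * dsym i k) * (((1 / ang k ^ 2 : ℝ) : ℂ) * n k) := by
    rw [Finset.sum_mul, ← Finset.sum_neg_distrib, ← Finset.sum_sub_distrib]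
    refine Finset.sum_congr rfl fun i _ => ?_
    rw [velCoef]
    ring
  rw [this, h3, h1]
  linear_combination n k * h2

lemma sum_curlSym_potCoef {b : Fin 3 → Freq → ℂ} {k : Freq} (hk : k ≠ 0)
    (h : ∑ i, dsym i k * b i k = 0) (i : Fin 3) : ∑ l, curlSym i l k * potCoef b l k = b i k := by
  simp only [potCoef, ← mul_assoc, ← Finset.sum_mul]
  rw [sum_curlSym_curlSym i k (fun l => b l k) h]
  linear_combination b i k * ang_sq_mul_inv hk

lemma isKernel_sinK (P : WeightPar) {ε : ℝ} (h0 : 0 < ε) (h1 : ε ≤ 1) (hT : P.T ≤ 1) :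
    P.IsKernel (1 / ε) fun k t => (sinK ε k t : ℂ) where
  nonneg := by positivity
  cont k := by have := continuous_sinK ε k; fun_prop
  herm t := herm_ofReal fun k => by simp
  bound k t ht := by
    have hk := freqNorm_nonneg k
    have h := abs_mul_sinK_le h0 h1 k ⟨ht.1, ht.2.trans hT⟩
    rw [abs_mul, abs_of_pos h0] at h
    rw [Complex.norm_real, Real.norm_eq_abs]
    have h2 : |sinK ε k t| ≤ 1 / ε := by rw [le_div_iff₀ h0]; linarith
    exact h2.trans (le_mul_of_one_le_right (by positivity) (by linarith))

lemma isKernel_cosK (P : WeightPar) (ε : ℝ) : P.IsKernel 1 fun k t => (cosK ε k t : ℂ) where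
  nonneg := zero_le_one
  cont k := by have := continuous_cosK ε k; fun_prop
  herm t := herm_ofReal fun k => by simp
  bound k t _ := by
    have hk := freqNorm_nonneg k
    rw [Complex.norm_real, Real.norm_eq_abs]
    linarith [abs_cosK_le ε k t]

namespace WeightPar

variable {P : WeightPar} {M : Type*} [MeasurableSpace M] {μ : Measure M}

variable (P) in
lemma continuous_coef (U : CoefSpace μ) (k : Freq) (θ : M) : Continuous fun t => P.coef U k t θ :=
  (P.isCoef_coef U).cont k θ

lemma hasDerivWithinAt_of_clamp {f g : ℝ → ℂ} {g' : ℂ} {t : ℝ} (ht : t ∈ Icc 0 P.T)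
    (hfg : ∀ s, f s = g (P.clamp s)) (hg : HasDerivAt g g' t) :
    HasDerivWithinAt f g' (Icc 0 P.T) t :=
  hg.hasDerivWithinAt.congr (fun s hs => by rw [hfg, P.clamp_of_mem hs])
    (by rw [hfg, P.clamp_of_mem ht])

lemma hasDerivWithinAt_integral_clamp {f : ℝ → ℂ} (hf : Continuous f) {t : ℝ}
    (ht : t ∈ Icc 0 P.T) :
    HasDerivWithinAt (fun s => ∫ r in (0 : ℝ)..P.clamp s, f r) (f t) (Icc 0 P.T) t :=
  hasDerivWithinAt_of_clamp ht (fun _ => rfl) (hf.integral_hasStrictDerivAt 0 t).hasDerivAt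

end WeightPar

/-! ### Evolution equations satisfied by a fixed point -/

namespace Sys

variable {M : Type*} [MeasurableSpace M] {μ : Measure M} [IsProbabilityMeasure μ]

/-- The data of the fixed point problem come from initial data with Fourier coefficients `r₀`
(densities), `x₀` (velocities), `e₀` and `b₀` (electromagnetic field). -/
structure Adapted (D : Sys μ) (r₀ : M → Freq → ℂ) (x₀ : Fin 3 → M → Freq → ℂ)
    (e₀ b₀ : Fin 3 → Freq → ℂ) (afree wfree : Fin 3 → CoefSpace μ) : Prop where
  rin_coef : ∀ k t θ, D.P.coef D.rin k t θ = r₀ θ k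
  afree_coef : ∀ i k t θ, D.P.coef (afree i) k t θ =
    freePot D.eps (potCoef b₀ i) (velCoef e₀ (fun k => ∫ θ, r₀ θ k ∂μ) i) k (D.P.clamp t)
  wfree_coef : ∀ i k t θ, D.P.coef (wfree i) k t θ =
    freeVel D.eps (potCoef b₀ i) (velCoef e₀ (fun k => ∫ θ, r₀ θ k ∂μ) i) k (D.P.clamp t)
  -- This is ξ(0) + εA(0) - εA_free(t): the initial value of ξ + εA, from which the free part of εA
  -- is removed so that ξ remains.
  xin_coef : ∀ i k t θ, D.P.coef (D.xin i) k t θ = ((1 + freqNorm k : ℝ) : ℂ) *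
    (x₀ i θ k + D.eps * potCoef b₀ i k - D.eps * D.P.coef (afree i) k t θ)
  -- A curl has mean zero, so the mean ⟨B⁰⟩ is added by hand on the zero mode.
  bin_coef : ∀ i k t θ, D.P.coef (D.bin i) k t θ =
    ∑ l, curlSym i l k * D.P.coef (afree l) k t θ + if k = 0 then b₀ i 0 else 0
  gauss : ∀ k, k ≠ 0 → ∑ i, dsym i k * e₀ i k = ∫ θ, r₀ θ k ∂μ
  total : ∫ θ, r₀ θ 0 ∂μ = 1
  solenoidal : ∀ k, ∑ i, dsym i k * b₀ i k = 0

/-- The vector potential. -/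
def pot (D : Sys μ) (afree : Fin 3 → CoefSpace μ) (u : State μ) (i : Fin 3) : CoefSpace μ :=
  afree i + duhamel (isKernel_sinK D.P D.eps_pos D.eps_le D.T_le) (D.pcur i u)

/-- The field `ε ∂ₜ A`. -/
def potVel (D : Sys μ) (wfree : Fin 3 → CoefSpace μ) (u : State μ) (i : Fin 3) : CoefSpace μ :=
  wfree i + duhamel (isKernel_cosK D.P D.eps) (D.pcur i u)

/-- The scalar potential. -/
def phi (D : Sys μ) (u : State μ) : CoefSpace μ :=
  D.P.multiplier isSymbol_invLaplacian (D.P.average u.1)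

section Verification

variable {D : Sys μ} {r₀ : M → Freq → ℂ} {x₀ : Fin 3 → M → Freq → ℂ}
  {e₀ b₀ : Fin 3 → Freq → ℂ} {afree wfree : Fin 3 → CoefSpace μ} {u : State μ}

lemma coef_pcur (u : State μ) (i : Fin 3) (k : Freq) (t : ℝ) (θ : M) :
    D.P.coef (D.pcur i u) k t θ = ∑ j, leraySym i j k * ∫ θ', D.P.coef (D.flux j u) k t θ' ∂μ := by
  simp [pcur, cur, coef_sum]

lemma coef_gradPhi (u : State μ) (i : Fin 3) (k : Freq) (t : ℝ) (θ : M) :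
    D.P.coef (D.gradPhi i u) k t θ = dsym i k * D.P.coef (D.phi u) k t θ := by
  simp [gradPhi, phi, mul_assoc]

lemma coef_phi (u : State μ) (k : Freq) (t : ℝ) (θ : M) :
    D.P.coef (D.phi u) k t θ = ((1 / ang k ^ 2 : ℝ) : ℂ) * ∫ θ', D.P.coef u.1 k t θ' ∂μ := by
  simp [phi]

lemma coef_dxi (u : State μ) (i j : Fin 3) (k : Freq) (t : ℝ) (θ : M) :
    D.P.coef (D.dxi i j u) k t θ = dsym j k * D.P.coef (D.xi i u) k t θ := by
  simp [dxi, xi, mul_assoc]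

lemma coef_rho (hD : D.Adapted r₀ x₀ e₀ b₀ afree wfree) (hu : D.step u = u) (k : Freq) (t : ℝ)
    (θ : M) : D.P.coef u.1 k t θ =
      r₀ θ k - ∫ s in (0 : ℝ)..D.P.clamp t, ∑ j, dsym j k * D.P.coef (D.flux j u) k s θ := by
  have h : u.1 = D.stepRho u := congrArg Prod.fst hu.symm
  rw [h, stepRho, coef_sub, coef_sum, hD.rin_coef,
    intervalIntegral.integral_finsetSum fun j _ =>
      ((D.P.continuous_coef _ k θ).const_mul _).intervalIntegrable _ _]
  simp only [coef_duhamel]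

/-- After cancelling 1+|k|, the free and the Duhamel parts recombine into the full potential, and
the fixed point equation becomes the integrated equation for ξ + εA. -/
lemma coef_xi (hD : D.Adapted r₀ x₀ e₀ b₀ afree wfree) (hu : D.step u = u) (i : Fin 3) (k : Freq)
    (t : ℝ) (θ : M) : D.P.coef (D.xi i u) k t θ =
      x₀ i θ k + D.eps * potCoef b₀ i k - D.eps * D.P.coef (D.pot afree u i) k t θ
        - ∫ s in (0 : ℝ)..D.P.clamp t, D.P.coef (D.force i u) k s θ := by
  have h : u.2.1 i = D.stepXi i u := congrFun (congrArg (fun v : State μ => v.2.1) hu.symm) i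
  have hk : (1 : ℂ) + (freqNorm k : ℂ) ≠ 0 := by
    have := freqNorm_nonneg k
    exact_mod_cast (by linarith : 0 < 1 + freqNorm k).ne'
  rw [xi, coef_multiplier, h, stepXi, coef_sub, coef_sub, hD.xin_coef, pot, coef_add]
  simp only [coef_duhamel]
  have e : ∀ s, (((1 + freqNorm k) * (D.eps * sinK D.eps k (D.P.clamp t - s)) : ℝ) : ℂ) *
      D.P.coef (D.pcur i u) k s θ = ((1 : ℂ) + freqNorm k) * D.eps *
      ((sinK D.eps k (D.P.clamp t - s) : ℂ) * D.P.coef (D.pcur i u) k s θ) := by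
    intro s
    push_cast
    ring
  simp only [e, intervalIntegral.integral_const_mul]
  push_cast
  field_simp
  ring

lemma hasDerivWithinAt_coef_rho (hD : D.Adapted r₀ x₀ e₀ b₀ afree wfree) (hu : D.step u = u)
    (k : Freq) (θ : M) {t : ℝ} (ht : t ∈ Icc 0 D.P.T) :
    HasDerivWithinAt (fun s => D.P.coef u.1 k s θ)
      (-∑ j, dsym j k * D.P.coef (D.flux j u) k t θ) (Icc 0 D.P.T) t := by
  simp only [coef_rho hD hu]
  exact (hasDerivWithinAt_integral_clamp
    (continuous_finsetSum _ fun j _ => (D.P.continuous_coef _ k θ).const_mul _) ht).const_sub _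

lemma hasDerivWithinAt_coef_pot (hD : D.Adapted r₀ x₀ e₀ b₀ afree wfree)
    (i : Fin 3) (k : Freq) (θ : M) {t : ℝ} (ht : t ∈ Icc 0 D.P.T) :
    HasDerivWithinAt (fun s => D.P.coef (D.pot afree u i) k s θ)
      ((D.eps : ℂ)⁻¹ * D.P.coef (D.potVel wfree u i) k t θ) (Icc 0 D.P.T) t := by
  have hd := (hasDerivAt_freePot (ε := D.eps) (potCoef b₀ i)
    (velCoef e₀ (fun k => ∫ θ, r₀ θ k ∂μ) i) k t).add
    (hasDerivAt_integral_sinK (D.P.continuous_coef (D.pcur i u) k θ) D.eps k t)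
  refine (hasDerivWithinAt_of_clamp ht (fun s => ?_) hd).congr_deriv ?_
  · simp [pot, coef_add, hD.afree_coef]
  · simp [potVel, coef_add, hD.wfree_coef, D.P.clamp_of_mem ht, mul_add]

lemma hasDerivWithinAt_coef_potVel (hD : D.Adapted r₀ x₀ e₀ b₀ afree wfree)
    (i : Fin 3) (k : Freq) (θ : M) {t : ℝ} (ht : t ∈ Icc 0 D.P.T) :
    HasDerivWithinAt (fun s => D.P.coef (D.potVel wfree u i) k s θ)
      (D.P.coef (D.pcur i u) k t θ - (ang k : ℂ) ^ 2 * (D.eps : ℂ)⁻¹ *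
        D.P.coef (D.pot afree u i) k t θ) (Icc 0 D.P.T) t := by
  have hd := (hasDerivAt_freeVel (ε := D.eps) (potCoef b₀ i)
    (velCoef e₀ (fun k => ∫ θ, r₀ θ k ∂μ) i) k t).add
    (hasDerivAt_integral_cosK (D.P.continuous_coef (D.pcur i u) k θ) D.eps k t)
  refine (hasDerivWithinAt_of_clamp ht (fun s => ?_) hd).congr_deriv ?_
  · simp [potVel, coef_add, hD.wfree_coef]
  · simp only [pot, coef_add, hD.afree_coef, D.P.clamp_of_mem ht, coef_duhamel]
    ring

/-- Differentiating εA returns the term -ε ∂ₜA of the electric field that the integrated form had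
hidden. -/
lemma hasDerivWithinAt_coef_xi (hD : D.Adapted r₀ x₀ e₀ b₀ afree wfree) (hu : D.step u = u)
    (i : Fin 3) (k : Freq) (θ : M) {t : ℝ} (ht : t ∈ Icc 0 D.P.T) :
    HasDerivWithinAt (fun s => D.P.coef (D.xi i u) k s θ)
      (-(D.P.coef (D.potVel wfree u i + D.force i u) k t θ)) (Icc 0 D.P.T) t := by
  simp only [coef_xi hD hu]
  have h0 : (D.eps : ℂ) ≠ 0 := by exact_mod_cast D.eps_pos.ne'
  refine ((((hasDerivWithinAt_coef_pot (u := u) hD i k θ ht).const_mul (D.eps : ℂ)).const_sub _).sub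
    (hasDerivWithinAt_integral_clamp (D.P.continuous_coef (D.force i u) k θ) ht)).congr_deriv ?_
  rw [coef_add, mul_inv_cancel_left₀ h0]
  ring

/-- Termwise differentiation in time of the functions given by elements of the space. -/
lemma hasDerivWithinAt_fn (U : CoefSpace μ) (θ : M) {a' : Freq → ℝ → ℂ} {w : Freq → ℝ}
    (hw : Summable w) (haw : ∀ k t, ‖a' k t‖ ≤ w k) (hc : ∀ k, Continuous (a' k))
    (h : ∀ k, ∀ t ∈ Icc 0 D.P.T,
      HasDerivWithinAt (fun s => D.P.coef U k s θ) (a' k t) (Icc 0 D.P.T) t)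
    (x : T3) {t : ℝ} (ht : t ∈ Icc 0 D.P.T) :
    HasDerivWithinAt (fun s => D.P.fn U s θ x) (syn (fun k => a' k t) x) (Icc 0 D.P.T) t :=
  hasDerivWithinAt_syn D.P.T_pos (a := fun k s => D.P.coef U k s θ) h
    (fun k => (hc k).continuousOn) hw (fun k t _ => haw k t) (D.P.summable_coef U 0 θ) x ht

lemma hasDerivWithinAt_rho (hD : D.Adapted r₀ x₀ e₀ b₀ afree wfree) (hu : D.step u = u) (θ : M)
    (x : T3) {t : ℝ} (ht : t ∈ Icc 0 D.P.T) :
    HasDerivWithinAt (fun s => D.P.fn u.1 s θ x)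
      (-divergence (fun y i => D.P.fn (D.flux i u) t θ y) x) (Icc 0 D.P.T) t := by
  choose w hw hwb using fun j => D.P.exists_summable_bound (D.flux j u) 1
  have hb : ∀ (k : Freq) (t : ℝ), ‖-∑ j, dsym j k * D.P.coef (D.flux j u) k t θ‖ ≤
      ∑ j, 7 * w j k := by
    intro k t
    rw [norm_neg]
    refine (norm_sum_le _ _).trans (Finset.sum_le_sum fun j _ => ?_)
    rw [norm_mul]
    have h1 := mul_le_mul_of_nonneg_right (norm_dsym_le_seven j k)
      (norm_nonneg (D.P.coef (D.flux j u) k t θ))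
    have h2 := hwb j k t θ
    rw [pow_one] at h2
    linarith
  refine (hasDerivWithinAt_fn u.1 θ
    (a' := fun k t => -∑ j, dsym j k * D.P.coef (D.flux j u) k t θ) (summable_sum fun j _ => (hw j).mul_left 7) hb
    (fun k => (continuous_finsetSum _ fun j _ => (D.P.continuous_coef _ k θ).const_mul _).neg)
    (fun k t ht => hasDerivWithinAt_coef_rho hD hu k θ ht) x ht).congr_deriv ?_
  rw [syn_neg, syn_sum _ fun j _ => D.P.summable_dsym_coef (D.flux j u) t θ j]
  simp only [divergence]
  congr 1
  refine Finset.sum_congr rfl fun j _ => ?_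
  exact (congrFun (D.P.pderiv_fn (D.flux j u) t θ j) x).symm

lemma hasDerivWithinAt_xi (hD : D.Adapted r₀ x₀ e₀ b₀ afree wfree) (hu : D.step u = u) (i : Fin 3)
    (θ : M) (x : T3) {t : ℝ} (ht : t ∈ Icc 0 D.P.T) :
    HasDerivWithinAt (fun s => D.P.fn (D.xi i u) s θ x)
      (-(D.P.fn (D.potVel wfree u i) t θ x + D.P.fn (D.force i u) t θ x)) (Icc 0 D.P.T) t := by
  obtain ⟨w, hw, hwb⟩ := D.P.exists_summable_bound (D.potVel wfree u i + D.force i u) 0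
  refine (hasDerivWithinAt_fn (D.xi i u) θ
    (a' := fun k t => -D.P.coef (D.potVel wfree u i + D.force i u) k t θ) hw (fun k t => ?_)
    (fun k => (D.P.continuous_coef (D.potVel wfree u i + D.force i u) k θ).neg)
    (fun k t ht => hasDerivWithinAt_coef_xi hD hu i k θ ht) x ht).congr_deriv ?_
  · simpa using hwb k t θ
  · rw [syn_neg, ← fn_add]
    rfl

lemma hasDerivWithinAt_pot (hD : D.Adapted r₀ x₀ e₀ b₀ afree wfree) (i : Fin 3)
    (θ : M) (x : T3) {t : ℝ} (ht : t ∈ Icc 0 D.P.T) :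
    HasDerivWithinAt (fun s => D.P.fn (D.pot afree u i) s θ x)
      (D.eps⁻¹ * D.P.fn (D.potVel wfree u i) t θ x) (Icc 0 D.P.T) t := by
  obtain ⟨w, hw, hwb⟩ := D.P.exists_summable_bound (D.eps⁻¹ • D.potVel wfree u i) 0
  refine (hasDerivWithinAt_fn (D.pot afree u i) θ
    (a' := fun k t => D.P.coef (D.eps⁻¹ • D.potVel wfree u i) k t θ) hw (fun k t => ?_)
    (fun k => D.P.continuous_coef (D.eps⁻¹ • D.potVel wfree u i) k θ)
    (fun k t ht => (hasDerivWithinAt_coef_pot hD i k θ ht).congr_deriv ?_) x ht).congr_deriv ?_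
  · simpa using hwb k t θ
  · rw [coef_smul, Complex.ofReal_inv]
  · rw [← fn_smul]
    rfl

/-- The coefficients of `ε ∂ₜ² A`. -/
def potAcc (D : Sys μ) (afree : Fin 3 → CoefSpace μ) (u : State μ) (i : Fin 3) (t : ℝ) (θ : M)
    (k : Freq) : ℂ :=
  D.P.coef (D.pcur i u) k t θ -
    ((D.eps⁻¹ : ℝ) : ℂ) * ((ang k : ℂ) ^ 2 * D.P.coef (D.pot afree u i) k t θ)

lemma summable_ang_sq_coef (U : CoefSpace μ) (t : ℝ) (θ : M) :
    Summable fun k => ‖(ang k : ℂ) ^ 2 * D.P.coef U k t θ‖ := by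
  have h : ∀ k, (ang k : ℂ) ^ 2 * D.P.coef U k t θ =
      -∑ i, dsym i k * (dsym i k * D.P.coef U k t θ) := by
    intro k
    simp only [← mul_assoc, ← Finset.sum_mul]
    rw [sum_dsym_sq, neg_mul, neg_neg]
  simp only [h, norm_neg]
  exact (summable_sum fun i (_ : i ∈ Finset.univ) => D.P.summable_dsym_dsym_coef U t θ i i).of_nonneg_of_le
    (fun _ => norm_nonneg _) fun k => norm_sum_le _ _

lemma laplacian_fn_eq (U : CoefSpace μ) (t : ℝ) (θ : M) (x : T3) :
    laplacian (D.P.fn U t θ) x = -syn (fun k => (ang k : ℂ) ^ 2 * D.P.coef U k t θ) x := by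
  rw [laplacian_fn, ← syn_sum _ fun i _ => D.P.summable_dsym_dsym_coef U t θ i i, ← syn_neg]
  congr 1
  funext k
  simp only [← mul_assoc, ← Finset.sum_mul]
  rw [sum_dsym_sq, neg_mul]

lemma hasDerivWithinAt_potVel (hD : D.Adapted r₀ x₀ e₀ b₀ afree wfree) (i : Fin 3)
    (θ : M) (x : T3) {t : ℝ} (ht : t ∈ Icc 0 D.P.T) :
    HasDerivWithinAt (fun s => D.P.fn (D.potVel wfree u i) s θ x)
      (syn (D.potAcc afree u i t θ) x) (Icc 0 D.P.T) t := by
  obtain ⟨w, hw, hwb⟩ := D.P.exists_summable_bound (D.pcur i u) 0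
  obtain ⟨w', hw', hwb'⟩ := D.P.exists_summable_bound (D.pot afree u i) 2
  refine hasDerivWithinAt_fn (D.potVel wfree u i) θ (a' := fun k t => D.potAcc afree u i t θ k)
    (hw.add (hw'.mul_left (D.eps⁻¹ * 49))) (fun k t => ?_)
    (fun k => (D.P.continuous_coef (D.pcur i u) k θ).sub
      (((D.P.continuous_coef (D.pot afree u i) k θ).const_mul _).const_mul _))
    (fun k t ht => (hasDerivWithinAt_coef_potVel hD i k θ ht).congr_deriv ?_) x ht
  · have h1 := hwb k t θ
    have h2 := hwb' k t θ
    have he := D.eps_pos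
    have hk := freqNorm_nonneg k
    have ha : ang k ≤ 7 * (1 + freqNorm k) := by unfold ang; nlinarith [Real.pi_lt_d2]
    have ha2 : ang k ^ 2 ≤ 49 * (1 + freqNorm k) ^ 2 :=
      (pow_le_pow_left₀ (ang_nonneg k) ha 2).trans (le_of_eq (by ring))
    rw [pow_zero, one_mul] at h1
    refine (norm_sub_le _ _).trans (add_le_add h1 ?_)
    rw [norm_mul, norm_mul, norm_pow, Complex.norm_real, Complex.norm_real, Real.norm_of_nonneg
      (inv_nonneg.2 he.le), Real.norm_of_nonneg (ang_nonneg k), mul_assoc]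
    refine mul_le_mul_of_nonneg_left ?_ (inv_nonneg.2 he.le)
    have := mul_le_mul_of_nonneg_right ha2 (norm_nonneg (D.P.coef (D.pot afree u i) k t θ))
    linarith
  · simp only [potAcc]
    push_cast
    ring

end Verification

end Sys

lemma syn_ite_zero (c : ℂ) (x : T3) : syn (fun k => if k = 0 then c else 0) x = c.re := by
  rw [syn, tsum_eq_single 0 fun k hk => by simp [hk]]
  simp [UnitAddTorus.mFourier_zero]

lemma summable_ite_zero (c : ℂ) : Summable fun k : Freq => ‖if k = 0 then c else 0‖ :=
  summable_of_ne_finset_zero (s := {0}) fun k hk => by simp_all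

namespace Sys

variable {M : Type*} [MeasurableSpace M] {μ : Measure M} [IsProbabilityMeasure μ]
  {D : Sys μ} {r₀ : M → Freq → ℂ} {x₀ : Fin 3 → M → Freq → ℂ}
  {e₀ b₀ : Fin 3 → Freq → ℂ} {afree wfree : Fin 3 → CoefSpace μ} {u : State μ}

/-! ### The functions of a fixed point -/

/-- The fields live in the same θ-dependent space as the fluids but are constant in θ, so they can
be evaluated at any fixed parameter. -/
lemma fn_gradPhi_indep (i : Fin 3) (t : ℝ) (θ θ' : M) :
    D.P.fn (D.gradPhi i u) t θ = D.P.fn (D.gradPhi i u) t θ' := by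
  simp only [fn, coef_gradPhi, coef_phi]

lemma fn_potVel_indep (hD : D.Adapted r₀ x₀ e₀ b₀ afree wfree) (i : Fin 3) (t : ℝ) (θ θ' : M) :
    D.P.fn (D.potVel wfree u i) t θ = D.P.fn (D.potVel wfree u i) t θ' := by
  simp only [fn, potVel, coef_add, hD.wfree_coef, coef_duhamel, coef_pcur]

lemma fn_mag_indep (hD : D.Adapted r₀ x₀ e₀ b₀ afree wfree) (i : Fin 3) (t : ℝ) (θ θ' : M) :
    D.P.fn (D.mag i u) t θ = D.P.fn (D.mag i u) t θ' := by
  simp only [fn, mag, curlDuh, coef_add, coef_sum, hD.bin_coef, hD.afree_coef, coef_duhamel,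
    coef_pcur]

lemma fn_xiSq (t : ℝ) (θ : M) (x : T3) :
    D.P.fn (D.xiSq u) t θ x = ∑ i, D.P.fn (D.xi i u) t θ x ^ 2 := by
  simp only [xiSq, fn_sum, fn_mul, sq]

lemma vel_eq (hu : D.step u = u) (hh : ‖u.2.2‖ ≤ 1 / 4) (i : Fin 3) (t : ℝ) (θ : M) (x : T3) :
    vel D.eps (fun i => D.P.fn (D.xi i u) t θ x) i = D.P.fn (D.velo i u) t θ x := by
  have h : u.2.2 = D.stepH u := congrArg (fun v : State μ => v.2.2) hu.symm
  have h1 : D.P.fn u.2.2 t θ x = D.P.fn (D.stepH u) t θ x := by rw [← h]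
  rw [stepH, fn_smul, fn_add, fn_mul, fn_smul, lorentzTerm, fn_add, fn_add, fn_smul, fn_mul,
    fn_mul, fn_mul, fn_xiSq] at h1
  have h2 := (abs_le.1 ((D.P.abs_fn_le u.2.2 t θ x).trans hh)).1
  rw [velo, fn_add, fn_mul]
  refine vel_eq_of_lorentz (h := D.P.fn u.2.2 t θ x) ?_ (by linarith) i
  refine h1.trans ?_
  ring

lemma fn_flux (i : Fin 3) (t : ℝ) (θ : M) (x : T3) :
    D.P.fn (D.flux i u) t θ x = D.P.fn (D.velo i u) t θ x * D.P.fn u.1 t θ x := fn_mul _ _ _ _ _ _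

lemma pderiv_xi (i j : Fin 3) (t : ℝ) (θ : M) :
    pderiv j (D.P.fn (D.xi i u) t θ) = D.P.fn (D.dxi i j u) t θ := by
  rw [pderiv_fn]
  simp only [fn, coef_dxi]

lemma grad_phi (i : Fin 3) (t : ℝ) (θ : M) (x : T3) :
    grad (D.P.fn (D.phi u) t θ) x i = D.P.fn (D.gradPhi i u) t θ x := by
  rw [grad, pderiv_fn]
  simp only [fn, coef_gradPhi]

lemma fn_force (i : Fin 3) (t : ℝ) (θ : M) (x : T3) :
    D.P.fn (D.force i u) t θ x =
      ∑ j, D.P.fn (D.velo j u) t θ x * D.P.fn (D.dxi i j u) t θ x + D.P.fn (D.gradPhi i u) t θ x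
        - D.eps * (D.P.fn (D.velo (i + 1) u) t θ x * D.P.fn (D.mag (i + 2) u) t θ x
          - D.P.fn (D.velo (i + 2) u) t θ x * D.P.fn (D.mag (i + 1) u) t θ x) := by
  simp only [force, magForce, fn_sub, fn_add, fn_sum, fn_mul, fn_smul]
  ring

lemma curl_fn (U : Fin 3 → CoefSpace μ) (t : ℝ) (θ : M) (x : T3) (i : Fin 3) :
    curl (fun y l => D.P.fn (U l) t θ y) x i =
      syn (fun k => ∑ l, curlSym i l k * D.P.coef (U l) k t θ) x := by
  rw [curl_eq]
  simp only [sum_curlSym_mul i _ fun l => D.P.coef (U l) _ t θ]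
  rw [syn_sub (D.P.summable_dsym_coef _ t θ _) (D.P.summable_dsym_coef _ t θ _), ← pderiv_fn,
    ← pderiv_fn]

lemma summable_curl (U : Fin 3 → CoefSpace μ) (t : ℝ) (θ : M) (i : Fin 3) :
    Summable fun k => ‖∑ l, curlSym i l k * D.P.coef (U l) k t θ‖ := by
  simp only [sum_curlSym_mul i _ fun l => D.P.coef (U l) _ t θ]
  exact ((D.P.summable_dsym_coef _ t θ _).add (D.P.summable_dsym_coef _ t θ _)).of_nonneg_of_le
    (fun _ => norm_nonneg _) fun k => norm_sub_le _ _

lemma coef_mag (hD : D.Adapted r₀ x₀ e₀ b₀ afree wfree) (i : Fin 3) (k : Freq) (t : ℝ) (θ : M) :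
    D.P.coef (D.mag i u) k t θ =
      ∑ l, curlSym i l k * D.P.coef (D.pot afree u l) k t θ + if k = 0 then b₀ i 0 else 0 := by
  simp only [mag, curlDuh, pot, coef_add, coef_sum, coef_duhamel, hD.bin_coef, mul_add, mul_assoc,
    intervalIntegral.integral_const_mul, Finset.sum_add_distrib]
  ring

lemma coef_pot_zero (hD : D.Adapted r₀ x₀ e₀ b₀ afree wfree) (i : Fin 3) (k : Freq) (θ : M) :
    D.P.coef (D.pot afree u i) k 0 θ = potCoef b₀ i k := by
  have h0 : D.P.clamp 0 = 0 := D.P.clamp_of_mem ⟨le_rfl, D.P.T_pos.le⟩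
  simp [pot, coef_add, hD.afree_coef, h0, freePot_zero]

lemma coef_potVel_zero (hD : D.Adapted r₀ x₀ e₀ b₀ afree wfree) (i : Fin 3) (k : Freq) (θ : M) :
    D.P.coef (D.potVel wfree u i) k 0 θ = velCoef e₀ (fun k => ∫ θ, r₀ θ k ∂μ) i k := by
  have h0 : D.P.clamp 0 = 0 := D.P.clamp_of_mem ⟨le_rfl, D.P.T_pos.le⟩
  simp [potVel, coef_add, hD.wfree_coef, h0, freeVel_zero]

lemma coef_rho_zero (hD : D.Adapted r₀ x₀ e₀ b₀ afree wfree) (hu : D.step u = u) (k : Freq)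
    (θ : M) : D.P.coef u.1 k 0 θ = r₀ θ k := by
  have h0 : D.P.clamp 0 = 0 := D.P.clamp_of_mem ⟨le_rfl, D.P.T_pos.le⟩
  rw [coef_rho hD hu, h0]
  simp

lemma coef_xi_zero (hD : D.Adapted r₀ x₀ e₀ b₀ afree wfree) (hu : D.step u = u) (i : Fin 3)
    (k : Freq) (θ : M) : D.P.coef (D.xi i u) k 0 θ = x₀ i θ k := by
  have h0 : D.P.clamp 0 = 0 := D.P.clamp_of_mem ⟨le_rfl, D.P.T_pos.le⟩
  rw [coef_xi hD hu, h0, coef_pot_zero hD]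
  simp

/-- The initial A, the initial ∂ₜA and the source are all divergence-free, and the scalar
propagators commute with the divergence. -/
lemma sum_dsym_pot (hD : D.Adapted r₀ x₀ e₀ b₀ afree wfree) (k : Freq) (t : ℝ) (θ : M) :
    ∑ i, dsym i k * D.P.coef (D.pot afree u i) k t θ = 0 := by
  have h1 := sum_dsym_potCoef b₀ k
  have h2 := sum_dsym_velCoef (e := e₀) (n := fun k => ∫ θ, r₀ θ k ∂μ) (k := k) (hD.gauss k)
  have h3 : ∀ s, ∑ i, dsym i k * D.P.coef (D.pcur i u) k s θ = 0 := fun s => by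
    simp only [coef_pcur]
    exact sum_dsym_leraySym k _
  have h4 : ∑ i, dsym i k * ∫ s in (0 : ℝ)..D.P.clamp t,
      (sinK D.eps k (D.P.clamp t - s) : ℂ) * D.P.coef (D.pcur i u) k s θ = 0 := by
    simp only [← intervalIntegral.integral_const_mul]
    rw [← intervalIntegral.integral_finsetSum fun i _ => ?_]
    · have : ∀ s, ∑ i, dsym i k * ((sinK D.eps k (D.P.clamp t - s) : ℂ) *
          D.P.coef (D.pcur i u) k s θ) = 0 := by
        intro s
        simp only [mul_left_comm (dsym _ k), ← Finset.mul_sum, h3, mul_zero]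
      simp only [this, intervalIntegral.integral_zero]
    · exact ((continuous_kernel_mul (isKernel_sinK D.P D.eps_pos D.eps_le D.T_le)
        (D.pcur i u) k t θ).const_mul _).intervalIntegrable _ _
  simp only [pot, coef_add, coef_duhamel, hD.afree_coef, mul_add, Finset.sum_add_distrib, h4,
    freePot, mul_left_comm (dsym _ k), ← Finset.mul_sum, h1, h2]
  simp

/-- Neutrality is conserved because a divergence has no zero mode. It is the solvability condition
of the Poisson equation. -/
lemma average_rho_zero (hD : D.Adapted r₀ x₀ e₀ b₀ afree wfree) (hu : D.step u = u) (t : ℝ) :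
    ∫ θ, D.P.coef u.1 0 t θ ∂μ = 1 := by
  simp only [coef_rho hD hu, dsym_zero, zero_mul, Finset.sum_const_zero,
    intervalIntegral.integral_zero, sub_zero]
  exact hD.total

lemma current_eq (hu : D.step u = u) (hh : ‖u.2.2‖ ≤ 1 / 4) (t : ℝ) (θ₀ : M) (x : T3)
    (i : Fin 3) :
    current μ D.eps (fun θ => D.P.fn u.1 t θ) (fun θ x i => D.P.fn (D.xi i u) t θ x) x i =
      D.P.fn (D.cur i u) t θ₀ x := by
  rw [cur, fn_average, current]
  refine integral_congr_ae (Eventually.of_forall fun θ => ?_)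
  simp only [vel_eq hu hh, fn_flux]

lemma leray_current (hu : D.step u = u) (hh : ‖u.2.2‖ ≤ 1 / 4) (t : ℝ) (θ₀ : M) (x : T3)
    (i : Fin 3) :
    leray (current μ D.eps (fun θ => D.P.fn u.1 t θ) (fun θ x i => D.P.fn (D.xi i u) t θ x)) x i =
      D.P.fn (D.pcur i u) t θ₀ x := by
  have h : ∀ j, fourierCoef (fun y => current μ D.eps (fun θ => D.P.fn u.1 t θ)
      (fun θ x i => D.P.fn (D.xi i u) t θ x) y j) = fun k => D.P.coef (D.cur j u) k t θ₀ := by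
    intro j
    funext k
    simp only [current_eq hu hh t θ₀]
    exact fourierCoef_syn (D.P.summable_coef _ t θ₀) ((D.P.isCoef_coef _).herm t θ₀) k
  rw [leray, fn, syn]
  simp only [h]
  congr 1
  refine tsum_congr fun k => ?_
  rw [← sum_leraySym_mul i k fun j => D.P.coef (D.cur j u) k t θ₀]
  simp only [pcur, coef_sum, coef_multiplier]

lemma elec_eq (θ₀ : M) (t : ℝ) (x : T3) (i : Fin 3) :
    elec D.eps (fun t => D.P.fn (D.phi u) t θ₀)
      (fun t x i => D.eps⁻¹ * D.P.fn (D.potVel wfree u i) t θ₀ x) t x i =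
      D.P.fn (-D.gradPhi i u - D.potVel wfree u i) t θ₀ x := by
  rw [elec, grad_phi, fn_sub, fn_neg, mul_inv_cancel_left₀ D.eps_pos.ne']

lemma magn_eq {B0 : T3 → Fin 3 → ℝ}
    (hD : D.Adapted r₀ x₀ e₀ (fun i => fourierCoef fun x => B0 x i) afree wfree)
    (θ₀ : M) (t : ℝ) (x : T3) (i : Fin 3) :
    magn B0 (fun t x i => D.P.fn (D.pot afree u i) t θ₀ x) t x i =
      D.P.fn (D.mag i u) t θ₀ x := by
  rw [magn, curl_fn]
  have h1 : (mean B0 i : ℝ) = (fourierCoef (fun x => B0 x i) 0).re := by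
    rw [← mean_eq_fourierCoef, Complex.ofReal_re]
  rw [h1, ← syn_ite_zero _ x, ← syn_add (summable_curl _ t θ₀ i) (summable_ite_zero _)]
  simp only [fn, coef_mag hD]

/-- The functions given by a fixed point solve the Vlasov-Maxwell system. -/
theorem isSolution {δ δ' : ℝ} (hδ : 1 < δ) (hδ' : 1 ≤ δ') {ρ0 : M → T3 → ℝ}
    {ξ0 : M → T3 → Fin 3 → ℝ} {E0 B0 : T3 → Fin 3 → ℝ}
    (hρ : ∀ θ, MemB δ' (ρ0 θ)) (hξ : ∀ θ, MemBVec δ' (ξ0 θ)) (hE : MemBVec δ' E0)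
    (hB : MemBVec δ' B0)
    (hD : D.Adapted (fun θ => fourierCoef (ρ0 θ)) (fun i θ => fourierCoef fun x => ξ0 θ x i)
      (fun i => fourierCoef fun x => E0 x i) (fun i => fourierCoef fun x => B0 x i) afree wfree)
    (hb : Real.log δ ≤ D.P.b) (hu : D.step u = u) (hh : ‖u.2.2‖ ≤ 1 / 4) (θ₀ : M) :
    IsSolution μ D.eps D.P.T δ ρ0 ξ0 E0 B0 (fun θ t => D.P.fn u.1 t θ)
      (fun θ t x i => D.P.fn (D.xi i u) t θ x) (fun t => D.P.fn (D.phi u) t θ₀)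
      (fun t x i => D.P.fn (D.pot afree u i) t θ₀ x)
      (fun t x i => D.eps⁻¹ * D.P.fn (D.potVel wfree u i) t θ₀ x)
      (fun t x i => D.eps⁻¹ * syn (D.potAcc afree u i t θ₀) x) := by
  have he : D.eps ≠ 0 := D.eps_pos.ne'
  constructor
  · exact fun θ => D.P.contInB_fn hδ hb u.1 θ _
  · exact fun θ i => D.P.contInB_fn hδ hb (D.xi i u) θ _
  · exact D.P.contInB_fn hδ hb (D.phi u) θ₀ _
  · exact fun i => D.P.contInB_fn hδ hb (D.pot afree u i) θ₀ _
  · intro i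
    simp only [elec_eq]
    exact D.P.contInB_fn hδ hb _ θ₀ _
  · intro i
    simp only [magn_eq hD]
    exact D.P.contInB_fn hδ hb _ θ₀ _
  · exact fun t _ x => D.P.integrable_fn u.1 t x
  · intro t _ x i
    simp only [vel_eq hu hh, ← fn_flux]
    exact D.P.integrable_fn (D.flux i u) t x
  · intro t _ i
    simp only [current_eq hu hh t θ₀]
    exact D.P.memB_fn hδ hb _ t θ₀
  · intro θ t ht x
    simp only [vel_eq hu hh, ← fn_flux]
    exact hasDerivWithinAt_rho hD hu θ x ht
  · intro θ t ht x i
    refine (hasDerivWithinAt_xi hD hu i θ x ht).congr_deriv ?_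
    have hp : ∀ j, pderiv j (fun y => D.P.fn (D.xi i u) t θ y) x = D.P.fn (D.dxi i j u) t θ x :=
      fun j => congrFun (pderiv_xi i j t θ) x
    simp only [hp, crossProduct_eq, vel_eq hu hh, elec_eq, magn_eq hD, fn_force, fn_sub, fn_neg]
    -- The fields are defined through the fixed parameter θ₀, while the equation is that of the
    -- fluid θ.
    rw [fn_gradPhi_indep i t θ₀ θ, fn_potVel_indep hD i t θ₀ θ, fn_mag_indep hD (i + 1) t θ₀ θ,
      fn_mag_indep hD (i + 2) t θ₀ θ]
    ring
  · intro t _ x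
    rw [laplacian_fn_eq, neg_neg, density, ← fn_average (θ := θ₀)]
    have h1 : (1 : ℝ) = syn (fun k => if k = 0 then (1 : ℂ) else 0) x := by
      rw [syn_ite_zero, Complex.one_re]
    rw [h1, fn, ← syn_sub (D.P.summable_coef _ t θ₀) (summable_ite_zero _)]
    congr 1
    funext k
    rw [coef_phi, coef_average, ← mul_assoc]
    -- At k = 0 the inverse Laplacian is 1/0 = 0, so the right-hand side has to vanish there: this
    -- is neutrality.
    split_ifs with hk
    · rw [hk, average_rho_zero hD hu]
      simp
    · rw [ang_sq_mul_inv hk, one_mul, sub_zero]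
  · exact fun t ht x i => hasDerivWithinAt_pot hD i θ₀ x ht
  · exact fun t ht x i => (hasDerivWithinAt_potVel hD i θ₀ x ht).const_mul _
  · intro t _ x i
    rw [leray_current hu hh t θ₀]
    have h1 : syn (D.potAcc afree u i t θ₀) x = D.P.fn (D.pcur i u) t θ₀ x -
        D.eps⁻¹ * syn (fun k => (ang k : ℂ) ^ 2 * D.P.coef (D.pot afree u i) k t θ₀) x := by
      rw [← syn_const_mul, fn, ← syn_sub (D.P.summable_coef _ t θ₀)]
      · rfl
      · simpa only [norm_mul] using (summable_ang_sq_coef (D := D) (D.pot afree u i) t θ₀).mul_left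
          ‖((D.eps⁻¹ : ℝ) : ℂ)‖
    have h2 := laplacian_fn_eq (D := D) (D.pot afree u i) t θ₀ x
    rw [h1]
    change D.eps ^ 2 * _ - laplacian (D.P.fn (D.pot afree u i) t θ₀) x = _
    rw [h2]
    field_simp
    ring
  · intro t _ x
    have h1 : ∀ i, pderiv i (fun y => D.P.fn (D.pot afree u i) t θ₀ y) x =
        syn (fun k => dsym i k * D.P.coef (D.pot afree u i) k t θ₀) x :=
      fun i => congrFun (D.P.pderiv_fn _ t θ₀ i) x
    rw [divergence]
    simp only [h1]
    rw [← syn_sum _ fun i _ => D.P.summable_dsym_coef (D.pot afree u i) t θ₀ i]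
    simp only [sum_dsym_pot hD]
    simp [syn]
  · intro θ
    simp only [fn, coef_rho_zero hD hu]
    exact syn_fourierCoef (hρ θ).1 ((hρ θ).summable hδ')
  · intro θ
    funext x i
    simp only [fn, coef_xi_zero hD hu]
    exact congrFun (syn_fourierCoef (hξ θ i).1 ((hξ θ i).summable hδ')) x
  · intro x i
    rw [grad_phi, mul_inv_cancel_left₀ he]
    have h1 : E0 x i = syn (fourierCoef fun x => E0 x i) x :=
      (congrFun (syn_fourierCoef (hE i).1 ((hE i).summable hδ')) x).symm
    rw [h1, fn, fn, ← syn_neg, ← syn_sub]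
    · congr 1
      funext k
      rw [coef_potVel_zero hD, coef_gradPhi, coef_phi, velCoef]
      simp only [coef_rho_zero hD hu, mul_assoc]
    · simpa using (hE i).summable hδ'
    · exact D.P.summable_coef _ 0 θ₀
  · intro x i
    rw [curl_fn]
    have h1 : B0 x i = syn (fourierCoef fun x => B0 x i) x :=
      (congrFun (syn_fourierCoef (hB i).1 ((hB i).summable hδ')) x).symm
    have h2 : (mean B0 i : ℝ) = (fourierCoef (fun x => B0 x i) 0).re := by
      rw [← mean_eq_fourierCoef, Complex.ofReal_re]
    rw [h1, h2, ← syn_ite_zero _ x, ← syn_sub ((hB i).summable hδ') (summable_ite_zero _)]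
    congr 1
    funext k
    simp only [coef_pot_zero hD]
    split_ifs with hk
    · simp [hk]
    · rw [sum_curlSym_potCoef hk (hD.solenoidal k), sub_zero]
  · intro i
    have h := mean_eq_fourierCoef (fun x i => D.P.fn (D.pot afree u i) 0 θ₀ x) i
    have h1 := fourierCoef_syn (D.P.summable_coef (D.pot afree u i) 0 θ₀)
      ((D.P.isCoef_coef _).herm 0 θ₀) 0
    have h2 : fourierCoef (fun x => D.P.fn (D.pot afree u i) 0 θ₀ x) 0 = 0 := by
      refine h1.trans ?_
      rw [coef_pot_zero hD]
      simp [potCoef]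
    rw [h2] at h
    exact_mod_cast h

end Sys

/-! ### The fixed point problem of given initial data -/

lemma Herm.add {a b : Freq → ℂ} (ha : Herm a) (hb : Herm b) : Herm fun k => a k + b k := by
  intro k; simp only [ha k, hb k, map_add]

lemma Herm.neg {a : Freq → ℂ} (ha : Herm a) : Herm fun k => -a k := by
  intro k; simp only [ha k, map_neg]

lemma Herm.sub {a b : Freq → ℂ} (ha : Herm a) (hb : Herm b) : Herm fun k => a k - b k := by
  intro k; simp only [ha k, hb k, map_sub]

lemma Herm.sum {ι : Type*} {s : Finset ι} {a : ι → Freq → ℂ} (ha : ∀ i, Herm (a i)) :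
    Herm fun k => ∑ i ∈ s, a i k := by
  intro k; simp only [ha _ k, map_sum]

lemma herm_ite_zero {a : Freq → ℂ} (ha : Herm a) : Herm fun k => if k = 0 then a 0 else 0 := by
  intro k
  have h := ha 0
  rw [neg_zero] at h
  by_cases hk : k = 0 <;> simp [hk, ← h]

lemma herm_potCoef {b : Fin 3 → Freq → ℂ} (hb : ∀ i, Herm (b i)) (i : Fin 3) :
    Herm (potCoef b i) :=
  (Herm.sum fun l => (herm_curlSym i l).mul (hb l)).mul (herm_ofReal fun k => by simp)

lemma herm_velCoef {e : Fin 3 → Freq → ℂ} {n : Freq → ℂ} (he : ∀ i, Herm (e i)) (hn : Herm n)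
    (i : Fin 3) : Herm (velCoef e n i) :=
  (he i).neg.sub (((herm_dsym i).mul (herm_ofReal fun k => by simp)).mul hn)

lemma herm_freePot {p q : Freq → ℂ} (hp : Herm p) (hq : Herm q) (ε t : ℝ) :
    Herm fun k => freePot ε p q k t :=
  ((herm_ofReal fun k => by simp).mul hp).add ((herm_ofReal fun k => by simp).mul hq)

lemma herm_freeVel {p q : Freq → ℂ} (hp : Herm p) (hq : Herm q) (ε t : ℝ) :
    Herm fun k => freeVel ε p q k t := by
  have h : Herm fun k => (ang k : ℂ) ^ 2 * (sinK ε k t : ℂ) := fun k => by simp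
  exact (h.mul hp).neg.add ((herm_ofReal fun k => by simp).mul hq)

lemma ang_mul_inv_sq_le (k : Freq) : ang k * (1 / ang k ^ 2) ≤ 1 := by
  by_cases hk : k = 0
  · simp [hk]
  have h := one_le_ang hk
  have h0 := ang_pos hk
  rw [mul_one_div, div_le_one (by positivity)]
  nlinarith

lemma norm_potCoef_le {b : Fin 3 → Freq → ℂ} {k : Freq} {w : ℝ} (hb : ∀ l, ‖b l k‖ ≤ w)
    (i : Fin 3) : ‖potCoef b i k‖ ≤ 3 * w := by
  have hw : 0 ≤ w := (norm_nonneg _).trans (hb 0)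
  have ha := ang_nonneg k
  have h1 : ‖∑ l, curlSym i l k * b l k‖ ≤ 3 * (ang k * w) := by
    refine (norm_sum_le_of_le _ fun l _ => ?_).trans (b := ∑ _l : Fin 3, ang k * w) (by simp)
    rw [norm_mul]
    exact mul_le_mul (norm_curlSym_le i l k) (hb l) (norm_nonneg _) ha
  rw [potCoef, norm_mul, Complex.norm_real, Real.norm_of_nonneg (by positivity)]
  calc _ ≤ 3 * (ang k * w) * (1 / ang k ^ 2) := by gcongr
    _ = 3 * w * (ang k * (1 / ang k ^ 2)) := by ring
    _ ≤ _ := mul_le_of_le_one_right (by positivity) (ang_mul_inv_sq_le k)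

lemma norm_velCoef_le {e : Fin 3 → Freq → ℂ} {n : Freq → ℂ} {k : Freq} {w : ℝ} {i : Fin 3}
    (he : ‖e i k‖ ≤ w) (hn : ‖n k‖ ≤ w) : ‖velCoef e n i k‖ ≤ 2 * w := by
  have h1 : ‖dsym i k * ((1 / ang k ^ 2 : ℝ) : ℂ)‖ ≤ 1 := by
    rw [norm_mul, Complex.norm_real, Real.norm_of_nonneg (by positivity)]
    exact (mul_le_mul_of_nonneg_right (norm_dsym_le_ang i k) (by positivity)).trans
      (ang_mul_inv_sq_le k)
  rw [velCoef]
  refine (norm_sub_le _ _).trans ?_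
  rw [norm_neg, norm_mul _ (n k)]
  have := mul_le_mul h1 hn (norm_nonneg _) zero_le_one
  linarith

lemma norm_freePot_le {ε t w : ℝ} {p q : Freq → ℂ} {k : Freq} (hp : ‖p k‖ ≤ 3 * w)
    (hq : |sinK ε k t| * ‖q k‖ ≤ 2 * w) : ‖freePot ε p q k t‖ ≤ 5 * w := by
  refine (norm_add_le _ _).trans ?_
  rw [norm_mul, norm_mul, Complex.norm_real, Complex.norm_real, Real.norm_eq_abs,
    Real.norm_eq_abs]
  have := mul_le_mul_of_nonneg_right (abs_cosK_le ε k t) (norm_nonneg (p k))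
  linarith

lemma norm_freeVel_le {ε t w : ℝ} {p q : Freq → ℂ} {k : Freq} (hp : ‖p k‖ ≤ 3 * w)
    (hq : ‖q k‖ ≤ 2 * w) : ‖freeVel ε p q k t‖ ≤ (3 * ang k + 2) * w := by
  refine (norm_add_le _ _).trans ?_
  rw [norm_neg, norm_mul, norm_mul, norm_mul, norm_pow, Complex.norm_real, Complex.norm_real,
    Complex.norm_real, Real.norm_eq_abs, Real.norm_eq_abs, Real.norm_eq_abs,
    abs_of_nonneg (ang_nonneg k)]
  have h1 := mul_le_mul_of_nonneg_right (abs_cosK_le ε k t) (norm_nonneg (q k))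
  have h2 : ang k * |sinK ε k t| * (ang k * ‖p k‖) ≤ 1 * (ang k * (3 * w)) :=
    mul_le_mul (ang_mul_abs_sinK_le ε k t) (mul_le_mul_of_nonneg_left hp (ang_nonneg k))
      (mul_nonneg (ang_nonneg k) (norm_nonneg _)) zero_le_one
  nlinarith

lemma ang_le_seven (k : Freq) : ang k ≤ 7 * freqNorm k := by
  have := Real.pi_lt_d2
  have := freqNorm_nonneg k
  unfold ang
  nlinarith

/-- The weights dominate the exponentially decaying coefficients of the data. -/
lemma exists_weight_bound {a l : ℝ} (h : a < l) : ∃ K > 0, ∀ k : Freq,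
    (1 + freqNorm k) * Real.exp (-l * freqNorm k) ≤ K * (wt k * Real.exp (-a * freqNorm k)) := by
  -- Six powers compensate the decay of `wt`, and one is the factor 1+|k| on the left.
  obtain ⟨K, hK, hb⟩ := exists_pow_mul_exp_le 7 (sub_pos.2 h)
  have hp := polySum_pos
  refine ⟨64 * polySum * K, by positivity, fun k => ?_⟩
  have hk := freqNorm_nonneg k
  have e : Real.exp (-l * freqNorm k) =
      Real.exp (-(l - a) * freqNorm k) * Real.exp (-a * freqNorm k) := by
    rw [← Real.exp_add]; congr 1; ring
  rw [e, wt]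
  calc _ = (1 + freqNorm k) ^ 7 * Real.exp (-(l - a) * freqNorm k) *
        Real.exp (-a * freqNorm k) * (1 / (1 + freqNorm k) ^ 6) := by field_simp
    _ ≤ K * Real.exp (-a * freqNorm k) * (1 / (1 + freqNorm k) ^ 6) := by
        gcongr
        exact hb k
    _ = _ := by field_simp

namespace Sys

variable {M : Type*} [MeasurableSpace M] {μ : Measure M} [IsProbabilityMeasure μ]

/-- Initial data with exponentially decaying coefficients define a fixed point problem. -/
theorem exists_adapted (P : WeightPar) (hT : P.T ≤ 1) {ε : ℝ} (hε : 0 < ε) (hε1 : ε ≤ 1)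
    {l K c G : ℝ} (hc : 0 ≤ c) (hG : 1 ≤ G) (hεG : ε * G ≤ 1) (hK0 : 0 ≤ K)
    (hK : ∀ k : Freq, (1 + freqNorm k) * Real.exp (-l * freqNorm k) ≤
      K * (wt k * Real.exp (-P.a * freqNorm k)))
    {r₀ : M → Freq → ℂ} {x₀ : Fin 3 → M → Freq → ℂ} {e₀ b₀ : Fin 3 → Freq → ℂ}
    (hrm : ∀ k, AEStronglyMeasurable (fun θ => r₀ θ k) μ)
    (hxm : ∀ i k, AEStronglyMeasurable (fun θ => x₀ i θ k) μ)
    (hrh : ∀ θ, Herm (r₀ θ)) (hxh : ∀ i θ, Herm (x₀ i θ)) (heh : ∀ i, Herm (e₀ i))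
    (hbh : ∀ i, Herm (b₀ i))
    (hr : ∀ θ k, ‖r₀ θ k‖ ≤ c * Real.exp (-l * freqNorm k))
    (hx : ∀ i θ k, ‖x₀ i θ k‖ ≤ c * Real.exp (-l * freqNorm k))
    (he : ∀ i k, ‖e₀ i k‖ ≤ c * G * Real.exp (-l * freqNorm k))
    (hb : ∀ i k, ‖b₀ i k‖ ≤ c * G * Real.exp (-l * freqNorm k))
    (hmean : (∀ i, e₀ i 0 = 0) ∨ P.T ≤ ε)
    (gauss : ∀ k, k ≠ 0 → ∑ i, dsym i k * e₀ i k = ∫ θ, r₀ θ k ∂μ)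
    (total : ∫ θ, r₀ θ 0 ∂μ = 1) (solenoidal : ∀ k, ∑ i, dsym i k * b₀ i k = 0) :
    ∃ (D : Sys μ) (afree wfree : Fin 3 → CoefSpace μ), D.P = P ∧ D.eps = ε ∧
      D.Adapted r₀ x₀ e₀ b₀ afree wfree ∧ ‖D.rin‖ ≤ 200 * (c * K) ∧
      (∀ i, ‖D.xin i‖ ≤ 200 * (c * K)) ∧ (∀ i, ‖D.bin i‖ ≤ 200 * (c * K) * G) ∧
      ∀ i, ‖wfree i‖ ≤ 200 * (c * K) * G := by
  have hck : 0 ≤ c * K := mul_nonneg hc hK0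
  have hG0 : 0 ≤ G := by linarith
  set p := potCoef b₀
  set n : Freq → ℂ := fun k => ∫ θ, r₀ θ k ∂μ
  set q := velCoef e₀ n
  have hnh : Herm n := fun k => by
    simp only [n, hrh _ k, integral_conj]
  have hph : ∀ i, Herm (p i) := fun i => herm_potCoef hbh i
  have hqh : ∀ i, Herm (q i) := fun i => herm_velCoef heh hnh i
  have hx0 : ∀ k : Freq, 0 ≤ Real.exp (-l * freqNorm k) := fun k => (Real.exp_pos _).le
  have hn : ∀ k, ‖n k‖ ≤ c * Real.exp (-l * freqNorm k) := fun k => by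
    simpa using norm_integral_le_of_norm_le_const (μ := μ) (Eventually.of_forall fun θ => hr θ k)
  have hn' : ∀ k, ‖n k‖ ≤ c * G * Real.exp (-l * freqNorm k) := fun k =>
    (hn k).trans (mul_le_mul_of_nonneg_right (le_mul_of_one_le_right hc hG) (hx0 k))
  have hp : ∀ i k, ‖p i k‖ ≤ 3 * (c * G * Real.exp (-l * freqNorm k)) := fun i k =>
    norm_potCoef_le (fun j => hb j k) i
  have hq : ∀ i k, ‖q i k‖ ≤ 2 * (c * G * Real.exp (-l * freqNorm k)) := fun i k =>
    norm_velCoef_le (he i k) (hn' k)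
  -- The only place where the alternative `hmean` is used: the zero mode of ε ∂ₜA is -⟨E⁰⟩, which
  -- either vanishes or is multiplied by t/ε ≤ 1.
  have hsq : ∀ i k, ∀ t ∈ Icc 0 P.T,
      |sinK ε k t| * ‖q i k‖ ≤ 2 * (c * G * Real.exp (-l * freqNorm k)) := by
    intro i k t ht
    by_cases hk : k = 0
    · rcases hmean with h | h
      · have : q i k = 0 := by simp [q, velCoef, hk, h]
        rw [this, norm_zero, mul_zero]
        have := hx0 k
        positivity
      · have : |sinK ε k t| ≤ 1 := by
          rw [sinK, if_pos hk, abs_of_nonneg (div_nonneg ht.1 hε.le), div_le_one hε]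
          exact ht.2.trans h
        exact (mul_le_of_le_one_left (norm_nonneg _) this).trans (hq i k)
    · exact (mul_le_of_le_one_left (norm_nonneg _) (abs_sinK_le_one hk t)).trans (hq i k)
  have hA : ∀ i k t, ‖freePot ε (p i) (q i) k (P.clamp t)‖ ≤
      5 * (c * G * Real.exp (-l * freqNorm k)) := fun i k t =>
    norm_freePot_le (hp i k) (hsq i k _ (P.clamp_mem t))
  -- Data decaying at the rate l, with room for one derivative, are dominated by the weights at
  -- every time, since these are bounded below by their value at time 0.
  have habs : ∀ {B s : ℝ} {k : Freq} (t : ℝ), 0 ≤ B →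
      s ≤ B * ((1 + freqNorm k) * Real.exp (-l * freqNorm k)) → s ≤ B * K * P.om k t := by
    intro B s k t hB hs
    refine hs.trans ?_
    rw [mul_assoc]
    exact mul_le_mul_of_nonneg_left
      ((hK k).trans (mul_le_mul_of_nonneg_left (P.le_om k t) hK0)) hB
  have hexp : ∀ k : Freq, Real.exp (-l * freqNorm k) ≤
      (1 + freqNorm k) * Real.exp (-l * freqNorm k) := fun k =>
    le_mul_of_one_le_left (hx0 k) (by linarith [freqNorm_nonneg k])
  have hAc : ∀ i, IsCoef μ fun k t (_ : M) => freePot ε (p i) (q i) k (P.clamp t) := fun i =>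
    { cont := fun k _ => (continuous_iff_continuousAt.2 fun t =>
        (hasDerivAt_freePot (p i) (q i) k t).continuousAt).comp P.continuous_clamp
      meas := fun _ _ => aestronglyMeasurable_const
      herm := fun t _ => herm_freePot (hph i) (hqh i) ε _ }
  have hWc : ∀ i, IsCoef μ fun k t (_ : M) => freeVel ε (p i) (q i) k (P.clamp t) := fun i =>
    { cont := fun k _ => (continuous_iff_continuousAt.2 fun t =>
        (hasDerivAt_freeVel (ε := ε) (p i) (q i) k t).continuousAt).comp P.continuous_clamp
      meas := fun _ _ => aestronglyMeasurable_const
      herm := fun t _ => herm_freeVel (hph i) (hqh i) ε _ }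
  have hAb : ∀ i k t (_ : M), ‖freePot ε (p i) (q i) k (P.clamp t)‖ ≤
      5 * (c * G) * K * P.om k t := fun i k t _ => habs t (by positivity) <| (hA i k t).trans (by
    rw [← mul_assoc]
    exact mul_le_mul_of_nonneg_left (hexp k) (by positivity))
  have hWb : ∀ i k t (_ : M), ‖freeVel ε (p i) (q i) k (P.clamp t)‖ ≤
      200 * (c * G) * K * P.om k t := fun i k t _ => habs t (by positivity) <|
    (norm_freeVel_le (hp i k) (hq i k)).trans (by
      have h1 := ang_le_seven k
      have h2 := freqNorm_nonneg k
      have h3 : 0 ≤ c * G * Real.exp (-l * freqNorm k) := by have := hx0 k; positivity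
      calc _ ≤ (200 * (1 + freqNorm k)) * (c * G * Real.exp (-l * freqNorm k)) :=
            mul_le_mul_of_nonneg_right (by linarith) h3
        _ = _ := by ring)
  have hRc : IsCoef μ fun k (_ : ℝ) θ => r₀ θ k :=
    ⟨fun _ _ => continuous_const, fun k _ => hrm k, fun _ θ => hrh θ⟩
  have hRb : ∀ k t θ, ‖r₀ θ k‖ ≤ c * K * P.om k t := fun k t θ =>
    habs t hc ((hr θ k).trans (mul_le_mul_of_nonneg_left (hexp k) hc))
  have hXc : ∀ i, IsCoef μ fun k t θ => ((1 + freqNorm k : ℝ) : ℂ) *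
      (x₀ i θ k + (ε : ℂ) * p i k - (ε : ℂ) * freePot ε (p i) (q i) k (P.clamp t)) := fun i =>
    { cont := fun k θ => continuous_const.mul (continuous_const.sub
        (continuous_const.mul ((hAc i).cont k θ)))
      meas := fun k t => (((hxm i k).add aestronglyMeasurable_const).sub
        aestronglyMeasurable_const).const_mul _
      herm := fun t θ => (herm_ofReal fun k => by simp).mul (((hxh i θ).add
        ((herm_ofReal fun k => rfl).mul (hph i))).sub
          ((herm_ofReal fun k => rfl).mul ((hAc i).herm t θ))) }
  -- The bound 9 = 1 + 3 + 5 adds ξ(0), εA(0) and εA_free(t). The last two carry a factor εG ≤ 1, so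
  -- the large fields do not make the velocity data large.
  have hXb : ∀ i k t θ, ‖((1 + freqNorm k : ℝ) : ℂ) *
      (x₀ i θ k + (ε : ℂ) * p i k - (ε : ℂ) * freePot ε (p i) (q i) k (P.clamp t))‖ ≤
        9 * c * K * P.om k t := fun i k t θ => habs t (by positivity) (by
    have hk := freqNorm_nonneg k
    have h0 := mul_nonneg hc (hx0 k)
    have hcG : c * G * Real.exp (-l * freqNorm k) = G * (c * Real.exp (-l * freqNorm k)) := by ring
    have hp1 := hp i k
    have hA1 := hA i k t
    rw [hcG] at hp1 hA1
    have hx1 := hx i θ k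
    rw [norm_mul, Complex.norm_real, Real.norm_of_nonneg (by positivity)]
    have h3 : ‖x₀ i θ k + (ε : ℂ) * p i k - (ε : ℂ) * freePot ε (p i) (q i) k (P.clamp t)‖ ≤
        9 * (c * Real.exp (-l * freqNorm k)) := by
      refine (norm_sub_le _ _).trans ((add_le_add_left (norm_add_le _ _) _).trans ?_)
      rw [norm_mul, norm_mul, Complex.norm_real, Real.norm_of_nonneg hε.le]
      have h4 := mul_le_mul_of_nonneg_left hp1 hε.le
      have h5 := mul_le_mul_of_nonneg_left hA1 hε.le
      have h6 := mul_le_mul_of_nonneg_right hεG h0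
      nlinarith
    calc _ ≤ (1 + freqNorm k) * (9 * (c * Real.exp (-l * freqNorm k))) := by gcongr
      _ = _ := by ring)
  have hBc : ∀ i, IsCoef μ fun k t (_ : M) => ∑ j, curlSym i j k *
      freePot ε (p j) (q j) k (P.clamp t) + if k = 0 then b₀ i 0 else 0 := fun i =>
    { cont := fun k θ => (continuous_finsetSum _ fun j _ =>
        continuous_const.mul ((hAc j).cont k θ)).add continuous_const
      meas := fun _ _ => aestronglyMeasurable_const
      herm := fun t θ => (Herm.sum fun j => (herm_curlSym i j).mul ((hAc j).herm t θ)).add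
        (herm_ite_zero (hbh i)) }
  have hBb : ∀ i k t (_ : M), ‖∑ j, curlSym i j k * freePot ε (p j) (q j) k (P.clamp t) +
      if k = 0 then b₀ i 0 else 0‖ ≤ 200 * (c * G) * K * P.om k t := fun i k t _ =>
    habs t (by positivity) (by
      have h1 := ang_le_seven k
      have h2 := freqNorm_nonneg k
      have h3 : 0 ≤ c * G * Real.exp (-l * freqNorm k) := by have := hx0 k; positivity
      have h4 : ‖∑ j, curlSym i j k * freePot ε (p j) (q j) k (P.clamp t)‖ ≤
          ∑ _j : Fin 3, ang k * (5 * (c * G * Real.exp (-l * freqNorm k))) := by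
        refine norm_sum_le_of_le _ fun j _ => ?_
        rw [norm_mul]
        exact mul_le_mul (norm_curlSym_le i j k) (hA j k t) (norm_nonneg _) (ang_nonneg k)
      have h5 : ‖if k = 0 then b₀ i 0 else 0‖ ≤ c * G * Real.exp (-l * freqNorm k) := by
        split_ifs with hk
        · rw [hk]; exact hb i 0
        · simpa using h3
      rw [Finset.sum_const, Finset.card_univ, Fintype.card_fin, nsmul_eq_mul] at h4
      refine (norm_add_le _ _).trans ((add_le_add h4 h5).trans ?_)
      calc _ = (15 * ang k + 1) * (c * G * Real.exp (-l * freqNorm k)) := by push_cast; ring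
        _ ≤ (200 * (1 + freqNorm k)) * (c * G * Real.exp (-l * freqNorm k)) :=
            mul_le_mul_of_nonneg_right (by linarith) h3
        _ = _ := by ring)
  refine ⟨⟨P, ε, hε, hε1, hT, P.ofCoef _ hRc ⟨_, hRb⟩, fun i => P.ofCoef _ (hXc i) ⟨_, hXb i⟩,
    fun i => P.ofCoef _ (hBc i) ⟨_, hBb i⟩⟩, fun i => P.ofCoef _ (hAc i) ⟨_, hAb i⟩,
    fun i => P.ofCoef _ (hWc i) ⟨_, hWb i⟩, rfl, rfl, ⟨?_, ?_, ?_, ?_, ?_, gauss, total,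
      solenoidal⟩, ?_, ?_, ?_, ?_⟩
  · intro k t θ; simp
  · intro i k t θ; simp only [coef_ofCoef]; rfl
  · intro i k t θ; simp only [coef_ofCoef]; rfl
  · intro i k t θ; simp only [coef_ofCoef]; rfl
  · intro i k t θ; simp only [coef_ofCoef]
  · refine P.norm_le_of_coef _ (by positivity) fun k t θ => ?_
    rw [coef_ofCoef]
    exact (hRb k t θ).trans (mul_le_mul_of_nonneg_right (by linarith) (P.om_pos k t).le)
  · intro i
    refine P.norm_le_of_coef _ (by positivity) fun k t θ => ?_
    rw [coef_ofCoef]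
    exact (hXb i k t θ).trans (mul_le_mul_of_nonneg_right (by linarith) (P.om_pos k t).le)
  · intro i
    refine P.norm_le_of_coef _ (by positivity) fun k t θ => ?_
    rw [coef_ofCoef]
    exact (hBb i k t θ).trans (mul_le_mul_of_nonneg_right (by linarith) (P.om_pos k t).le)
  · intro i
    refine P.norm_le_of_coef _ (by positivity) fun k t θ => ?_
    rw [coef_ofCoef]
    exact (hWb i k t θ).trans (mul_le_mul_of_nonneg_right (by linarith) (P.om_pos k t).le)

end Sys

/-! ### Fourier coefficients of the data -/

section Data

variable {M : Type*} [MeasurableSpace M] {μ : Measure M}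

lemma aestronglyMeasurable_fourierCoef {f : M → T3 → ℝ} (hc : ∀ θ, Continuous (f θ))
    (hm : ∀ x, AEStronglyMeasurable (fun θ => f θ x) μ) (k : Freq) :
    AEStronglyMeasurable (fun θ => fourierCoef (f θ) k) μ := by
  simp only [fourierCoef_eq_integral]
  refine aestronglyMeasurable_integral_of_continuous volume
    (u := fun x θ => UnitAddTorus.mFourier (-k) x * (f θ x : ℂ)) (fun θ => ?_) fun x => ?_
  · have := hc θ
    fun_prop
  · exact (Complex.continuous_ofReal.comp_aestronglyMeasurable (hm x)).const_mul _

lemma bNorm_nonneg {δ : ℝ} (hδ : 0 ≤ δ) (f : T3 → ℝ) : 0 ≤ bNorm δ f :=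
  tsum_nonneg fun _ => mul_nonneg (norm_nonneg _) (Real.rpow_nonneg hδ _)

lemma bNorm_le_bNormVec {δ : ℝ} (hδ : 0 ≤ δ) (F : T3 → Fin 3 → ℝ) (i : Fin 3) :
    bNorm δ (fun x => F x i) ≤ bNormVec δ F :=
  Finset.single_le_sum (f := fun i => bNorm δ fun x => F x i)
    (fun _ _ => bNorm_nonneg hδ _) (Finset.mem_univ i)

lemma bNormVec_nonneg {δ : ℝ} (hδ : 0 ≤ δ) (F : T3 → Fin 3 → ℝ) : 0 ≤ bNormVec δ F :=
  Finset.sum_nonneg fun _ _ => bNorm_nonneg hδ _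

lemma MemB.norm_fourierCoef_le_of_bNorm_le {δ c : ℝ} (hδ : 0 < δ) {f : T3 → ℝ} (hf : MemB δ f)
    (hc : bNorm δ f ≤ c) (k : Freq) :
    ‖fourierCoef f k‖ ≤ c * Real.exp (-Real.log δ * freqNorm k) :=
  (hf.norm_fourierCoef_le hδ k).trans (mul_le_mul_of_nonneg_right hc (Real.exp_pos _).le)

lemma MemB.summable_dsym {δ : ℝ} (hδ : 1 < δ) {f : T3 → ℝ} (hf : MemB δ f) (i : Fin 3) :
    Summable fun k => ‖dsym i k * fourierCoef f k‖ := by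
  obtain ⟨K, hK0, hK⟩ := exists_weight_bound (Real.log_pos hδ)
  refine (summable_wt.mul_left (7 * bNorm δ f * K)).of_nonneg_of_le (fun _ => norm_nonneg _)
    fun k => ?_
  have h1 := hf.norm_fourierCoef_le (by linarith) k
  have h2 := (norm_dsym_le_ang i k).trans (ang_le_seven k)
  have hk := freqNorm_nonneg k
  have hb := bNorm_nonneg (by linarith : 0 ≤ δ) f
  have h3 := hK k
  rw [neg_zero, zero_mul, Real.exp_zero, mul_one] at h3
  have he := Real.exp_pos (-Real.log δ * freqNorm k)
  rw [norm_mul]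
  calc _ ≤ (7 * (1 + freqNorm k)) * (bNorm δ f * Real.exp (-Real.log δ * freqNorm k)) :=
        mul_le_mul (by linarith) h1 (norm_nonneg _) (by positivity)
    _ = 7 * bNorm δ f * ((1 + freqNorm k) * Real.exp (-Real.log δ * freqNorm k)) := by ring
    _ ≤ 7 * bNorm δ f * (K * wt k) := by gcongr
    _ = _ := by ring

lemma summable_sum_dsym {δ : ℝ} (hδ : 1 < δ) {F : T3 → Fin 3 → ℝ} (hF : MemBVec δ F) :
    Summable fun k => ‖∑ i, dsym i k * fourierCoef (fun x => F x i) k‖ :=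
  (summable_sum (s := Finset.univ) fun i _ => (hF i).summable_dsym hδ i).of_nonneg_of_le
    (fun _ => norm_nonneg _) fun _ => norm_sum_le _ _

lemma herm_sum_dsym (F : T3 → Fin 3 → ℝ) :
    Herm fun k => ∑ i, dsym i k * fourierCoef (fun x => F x i) k :=
  Herm.sum fun i => (herm_dsym i).mul (herm_fourierCoef _)

lemma divergence_eq_syn {δ : ℝ} (hδ : 1 < δ) {F : T3 → Fin 3 → ℝ} (hF : MemBVec δ F) (x : T3) :
    divergence F x = syn (fun k => ∑ i, dsym i k * fourierCoef (fun x => F x i) k) x := by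
  rw [syn_sum _ fun i _ => (hF i).summable_dsym hδ i]
  refine Finset.sum_congr rfl fun i _ => ?_
  have h := syn_fourierCoef (hF i).1 ((hF i).summable hδ.le)
  conv_lhs => rw [← h]
  exact pderiv_syn ((hF i).summable hδ.le) (fun j => (hF i).summable_dsym hδ j) i x

/-- The pointwise divergence condition becomes a condition on each mode by uniqueness of Fourier
coefficients. -/
lemma sum_dsym_eq_zero {δ : ℝ} (hδ : 1 < δ) {F : T3 → Fin 3 → ℝ} (hF : MemBVec δ F)
    (h : ∀ x, divergence F x = 0) (k : Freq) :
    ∑ i, dsym i k * fourierCoef (fun x => F x i) k = 0 := by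
  have h1 : syn (fun k => ∑ i, dsym i k * fourierCoef (fun x => F x i) k) = fun _ => 0 :=
    funext fun x => (divergence_eq_syn hδ hF x).symm.trans (h x)
  have h2 := fourierCoef_syn (summable_sum_dsym hδ hF) (herm_sum_dsym F) k
  rw [h1, fourierCoef_eq_integral] at h2
  simpa using h2.symm

variable [IsProbabilityMeasure μ]

/-- Gauss's law mode by mode. For k ≠ 0 it serves the gauge condition; for k = 0 the left side
vanishes and the total charge comes out as 1. -/
lemma sum_dsym_eq_of_density {δ c : ℝ} (hδ : 1 < δ) {ρ0 : M → T3 → ℝ} {F : T3 → Fin 3 → ℝ}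
    (hm : ∀ x, AEStronglyMeasurable (fun θ => ρ0 θ x) μ)
    (hρ : ∀ θ, MemB δ (ρ0 θ) ∧ bNorm δ (ρ0 θ) ≤ c) (hF : MemBVec δ F)
    (h : ∀ x, divergence F x = density μ ρ0 x - 1) (k : Freq) :
    ∑ i, dsym i k * fourierCoef (fun x => F x i) k =
      ∫ θ, fourierCoef (ρ0 θ) k ∂μ - if k = 0 then 1 else 0 := by
  have hδ0 : 0 < δ := by linarith
  have hl := Real.log_pos hδ
  obtain ⟨θ₀⟩ := nonempty_of_isProbabilityMeasure μ
  have hc : 0 ≤ c := (bNorm_nonneg hδ0.le _).trans (hρ θ₀).2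
  obtain ⟨K, hK0, hK⟩ := exists_weight_bound (half_lt_self hl)
  -- Any weights of width less than log δ would do: the data are regarded as constant in time only
  -- to borrow `fn_average` for exchanging series and integral.
  let P : WeightPar := ⟨Real.log δ / 2, Real.log δ / 4, 1, Real.log δ / 4, by linarith, one_pos,
    by linarith, by linarith⟩
  have hf : IsCoef μ fun k (_ : ℝ) θ => fourierCoef (ρ0 θ) k :=
    ⟨fun _ _ => continuous_const, fun k _ => aestronglyMeasurable_fourierCoef
      (fun θ => (hρ θ).1.1) hm k, fun _ θ => herm_fourierCoef _⟩
  have hB : ∀ k t θ, ‖fourierCoef (ρ0 θ) k‖ ≤ c * K * P.om k t := fun k t θ => by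
    have hk := freqNorm_nonneg k
    refine ((hρ θ).1.norm_fourierCoef_le_of_bNorm_le hδ0 (hρ θ).2 k).trans ?_
    rw [mul_assoc]
    refine mul_le_mul_of_nonneg_left (le_trans ?_ ((hK k).trans
      (mul_le_mul_of_nonneg_left (P.le_om k t) hK0.le))) hc
    exact le_mul_of_one_le_left (Real.exp_pos _).le (by linarith)
  let U : CoefSpace μ := P.ofCoef _ hf ⟨_, hB⟩
  have hU : P.coef (P.average U) = fun k _ _ => ∫ θ, fourierCoef (ρ0 θ) k ∂μ := by
    funext k t θ
    rw [coef_average, coef_ofCoef]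
  have hs := P.summable_coef (P.average U) 0 θ₀
  have hh := (P.isCoef_coef (P.average U)).herm 0 θ₀
  rw [hU] at hs hh
  have hd : ∀ x, density μ ρ0 x = syn (fun k => ∫ θ, fourierCoef (ρ0 θ) k ∂μ) x := by
    intro x
    have h1 := fn_average (P := P) U 0 θ₀ x
    have h2 : ∀ θ, P.fn U 0 θ = ρ0 θ := fun θ => by
      simp only [fn, U, coef_ofCoef]
      exact syn_fourierCoef (hρ θ).1.1 ((hρ θ).1.summable hδ.le)
    simp only [h2] at h1
    rw [density, ← h1, fn, hU]
  have hz : Herm fun k : Freq => if k = 0 then (1 : ℂ) else 0 := herm_ite_zero (a := fun _ => 1)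
    fun k => by simp
  have h1 : syn (fun k => ∑ i, dsym i k * fourierCoef (fun x => F x i) k) =
      syn fun k => ∫ θ, fourierCoef (ρ0 θ) k ∂μ - if k = 0 then 1 else 0 := by
    funext x
    rw [syn_sub hs (summable_ite_zero 1), syn_ite_zero, ← hd, ← divergence_eq_syn hδ hF, h,
      Complex.one_re]
  have h2 := fourierCoef_syn (summable_sum_dsym hδ hF) (herm_sum_dsym F) k
  rw [h1, fourierCoef_syn _ (hh.sub hz)] at h2
  · exact h2.symm
  · exact (hs.add (summable_ite_zero 1)).of_nonneg_of_le (fun _ => norm_nonneg _)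
      fun k => norm_sub_le _ _

end Data

/-! ### Existence with bounds, and the choice of constants -/

namespace Sys

variable {M : Type*} [MeasurableSpace M] {μ : Measure M} [IsProbabilityMeasure μ]
  {D : Sys μ} {afree wfree : Fin 3 → CoefSpace μ}

/-- Small time intervals and small `ε` yield a solution, with bounds. -/
theorem exists_isSolution {R Q N G δ δ' : ℝ} (hS : Small D R Q) (hδ : 1 < δ) (hδ' : 1 ≤ δ')
    {ρ0 : M → T3 → ℝ} {ξ0 : M → T3 → Fin 3 → ℝ} {E0 B0 : T3 → Fin 3 → ℝ}
    (hρ : ∀ θ, MemB δ' (ρ0 θ)) (hξ : ∀ θ, MemBVec δ' (ξ0 θ)) (hE : MemBVec δ' E0)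
    (hB : MemBVec δ' B0)
    (hD : D.Adapted (fun θ => fourierCoef (ρ0 θ)) (fun i θ => fourierCoef fun x => ξ0 θ x i)
      (fun i => fourierCoef fun x => E0 x i) (fun i => fourierCoef fun x => B0 x i) afree wfree)
    (hb : Real.log δ ≤ D.P.b) (hbin : ∀ i, ‖D.bin i‖ ≤ N * G) (hw : ∀ i, ‖wfree i‖ ≤ N * G)
    (hG : 1 ≤ G) :
    ∃ (ρ : M → ℝ → T3 → ℝ) (ξ : M → ℝ → T3 → Fin 3 → ℝ)
      (φ : ℝ → T3 → ℝ) (A At Att : ℝ → T3 → Fin 3 → ℝ),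
      IsSolution μ D.eps D.P.T δ ρ0 ξ0 E0 B0 ρ ξ φ A At Att ∧
      (∀ θ θ' t t', bNorm δ (ρ θ t) + bNormVec δ (ξ θ' t') ≤ R + 3 * Q ^ 2) ∧
      ∀ t t', bNormVec δ (elec D.eps φ At t) + bNormVec δ (magn B0 A t') ≤
        (6 * N + 3 * (Q ^ 3 + Q ^ 11 + Q ^ 14)) * G := by
  obtain ⟨θ₀⟩ := nonempty_of_isProbabilityMeasure μ
  obtain ⟨u, hu, hfix⟩ := exists_fixedPoint hS
  have hQ := hS.le_Q
  have h3 : ∀ {a : Fin 3 → ℝ} {c : ℝ}, (∀ i, a i ≤ c) → ∑ i, a i ≤ 3 * c := fun h => by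
    rw [Fin.sum_univ_three]
    linarith [h 0, h 1, h 2]
  refine ⟨_, _, _, _, _, _, isSolution hδ hδ' hρ hξ hE hB hD hb hfix hu.2.2 θ₀, ?_, ?_⟩
  · intro θ θ' t t'
    exact add_le_add ((D.P.bNorm_fn_le hδ hb _ t θ).trans hu.1)
      (h3 fun i => (D.P.bNorm_fn_le hδ hb _ t' θ').trans ((tame_velo_xi hS i).bound u hu))
  · intro t t'
    have h1 : ∀ i, ‖-D.gradPhi i u - D.potVel wfree u i‖ ≤ Q ^ 3 + (N * G + Q ^ 11) := by
      intro i
      refine (norm_sub_le _ _).trans (add_le_add ?_ ((norm_add_le _ _).trans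
        (add_le_add (hw i) ((norm_duhamel_apply_le _ _).trans ?_))))
      · rw [norm_neg]
        exact (tame_gradPhi hS i).bound u hu
      · have h4 := (tame_pcur hS i).bound u hu
        rw [one_mul]
        exact (mul_le_of_le_one_left (norm_nonneg _) hS.gain_le_one).trans h4
    have h2 : ∀ i, ‖D.mag i u‖ ≤ N * G + Q ^ 14 := fun i =>
      (norm_add_le _ _).trans (add_le_add (hbin i) ((tame_curlDuh hS i).bound u hu))
    have h5 : bNormVec δ (elec D.eps (fun t => D.P.fn (D.phi u) t θ₀)
        (fun t x i => D.eps⁻¹ * D.P.fn (D.potVel wfree u i) t θ₀ x) t) ≤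
          3 * (Q ^ 3 + (N * G + Q ^ 11)) := by
      simp only [bNormVec, elec_eq]
      exact h3 fun i => (D.P.bNorm_fn_le hδ hb _ t θ₀).trans (h1 i)
    have h6 : bNormVec δ (magn B0 (fun t x i => D.P.fn (D.pot afree u i) t θ₀ x) t') ≤
        3 * (N * G + Q ^ 14) := by
      simp only [bNormVec, magn_eq hD]
      exact h3 fun i => (D.P.bNorm_fn_le hδ hb _ t' θ₀).trans (h2 i)
    have h7 : 0 ≤ Q ^ 3 + Q ^ 11 + Q ^ 14 := by positivity
    -- The contributions of the fluids are bounded independently of G, and G ≥ 1 lets them be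
    -- written as multiples of G.
    nlinarith [mul_le_mul_of_nonneg_left hG h7]

end Sys
end VlasovMaxwell
end

/-- The constants are fixed in the order d, K, N, Q, T₀ from δ₀, δ₁ and C₀ alone: the size ε^(-γ) of
the fields enters only through G = ε^(-γ), for which ε G ≤ 1. -/
theorem theorem2 {M : Type*} [MeasurableSpace M] (μ : Measure M) [IsProbabilityMeasure μ]
    (δ₀ δ₁ C₀ γ : ℝ) (hδ₁ : 1 < δ₁) (hδ : δ₁ < δ₀) (hC₀ : 0 < C₀)
    (hγ : γ ∈ Icc (0 : ℝ) 1)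
    (ρ0 : M → T3 → ℝ) (ξ0 : M → T3 → Fin 3 → ℝ) (E0 B0 : ℝ → T3 → Fin 3 → ℝ)
    (hρmeas : ∀ x, AEStronglyMeasurable (fun θ => ρ0 θ x) μ)
    (hξmeas : ∀ x i, AEStronglyMeasurable (fun θ => ξ0 θ x i) μ)
    (hρ : ∀ θ, MemB δ₀ (ρ0 θ) ∧ bNorm δ₀ (ρ0 θ) ≤ C₀)
    (hξ : ∀ θ, MemBVec δ₀ (ξ0 θ) ∧ bNormVec δ₀ (ξ0 θ) ≤ C₀)
    (hE : ∀ ε ∈ Ioc (0 : ℝ) 1, MemBVec δ₀ (E0 ε))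
    (hB : ∀ ε ∈ Ioc (0 : ℝ) 1, MemBVec δ₀ (B0 ε))
    (hEB : ∀ ε ∈ Ioc (0 : ℝ) 1,
      bNormVec δ₀ (E0 ε) + bNormVec δ₀ (B0 ε) ≤ C₀ * ε ^ (-γ))
    (hdivE : ∀ ε ∈ Ioc (0 : ℝ) 1, ∀ x, divergence (E0 ε) x = density μ ρ0 x - 1)
    (hdivB : ∀ ε ∈ Ioc (0 : ℝ) 1, ∀ x, divergence (B0 ε) x = 0) :
    ∃ ε₀ > 0, ∃ C > 0, ∃ T₀ > 0, ∀ ε ∈ Ioc (0 : ℝ) ε₀,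
      ∃ T > 0, ((∀ i, mean (E0 ε) i = 0) → T₀ ≤ T) ∧
        ∃ (ρ : M → ℝ → T3 → ℝ) (ξ : M → ℝ → T3 → Fin 3 → ℝ)
          (φ : ℝ → T3 → ℝ) (A At Att : ℝ → T3 → Fin 3 → ℝ),
          IsSolution μ ε T δ₁ ρ0 ξ0 (E0 ε) (B0 ε) ρ ξ φ A At Att ∧
          (∀ θ θ', ∀ t ∈ Icc 0 T, ∀ t' ∈ Icc 0 T,
            bNorm δ₁ (ρ θ t) + bNormVec δ₁ (ξ θ' t') ≤ C) ∧
          (∀ t ∈ Icc 0 T, ∀ t' ∈ Icc 0 T,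
            bNormVec δ₁ (elec ε φ At t) + bNormVec δ₁ (magn (B0 ε) A t') ≤ C * ε ^ (-γ)) := by
  have hδ0 : 1 < δ₀ := hδ₁.trans hδ
  have hδp : 0 < δ₀ := by linarith
  have hl : Real.log δ₁ < Real.log δ₀ := Real.log_lt_log (by linarith) hδ
  set l := Real.log δ₀ with hl_def
  set b := Real.log δ₁ with hb_def
  have hb : 0 < b := Real.log_pos hδ₁
  -- The strip starts with width b + d, strictly below log δ₀ to absorb polynomial factors and
  -- strictly above log δ₁ to leave room for shrinking.
  obtain ⟨d, hd, hdl⟩ : ∃ d > 0, b + d < l := ⟨(l - b) / 2, by linarith, by linarith⟩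
  obtain ⟨K, hK0, hK⟩ := exists_weight_bound hdl
  obtain ⟨N, hN_def⟩ : ∃ N, N = 200 * (C₀ * K) := ⟨_, rfl⟩
  have hN : 0 < N := by rw [hN_def]; positivity
  obtain ⟨Q, hQ_def⟩ : ∃ Q, Q = N + 9 := ⟨_, rfl⟩
  have hQ9 : 9 ≤ Q := by linarith
  have hQ : 0 < Q ^ 30 := by positivity
  -- With λ = 2Q^30 this gives both λT₀ ≤ d, the shrinking budget, and T₀ Q^30 ≤ 1/2. Since Q^30/λ =
  -- 1/2 as well, the gain T + 1/λ is at most Q^(-30).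
  obtain ⟨T₀, hT, hTQ⟩ : ∃ T₀ > 0, T₀ * (2 * Q ^ 30) = min 1 d :=
    ⟨min 1 d / (2 * Q ^ 30), div_pos (lt_min one_pos hd) (by positivity),
      div_mul_cancel₀ _ (by positivity)⟩
  have hQ1 : 1 ≤ Q ^ 30 := one_le_pow₀ (by linarith)
  have hT1 : T₀ ≤ 1 := by
    have := min_le_left 1 d
    nlinarith
  refine ⟨1 / Q ^ 30, by positivity,
    (N + 1 + 3 * Q ^ 2) + (6 * N + 3 * (Q ^ 3 + Q ^ 11 + Q ^ 14)), by positivity, T₀, hT,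
    fun ε hε => ?_⟩
  have hεQ : ε * Q ^ 30 ≤ 1 := (le_div_iff₀ hQ).1 hε.2
  have hε0 : 0 < ε := hε.1
  have hε1 : ε ∈ Ioc (0 : ℝ) 1 := ⟨hε0, by nlinarith⟩
  have hG : 1 ≤ ε ^ (-γ) :=
    Real.one_le_rpow_of_pos_of_le_one_of_nonpos hε0 hε1.2 (by linarith [hγ.1])
  have hεG : ε * ε ^ (-γ) ≤ 1 := by
    have h := Real.rpow_add hε0 1 (-γ)
    rw [Real.rpow_one] at h
    rw [← h]
    exact Real.rpow_le_one hε0.le hε1.2 (by linarith [hγ.2])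
  obtain ⟨T, hT0, hTT, hTmean, hTε⟩ : ∃ T > 0, T ≤ T₀ ∧ ((∀ i, mean (E0 ε) i = 0) → T₀ ≤ T) ∧
      ((∀ i, mean (E0 ε) i = 0) ∨ T ≤ ε) := by
    by_cases h : ∀ i, mean (E0 ε) i = 0
    · exact ⟨T₀, hT, le_rfl, fun _ => le_rfl, Or.inl h⟩
    -- A nonzero mean of E⁰ forces a time of order ε.
    · exact ⟨T₀ * ε, mul_pos hT hε0, mul_le_of_le_one_right hT.le hε1.2, fun h' => absurd h' h,
        Or.inr (mul_le_of_le_one_left hε0.le hT1)⟩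
  obtain ⟨P, hPa, hPb, hPlam, rfl⟩ : ∃ P : WeightPar, P.a = b + d ∧ P.b = b ∧
      P.lam = 2 * Q ^ 30 ∧ P.T = T :=
    ⟨⟨b + d, b, 2 * Q ^ 30, T, hb, by positivity, hT0, by
      have := min_le_right 1 d
      nlinarith⟩, rfl, rfl, rfl, rfl⟩
  have hcE : ∀ i, bNorm δ₀ (fun x => E0 ε x i) ≤ C₀ * ε ^ (-γ) := fun i =>
    (bNorm_le_bNormVec hδp.le _ i).trans
      (by linarith [hEB ε hε1, bNormVec_nonneg hδp.le (B0 ε)])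
  have hcB : ∀ i, bNorm δ₀ (fun x => B0 ε x i) ≤ C₀ * ε ^ (-γ) := fun i =>
    (bNorm_le_bNormVec hδp.le _ i).trans
      (by linarith [hEB ε hε1, bNormVec_nonneg hδp.le (E0 ε)])
  have hgauss := sum_dsym_eq_of_density hδ0 hρmeas hρ (hE ε hε1) (hdivE ε hε1)
  obtain ⟨D, afree, wfree, rfl, rfl, hD, hr, hx, hbin, hw⟩ :=
    Sys.exists_adapted P (hTT.trans hT1) hε0 hε1.2 hC₀.le hG hεG hK0.le (by rwa [hPa])
      (r₀ := fun θ => fourierCoef (ρ0 θ)) (x₀ := fun i θ => fourierCoef fun x => ξ0 θ x i)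
      (e₀ := fun i => fourierCoef fun x => E0 ε x i)
      (b₀ := fun i => fourierCoef fun x => B0 ε x i)
      (fun k => aestronglyMeasurable_fourierCoef (fun θ => (hρ θ).1.1) hρmeas k)
      (fun i k => aestronglyMeasurable_fourierCoef (fun θ => ((hξ θ).1 i).1)
        (fun x => hξmeas x i) k)
      (fun _ => herm_fourierCoef _) (fun _ _ => herm_fourierCoef _) (fun _ => herm_fourierCoef _)
      (fun _ => herm_fourierCoef _)
      (fun θ k => (hρ θ).1.norm_fourierCoef_le_of_bNorm_le hδp (hρ θ).2 k)
      (fun i θ k => ((hξ θ).1 i).norm_fourierCoef_le_of_bNorm_le hδp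
        ((bNorm_le_bNormVec hδp.le _ i).trans (hξ θ).2) k)
      (fun i k => (hE ε hε1 i).norm_fourierCoef_le_of_bNorm_le hδp (hcE i) k)
      (fun i k => (hB ε hε1 i).norm_fourierCoef_le_of_bNorm_le hδp (hcB i) k)
      (hTε.imp_left fun h i => by rw [← mean_eq_fourierCoef, h, Complex.ofReal_zero])
      (fun k hk => by simpa [hk] using hgauss k)
      -- The zero mode of Gauss's law is the neutrality of the data.
      (sub_eq_zero.1 (by simpa using (hgauss 0).symm))
      (sum_dsym_eq_zero hδ0 (hB ε hε1) (hdivB ε hε1))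
  rw [← hN_def] at hr hx hbin hw
  have hS : Sys.Small D (N + 1) Q :=
    { le_Q := by linarith
      R_le := by linarith
      R_nonneg := by linarith
      rin_le := by linarith
      xin_le := fun i => by linarith [hx i]
      -- Here γ ≤ 1 enters, through ε · ε^(-γ) ≤ 1.
      bin_le := fun i => by
        rw [norm_smul, Real.norm_of_nonneg hε0.le]
        have h1 := mul_le_mul_of_nonneg_left (hbin i) hε0.le
        nlinarith
      gain_le := by
        rw [WeightPar.gain, hPlam, add_mul, one_div, inv_mul_eq_div,
          div_mul_cancel_right₀ hQ.ne']
        have := min_le_left 1 d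
        nlinarith
      eps_small := by nlinarith [hε1.2] }
  obtain ⟨ρ, ξ, φ, A, At, Att, hsol, h1, h2⟩ := Sys.exists_isSolution hS hδ₁ hδ0.le
    (fun θ => (hρ θ).1) (fun θ => (hξ θ).1) (hE _ hε1) (hB _ hε1) hD hPb.ge hbin hw hG
  refine ⟨D.P.T, hT0, hTmean, ρ, ξ, φ, A, At, Att, hsol, fun θ θ' t _ t' _ =>
    (h1 θ θ' t t').trans (le_add_of_nonneg_right (by positivity)), fun t _ t' _ =>
    (h2 t t').trans (mul_le_mul_of_nonneg_right (le_add_of_nonneg_left (by positivity)) ?_)⟩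
  linarith
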